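/- Let $n\ge 1$. For a bounded measurable compactly supported $F:\mathbb R\times\mathbb R^n\to\mathbb C$, a solution of the Cauchy problem $$ i\partial_t u+\Delta u=F \ \text{ on } (0,\infty)\times\mathbb R^n,\qquad u(0,\cdot)=0, \tag{1}$$ means a function $u\in C([0,\infty);L^2(\mathbb R^n))$ with $u(0)=0$ such that, for every Schwartz function $\varphi$ on $\mathbb R^n$ and every $t\ge 0$, $$ i\int u(t)\varphi\,dx+\int_0^t\!\!\int u(s)\,\Delta\varphi\,dx\,ds=\int_0^t\!\!\int F(s,x)\varphi(x)\,dx\,ds .$$ For $q,r\in[1,\infty]$ write $\|f\|_{L^q_tL^r_x}$ for the norm of $t\mapsto\|f(t,\cdot)\|_{L^r(\mathbb R^n)}$ in $L^q((0,\infty))$. For $q,r,\tilde q,\tilde r\in[1,\infty]$, with conjugate exponents $\tilde q',\tilde r'$, the inhomogeneous Strichartz estimate is $$ \|u\|_{L^q_tL^r_x}\le C\,\|F\|_{L^{\tilde q'}_tL^{\tilde r'}_x}, \tag{2}$$ required, with some finite $C$ independent of $F$, for all such $F$ and every solution $u$ of (1). For $\eta,N>0$ let $$F_l(t,x)=e^{-iN^2t}\,\chi_{[0,1]}(t)\,\chi_{B(\eta/N)}(x),$$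 where $B(\rho)$ is the ball of radius $\rho$ about the origin, and $$\Omega_{\eta,N}=\{(t,x)\in[2,3]\times\mathbb R^n:\ 2(t-\tfrac34)N+\eta N^{-1}<|x|<2(t-\tfrac14)N-\eta N^{-1}\}.$$ (a) There are $\eta_0,N_0,c>0$ depending only on $n$ such that, for all $0<\eta\le\eta_0$ and all real $N\ge N_0$: $F_l$ is bounded, measurable and compactly supported, problem (1) with $F=F_l$ has a solution, and every solution $u_l$ agrees, for each $t\in[2,3]$ and almost every $x$, with a continuous function on $[2,3]\times\mathbb R^n$ which (again written $u_l$) satisfies $$|u_l(t,x)|\ge c\,\eta^n N^{-(1+n)}\qquad\text{for all }(t,x)\in\Omega_{\eta,N}.$$ Moreover, with the same $c$, for all $q,r,\tilde q,\tilde r\in[1,\infty]$, $$\|u_l\|_{L^q_tL^r_x}\ \ge\ c\,\eta^{\frac n{\tilde r}}N^{\frac nr-\frac n{\tilde r}-1}\,\|F_l\|_{L^{\tilde q'}_tL^{\tilde r'}_x}.$$ (b) For all $q,r,\tilde q,\tilde r\in[1,\infty]$, if the estimate (2) holds, then $$\Big|\frac1r-\frac1{\tilde r}\Big|\le\frac1n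 .$$ -/

import Mathlib

open MeasureTheory Set
open scoped ENNReal NNReal Laplacian SchwartzMap

noncomputable section

/-- The space `L²(ℝⁿ; ℂ)`. -/
abbrev L2Space (n : ℕ) : Type :=
  Lp ℂ 2 (volume : Measure (EuclideanSpace ℝ (Fin n)))

/-- The mixed norm `‖f‖_{L^q_t((0,∞); L^r_x(ℝⁿ))}`. -/
def mixedNorm {n : ℕ} (q r : ℝ≥0∞) (f : ℝ → EuclideanSpace ℝ (Fin n) → ℂ) : ℝ≥0∞ :=
  eLpNorm (fun t : ℝ => eLpNorm (f t) r volume) q (volume.restrict (Ioi (0 : ℝ)))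

/-- `u` solves the Cauchy problem `i ∂ₜu + Δu = F` on `(0,∞) × ℝⁿ`, `u(0) = 0`:
`u ∈ C([0,∞); L²(ℝⁿ))` and, integrated in time, the equation holds in the sense of
tempered distributions on `ℝⁿ`. Values of `u` and `F` at negative times play no role. -/
structure IsSchrodingerSolution {n : ℕ} (F : ℝ → EuclideanSpace ℝ (Fin n) → ℂ)
    (u : ℝ → L2Space n) : Prop where
  continuousOn : ContinuousOn u (Ici 0)
  initial : u 0 = 0
  weak : ∀ φ : 𝓢(EuclideanSpace ℝ (Fin n), ℂ), ∀ t : ℝ, 0 ≤ t →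
    Complex.I * (∫ x, u t x * φ x)
        + (∫ s in (0 : ℝ)..t, ∫ x, u s x * Laplacian.laplacian (φ : EuclideanSpace ℝ (Fin n) → ℂ) x)
      = ∫ s in (0 : ℝ)..t, ∫ x, F s x * φ x

/-- Admissible forcing terms: bounded measurable functions of `(t, x)` with compact support. -/
structure IsForcing {n : ℕ} (F : ℝ → EuclideanSpace ℝ (Fin n) → ℂ) : Prop where
  measurable : Measurable (Function.uncurry F)
  bounded : ∃ M : ℝ, ∀ t x, ‖F t x‖ ≤ M
  compactSupport : HasCompactSupport (Function.uncurry F)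

/-- The inhomogeneous Strichartz estimate
`‖u‖_{L^q_t L^r_x} ≲ ‖F‖_{L^{q̃'}_t L^{r̃'}_x}`, with a constant independent of `F`;
`qt`, `rt` stand for `q̃`, `r̃` and `F` runs over the admissible forcing terms. -/
def InhomogeneousStrichartz (n : ℕ) (q r qt rt : ℝ≥0∞) : Prop :=
  ∃ C : ℝ≥0, ∀ F : ℝ → EuclideanSpace ℝ (Fin n) → ℂ, IsForcing F →
    ∀ u : ℝ → L2Space n, IsSchrodingerSolution F u →
      mixedNorm q r (fun t => (u t : EuclideanSpace ℝ (Fin n) → ℂ))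
        ≤ C * mixedNorm qt.conjExponent rt.conjExponent F

/-- The forcing term with linear phase,
`F_l(t,x) = e^{-iN²t} χ_{[0,1]}(t) χ_{B(η/N)}(x)`. -/
def linearForcing (n : ℕ) (η N : ℝ) (t : ℝ) (x : EuclideanSpace ℝ (Fin n)) : ℂ :=
  Complex.exp (-Complex.I * (N : ℂ) ^ 2 * (t : ℂ))
    * (Icc (0 : ℝ) 1).indicator (fun _ => (1 : ℂ)) t
    * (Metric.ball (0 : EuclideanSpace ℝ (Fin n)) (η / N)).indicator (fun _ => (1 : ℂ)) x

/-- The region `Ω_{η,N}`: for each `t ∈ [2,3]` a spherical shell of radius and thickness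
comparable to `N`. -/
def shellRegion (n : ℕ) (η N : ℝ) : Set (ℝ × EuclideanSpace ℝ (Fin n)) :=
  {p | p.1 ∈ Icc (2 : ℝ) 3 ∧ 2 * (p.1 - 3 / 4) * N + η * N⁻¹ < ‖p.2‖ ∧
    ‖p.2‖ < 2 * (p.1 - 1 / 4) * N - η * N⁻¹}

end

/-! The solution is unique and given by Duhamel's formula. For a forcing supported in times [0,1]
and t ≥ 2 the elapsed time τ = t - s is at least 1, so the solution is an absolutely convergent
integral against the kernel (4πiτ)^{-n/2} exp(i|z|²/4τ), z = y - x. With the factor e^{-iN²s}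
inserted, the phase in τ is N²τ + |z|²/4τ up to a constant, stationary at T = |z|/2N. The shell Ω is
chosen so that, for every y in B(η/N), T stays in [t - 3/4, t - 1/4], well inside the range [t - 1,
t] of τ. The time integral is then of size 1/N times e^{iN|z|}, and this factor varies by at most η
as y runs through B(η/N). Nothing cancels, and integrating over a ball of volume comparable to
(η/N)^n gives η^n N^{-(1+n)} (`exists_freeSolution_lower_bound`). The norm inequality in (a) follows
by comparing with the norm of F_l, since for each t in [2,3] the shell contains a ball of radius
N/4.

Stationary phase is carried out by hand. With h = (τ - T)/√τ one has N²τ + |z|²/4τ - N|z| = (N h)²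
exactly. The amplitude τ^{-n/2} splits as α h' + k h h' with α constant: the first term becomes a
Fresnel integral under σ = N h, and the second is k times an exact derivative, so that integration
by parts makes it O(N^{-2}) (`inv_pow_eq_stationary`, `exists_stationary_phase`).

For (b), inserting F_l in (2) and letting N → ∞ gives 1/r - 1/r̃ ≤ 1/n. The reverse inequality is a
duality argument. The solution map is symmetric for the time reversed pairing ∫ F(s) u_G(3 - s) = ∫
G(s) u_F(3 - s). Taking F = F_l and G unimodular, aligned with u_l and supported in |x| < 6N, the
right side controls the L¹ size of u_l on the shell, while the left side is bounded by Hölder on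
B(η/N) and by (2) applied to G (`mul_volume_le_of_strichartz`). -/

noncomputable section

open scoped FourierTransform
open Filter Topology

/-! ### The bilinear pairing and the Fourier transform on L² -/

/-- The bilinear pairing `(f, g) ↦ ∫ f g` on `L²(ℝⁿ)`. -/
def l2Pairing (n : ℕ) : L2Space n →L[ℂ] L2Space n →L[ℂ] ℂ :=
  (ContinuousLinearMap.mul ℂ ℂ).lpPairing volume 2 2

theorem l2Pairing_eq_integral {n : ℕ} (f g : L2Space n) :
    l2Pairing n f g = ∫ x, f x * g x := by
  simp [l2Pairing, ContinuousLinearMap.lpPairing_eq_integral]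

/-- The embedding of Schwartz functions into `L²(ℝⁿ)`. -/
def schwartzToL2 (n : ℕ) : 𝓢(EuclideanSpace ℝ (Fin n), ℂ) →L[ℂ] L2Space n :=
  SchwartzMap.toLpCLM ℂ ℂ 2 volume

theorem schwartzToL2_apply {n : ℕ} (φ : 𝓢(EuclideanSpace ℝ (Fin n), ℂ)) :
    schwartzToL2 n φ = φ.toLp 2 volume := rfl

theorem denseRange_schwartzToL2 (n : ℕ) : DenseRange (schwartzToL2 n) :=
  SchwartzMap.denseRange_toLpCLM ENNReal.ofNat_ne_top

attribute [irreducible] schwartzToL2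

theorem schwartzToL2_ae_eq {n : ℕ} (φ : 𝓢(EuclideanSpace ℝ (Fin n), ℂ)) :
    schwartzToL2 n φ =ᵐ[volume] φ := by
  rw [schwartzToL2_apply]
  exact φ.coeFn_toLp 2 volume

theorem l2Pairing_schwartz {n : ℕ} (f : L2Space n) (φ : 𝓢(EuclideanSpace ℝ (Fin n), ℂ)) :
    l2Pairing n f (schwartzToL2 n φ) = ∫ x, f x * φ x := by
  rw [l2Pairing_eq_integral]
  refine integral_congr_ae ?_
  filter_upwards [schwartzToL2_ae_eq φ] with x hx
  rw [hx]

theorem l2Pairing_schwartz_schwartz {n : ℕ} (φ ψ : 𝓢(EuclideanSpace ℝ (Fin n), ℂ)) :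
    l2Pairing n (schwartzToL2 n φ) (schwartzToL2 n ψ) = ∫ x, φ x * ψ x := by
  rw [l2Pairing_schwartz]
  refine integral_congr_ae ?_
  filter_upwards [schwartzToL2_ae_eq φ] with x hx
  rw [hx]

/-- The inverse Fourier transform on `L²(ℝⁿ)`. -/
def l2FourierInv (n : ℕ) : L2Space n →L[ℂ] L2Space n :=
  FourierTransform.fourierInvCLM ℂ (L2Space n)

/-- The Fourier transform on `L²(ℝⁿ)`. -/
def l2Fourier (n : ℕ) : L2Space n →L[ℂ] L2Space n :=
  FourierTransform.fourierCLM ℂ (L2Space n)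

theorem l2Fourier_apply {n : ℕ} (f : L2Space n) : l2Fourier n f = 𝓕 f := rfl

theorem l2FourierInv_apply {n : ℕ} (f : L2Space n) : l2FourierInv n f = 𝓕⁻ f := rfl

theorem l2Fourier_schwartz {n : ℕ} (φ : 𝓢(EuclideanSpace ℝ (Fin n), ℂ)) :
    l2Fourier n (schwartzToL2 n φ) = schwartzToL2 n (𝓕 φ) := by
  rw [l2Fourier_apply, schwartzToL2_apply, SchwartzMap.toLp_fourier_eq, schwartzToL2_apply]

theorem l2FourierInv_schwartz {n : ℕ} (φ : 𝓢(EuclideanSpace ℝ (Fin n), ℂ)) :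
    l2FourierInv n (schwartzToL2 n φ) = schwartzToL2 n (𝓕⁻ φ) := by
  rw [l2FourierInv_apply, schwartzToL2_apply, SchwartzMap.toLp_fourierInv_eq, schwartzToL2_apply]

attribute [irreducible] l2Fourier l2FourierInv l2Pairing

theorem l2FourierInv_l2Fourier {n : ℕ} (f : L2Space n) : l2FourierInv n (l2Fourier n f) = f := by
  simp [l2Fourier_apply, l2FourierInv_apply]

theorem l2Fourier_l2FourierInv {n : ℕ} (f : L2Space n) : l2Fourier n (l2FourierInv n f) = f := by
  simp [l2Fourier_apply, l2FourierInv_apply]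

theorem norm_l2Fourier {n : ℕ} (f : L2Space n) : ‖l2Fourier n f‖ = ‖f‖ :=
  by rw [l2Fourier_apply, Lp.norm_fourier_eq]

theorem norm_l2FourierInv {n : ℕ} (f : L2Space n) : ‖l2FourierInv n f‖ = ‖f‖ := by
  rw [← norm_l2Fourier, l2Fourier_l2FourierInv]

theorem l2Pairing_l2FourierInv_schwartz {n : ℕ} (φ ψ : 𝓢(EuclideanSpace ℝ (Fin n), ℂ)) :
    l2Pairing n (l2FourierInv n (schwartzToL2 n φ)) (schwartzToL2 n ψ) =
      l2Pairing n (schwartzToL2 n φ) (l2FourierInv n (schwartzToL2 n ψ)) := by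
  rw [l2FourierInv_schwartz, l2FourierInv_schwartz, l2Pairing_schwartz_schwartz,
    l2Pairing_schwartz_schwartz]
  exact SchwartzMap.integral_fourierInv_mul_eq φ ψ

/-- Both sides are continuous in each variable, so density of Schwartz functions reduces the claim
to them. The pairing is bilinear rather than sesquilinear, which makes the transform its own
transpose, with no conjugation or change to the other transform. -/
theorem l2Pairing_l2FourierInv {n : ℕ} (f g : L2Space n) :
    l2Pairing n (l2FourierInv n f) g = l2Pairing n f (l2FourierInv n g) := by
  have hR : ∀ f : L2Space n, Continuous fun g => l2Pairing n f (l2FourierInv n g) :=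
    fun f => (l2Pairing n f).continuous.comp (l2FourierInv n).continuous
  have hL : ∀ g : L2Space n, Continuous fun f => l2Pairing n (l2FourierInv n f) g :=
    fun g => ((l2Pairing n).flip g).continuous.comp (l2FourierInv n).continuous
  have hd := denseRange_schwartzToL2 n
  refine congrFun (hd.equalizer (hL g) ((l2Pairing n).flip (l2FourierInv n g)).continuous
    (funext fun φ => ?_)) f
  exact congrFun (hd.equalizer (l2Pairing n (l2FourierInv n (schwartzToL2 n φ))).continuous
    (hR (schwartzToL2 n φ)) (funext fun ψ => l2Pairing_l2FourierInv_schwartz φ ψ)) g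

theorem l2Pairing_l2Fourier {n : ℕ} (f g : L2Space n) :
    l2Pairing n (l2Fourier n f) g = l2Pairing n f (l2Fourier n g) := by
  have := l2Pairing_l2FourierInv (l2Fourier n f) (l2Fourier n g)
  rw [l2FourierInv_l2Fourier, l2FourierInv_l2Fourier] at this
  exact this.symm

/-- A locally integrable function is determined by its integrals against Schwartz functions. -/
theorem ae_eq_of_integral_mul_schwartz_eq {n : ℕ} {f g : EuclideanSpace ℝ (Fin n) → ℂ}
    (hf : LocallyIntegrable f) (hg : LocallyIntegrable g)
    (h : ∀ φ : 𝓢(EuclideanSpace ℝ (Fin n), ℂ), HasCompactSupport φ →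
      ∫ x, f x * φ x = ∫ x, g x * φ x) : f =ᵐ[volume] g := by
  refine ae_eq_of_integral_contDiff_smul_eq hf hg fun ρ hρ hρc => ?_
  have hc : HasCompactSupport (Complex.ofRealCLM ∘ ρ) := hρc.comp_left (by simp)
  have := h (hc.toSchwartzMap (Complex.ofRealCLM.contDiff.comp hρ)) hc
  simpa [mul_comm] using this

theorem L2Space.locallyIntegrable {n : ℕ} (f : L2Space n) :
    LocallyIntegrable (f : EuclideanSpace ℝ (Fin n) → ℂ) :=
  (Lp.memLp f).locallyIntegrable (by norm_num)

theorem L2Space.ext_pairing {n : ℕ} {f g : L2Space n}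
    (h : ∀ φ : 𝓢(EuclideanSpace ℝ (Fin n), ℂ), HasCompactSupport φ →
      l2Pairing n f (schwartzToL2 n φ) = l2Pairing n g (schwartzToL2 n φ)) : f = g := by
  refine Lp.ext (ae_eq_of_integral_mul_schwartz_eq f.locallyIntegrable g.locallyIntegrable ?_)
  intro φ hφ
  rw [← l2Pairing_schwartz, ← l2Pairing_schwartz, h φ hφ]

/-- On `L¹ ∩ L²` the inverse `L²` Fourier transform is given by the Fourier integral. -/
theorem l2FourierInv_toLp_ae_eq {n : ℕ} {f : EuclideanSpace ℝ (Fin n) → ℂ}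
    (h1 : Integrable f) (h2 : MemLp f 2 volume) :
    l2FourierInv n (h2.toLp f) =ᵐ[volume] 𝓕⁻ f := by
  have hL : Continuous fun p : EuclideanSpace ℝ (Fin n) × EuclideanSpace ℝ (Fin n) =>
      (-innerₗ (EuclideanSpace ℝ (Fin n))) p.1 p.2 := by
    exact (continuous_inner (𝕜 := ℝ) (E := EuclideanSpace ℝ (Fin n))).neg
  have hc : Continuous (𝓕⁻ f) :=
    VectorFourier.fourierIntegral_continuous Real.continuous_fourierChar hL h1
  refine ae_eq_of_integral_mul_schwartz_eq (L2Space.locallyIntegrable _) hc.locallyIntegrable ?_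
  intro φ _
  -- Both transforms of f are moved onto the test function: the L² one by transposition, the
  -- integral one by Fubini for integrable functions.
  rw [← l2Pairing_schwartz, l2Pairing_l2FourierInv, l2FourierInv_schwartz, l2Pairing_schwartz]
  have : (∫ x, (h2.toLp f) x * 𝓕⁻ φ x) = ∫ x, f x * 𝓕⁻ (φ : EuclideanSpace ℝ (Fin n) → ℂ) x :=
    integral_congr_ae (by
      filter_upwards [h2.coeFn_toLp] with x hx
      rw [hx, ← SchwartzMap.fourierInv_coe])
  rw [this]
  have := VectorFourier.integral_bilin_fourierIntegral_eq_flip (ContinuousLinearMap.mul ℂ ℂ)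
    (L := -innerₗ (EuclideanSpace ℝ (Fin n))) (μ := volume) (ν := volume)
    Real.continuous_fourierChar hL h1 φ.integrable
  simp only [Real.fourierInv_eq]
  simpa [VectorFourier.fourierIntegral, real_inner_comm] using this.symm

/-! ### The Schrödinger group as a multiplier on the frequency side -/

/-- The symbol of the free Schrödinger group at time `t`. -/
def schrodingerSymbol (n : ℕ) (t : ℝ) (ξ : EuclideanSpace ℝ (Fin n)) : ℂ :=
  Complex.exp (-(((2 * Real.pi) ^ 2 * ‖ξ‖ ^ 2 * t : ℝ) : ℂ) * Complex.I)

theorem norm_schrodingerSymbol {n : ℕ} (t : ℝ) (ξ : EuclideanSpace ℝ (Fin n)) :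
    ‖schrodingerSymbol n t ξ‖ = 1 := by
  rw [schrodingerSymbol, ← Complex.ofReal_neg, Complex.norm_exp_ofReal_mul_I]

theorem continuous_schrodingerSymbol (n : ℕ) :
    Continuous fun p : ℝ × EuclideanSpace ℝ (Fin n) => schrodingerSymbol n p.1 p.2 := by
  unfold schrodingerSymbol; fun_prop

theorem continuous_schrodingerSymbol_left {n : ℕ} (ξ : EuclideanSpace ℝ (Fin n)) :
    Continuous fun t : ℝ => schrodingerSymbol n t ξ := by
  unfold schrodingerSymbol; fun_prop

theorem schrodingerSymbol_add {n : ℕ} (s t : ℝ) (ξ : EuclideanSpace ℝ (Fin n)) :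
    schrodingerSymbol n (s + t) ξ = schrodingerSymbol n s ξ * schrodingerSymbol n t ξ := by
  rw [schrodingerSymbol, schrodingerSymbol, schrodingerSymbol, ← Complex.exp_add]
  push_cast; ring_nf

theorem schrodingerSymbol_zero {n : ℕ} (ξ : EuclideanSpace ℝ (Fin n)) :
    schrodingerSymbol n 0 ξ = 1 := by simp [schrodingerSymbol]

theorem memLp_schrodingerSymbol (n : ℕ) (t : ℝ) : MemLp (schrodingerSymbol n t) ∞ volume :=
  memLp_top_of_bound ((continuous_schrodingerSymbol n).comp
    (Continuous.prodMk_right t)).aestronglyMeasurable 1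
    (Eventually.of_forall fun ξ => (norm_schrodingerSymbol t ξ).le)

/-- Multiplication by the Schrödinger symbol, as an operator on `L²(ℝⁿ)`. -/
def phaseMul (n : ℕ) (t : ℝ) : L2Space n →L[ℂ] L2Space n :=
  (ContinuousLinearMap.mul ℂ ℂ).holderL volume ∞ 2 2 ((memLp_schrodingerSymbol n t).toLp _)

theorem phaseMul_ae_eq {n : ℕ} (t : ℝ) (f : L2Space n) :
    phaseMul n t f =ᵐ[volume] fun ξ => schrodingerSymbol n t ξ * f ξ := by
  have h := (ContinuousLinearMap.mul ℂ ℂ).coeFn_holder (r := 2)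
    ((memLp_schrodingerSymbol n t).toLp _) f
  filter_upwards [h, (memLp_schrodingerSymbol n t).coeFn_toLp] with ξ h1 h2
  rw [h2] at h1
  exact h1

attribute [irreducible] phaseMul

theorem norm_phaseMul {n : ℕ} (t : ℝ) (f : L2Space n) : ‖phaseMul n t f‖ = ‖f‖ := by
  rw [Lp.norm_def, Lp.norm_def]
  congr 1
  refine eLpNorm_congr_norm_ae ?_
  filter_upwards [phaseMul_ae_eq t f] with ξ h
  rw [h, norm_mul, norm_schrodingerSymbol, one_mul]

theorem phaseMul_add {n : ℕ} (s t : ℝ) (f : L2Space n) :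
    phaseMul n (s + t) f = phaseMul n s (phaseMul n t f) := by
  refine Lp.ext ?_
  filter_upwards [phaseMul_ae_eq (s + t) f, phaseMul_ae_eq s (phaseMul n t f),
    phaseMul_ae_eq t f] with ξ h1 h2 h3
  rw [h1, h2, h3, schrodingerSymbol_add, mul_assoc]

theorem phaseMul_zero {n : ℕ} (f : L2Space n) : phaseMul n 0 f = f := by
  refine Lp.ext ?_
  filter_upwards [phaseMul_ae_eq 0 f] with ξ h1
  rw [h1, schrodingerSymbol_zero, one_mul]

/-- Weak continuity of the group: dominated convergence, the symbol being unimodular and continuous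
in t. -/
theorem continuous_inner_phaseMul {n : ℕ} (f g : L2Space n) :
    Continuous fun t => inner ℂ g (phaseMul n t f) := by
  have h : ∀ t, inner ℂ g (phaseMul n t f) =
      ∫ ξ, schrodingerSymbol n t ξ * inner ℂ (g ξ) (f ξ) := by
    intro t
    rw [L2.inner_def]
    refine integral_congr_ae ?_
    filter_upwards [phaseMul_ae_eq t f] with ξ h
    rw [h, ← smul_eq_mul, inner_smul_right]
  simp_rw [h]
  refine continuous_of_dominated (bound := fun ξ => ‖inner ℂ (g ξ) (f ξ)‖) (fun t => ?_)
    (fun t => ?_) (L2.integrable_inner g f).norm ?_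
  · exact (memLp_schrodingerSymbol n t).aestronglyMeasurable.mul
      (L2.integrable_inner g f).aestronglyMeasurable
  · exact Eventually.of_forall fun ξ => by rw [norm_mul, norm_schrodingerSymbol, one_mul]
  · exact Eventually.of_forall fun ξ =>
      (continuous_schrodingerSymbol_left ξ).mul continuous_const

/-- The group preserves norms, so weak continuity upgrades to strong continuity through ‖a - b‖² =
2‖f‖² - 2 Re⟨b, a⟩. -/
theorem continuous_phaseMul_apply {n : ℕ} (f : L2Space n) :
    Continuous fun t => phaseMul n t f := by
  rw [continuous_iff_continuousAt]
  intro s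
  rw [ContinuousAt, tendsto_iff_norm_sub_tendsto_zero]
  have h : ∀ t, ‖phaseMul n t f - phaseMul n s f‖ =
      Real.sqrt (2 * ‖f‖ ^ 2 - 2 * RCLike.re (inner ℂ (phaseMul n s f) (phaseMul n t f))) := by
    intro t
    rw [← Real.sqrt_sq (norm_nonneg (phaseMul n t f - phaseMul n s f)), @norm_sub_sq ℂ,
      norm_phaseMul, norm_phaseMul, ← inner_conj_symm, RCLike.conj_re]
    ring_nf
  simp_rw [h]
  have hc : Continuous fun t => Real.sqrt (2 * ‖f‖ ^ 2 -
      2 * RCLike.re (inner ℂ (phaseMul n s f) (phaseMul n t f))) := by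
    have := continuous_inner_phaseMul f (phaseMul n s f)
    fun_prop
  have := hc.tendsto s
  rwa [inner_self_eq_norm_sq, norm_phaseMul, sub_self, Real.sqrt_zero] at this

/-- Joint continuity is what makes s ↦ `phaseMul n (-s) (g s)` strongly measurable when g is. -/
theorem continuous_phaseMul (n : ℕ) :
    Continuous fun p : ℝ × L2Space n => phaseMul n p.1 p.2 := by
  rw [continuous_iff_continuousAt]
  rintro ⟨s, f⟩
  rw [ContinuousAt, tendsto_iff_norm_sub_tendsto_zero]
  have h0 : Tendsto (fun p : ℝ × L2Space n => ‖p.2 - f‖ + ‖phaseMul n p.1 f - phaseMul n s f‖)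
      (𝓝 (s, f)) (𝓝 0) := by
    have hc : Continuous fun p : ℝ × L2Space n =>
        ‖p.2 - f‖ + ‖phaseMul n p.1 f - phaseMul n s f‖ := by
      have := (continuous_phaseMul_apply f).comp (continuous_fst (X := ℝ) (Y := L2Space n))
      exact (continuous_snd.sub continuous_const).norm.add (this.sub continuous_const).norm
    simpa using hc.tendsto (s, f)
  refine squeeze_zero (fun _ => norm_nonneg _) (fun p => ?_) h0
  have : phaseMul n p.1 p.2 - phaseMul n s f =
      phaseMul n p.1 (p.2 - f) + (phaseMul n p.1 f - phaseMul n s f) := by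
    rw [map_sub]; abel
  rw [this]
  refine (norm_add_le _ _).trans ?_
  rw [norm_phaseMul]

/-- The Schwartz function `(2π)²|ξ|² ψ(ξ)`. -/
def symbolMul (n : ℕ) (ψ : 𝓢(EuclideanSpace ℝ (Fin n), ℂ)) : 𝓢(EuclideanSpace ℝ (Fin n), ℂ) :=
  SchwartzMap.smulLeftCLM ℂ (fun ξ : EuclideanSpace ℝ (Fin n) => (2 * Real.pi) ^ 2 * ‖ξ‖ ^ 2) ψ

theorem symbolMul_apply {n : ℕ} (ψ : 𝓢(EuclideanSpace ℝ (Fin n), ℂ))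
    (ξ : EuclideanSpace ℝ (Fin n)) :
    symbolMul n ψ ξ = (((2 * Real.pi) ^ 2 * ‖ξ‖ ^ 2 : ℝ) : ℂ) * ψ ξ := by
  rw [symbolMul, SchwartzMap.smulLeftCLM_apply_apply (by fun_prop)]
  simp

theorem fourier_laplacian {n : ℕ} (φ : 𝓢(EuclideanSpace ℝ (Fin n), ℂ)) :
    𝓕 (Δ φ) = -symbolMul n (𝓕 φ) := by
  rw [SchwartzMap.laplacian_eq_fourierMultiplierCLM, SchwartzMap.fourierMultiplierCLM_apply,
    FourierTransform.fourier_smul, FourierTransform.fourier_fourierInv_eq]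
  ext ξ
  have h2 : (‖·‖ ^ 2 : EuclideanSpace ℝ (Fin n) → ℝ) = fun ξ => ‖ξ‖ ^ 2 := rfl
  rw [h2, smul_apply, neg_apply, symbolMul_apply,
    SchwartzMap.smulLeftCLM_apply_apply (by fun_prop)]
  simp [mul_assoc]

theorem l2Pairing_phaseMul {n : ℕ} (t : ℝ) (h : L2Space n)
    (ψ : 𝓢(EuclideanSpace ℝ (Fin n), ℂ)) :
    l2Pairing n (phaseMul n t h) (schwartzToL2 n ψ) = ∫ ξ, schrodingerSymbol n t ξ * h ξ * ψ ξ := by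
  rw [l2Pairing_schwartz]
  refine integral_congr_ae ?_
  filter_upwards [phaseMul_ae_eq t h] with ξ hξ
  rw [hξ]

theorem L2Space.integrable_mul_schwartz {n : ℕ} (h : L2Space n)
    (ψ : 𝓢(EuclideanSpace ℝ (Fin n), ℂ)) : Integrable fun ξ => h ξ * ψ ξ :=
  (Lp.memLp h).integrable_mul (ψ.memLp 2)

/-- The factor |ξ|² produced by differentiation falls on the Schwartz function, so the pairing is
differentiable for every h in L², not only for h in the domain of the Laplacian. -/
theorem hasDerivAt_l2Pairing_phaseMul {n : ℕ} (h : L2Space n)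
    (ψ : 𝓢(EuclideanSpace ℝ (Fin n), ℂ)) (t : ℝ) :
    HasDerivAt (fun t => l2Pairing n (phaseMul n t h) (schwartzToL2 n ψ))
      (-Complex.I * l2Pairing n (phaseMul n t h) (schwartzToL2 n (symbolMul n ψ))) t := by
  simp_rw [l2Pairing_phaseMul]
  rw [← integral_const_mul]
  have hm : ∀ (φ : 𝓢(EuclideanSpace ℝ (Fin n), ℂ)) (t : ℝ), AEStronglyMeasurable
      (fun ξ => schrodingerSymbol n t ξ * h ξ * φ ξ) volume := fun φ t => by
    have := (memLp_schrodingerSymbol n t).aestronglyMeasurable.mul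
      (h.integrable_mul_schwartz φ).aestronglyMeasurable
    simpa [mul_assoc] using! this
  refine (hasDerivAt_integral_of_dominated_loc_of_deriv_le (s := univ) (x₀ := t)
    (F := fun t ξ => schrodingerSymbol n t ξ * h ξ * ψ ξ)
    (F' := fun t ξ => -Complex.I * (schrodingerSymbol n t ξ * h ξ * symbolMul n ψ ξ))
    (bound := fun ξ => ‖h ξ * symbolMul n ψ ξ‖) univ_mem
    (Eventually.of_forall fun t => hm ψ t) ?_ ((hm _ t).const_mul _)
    (Eventually.of_forall fun ξ t _ => ?_) (h.integrable_mul_schwartz _).norm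
    (Eventually.of_forall fun ξ t _ => ?_)).2
  · refine ((h.integrable_mul_schwartz ψ).norm).mono' (hm ψ t) (Eventually.of_forall fun ξ => ?_)
    rw [norm_mul, norm_mul, norm_schrodingerSymbol, one_mul, norm_mul]
  · simp only [norm_mul, norm_neg, Complex.norm_I, norm_schrodingerSymbol, one_mul, le_refl]
  · rw [symbolMul_apply]
    unfold schrodingerSymbol
    have h1 : HasDerivAt (fun t : ℝ => -(((2 * Real.pi) ^ 2 * ‖ξ‖ ^ 2 * t : ℝ) : ℂ) * Complex.I)
        (-(((2 * Real.pi) ^ 2 * ‖ξ‖ ^ 2 * 1 : ℝ) : ℂ) * Complex.I) t :=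
      ((((hasDerivAt_id t).const_mul _).ofReal_comp).neg).mul_const _
    convert! (h1.cexp.mul_const (h ξ)).mul_const (ψ ξ) using 1
    push_cast; ring

theorem l2Pairing_phaseMul_sub {n : ℕ} (h : L2Space n) (ψ : 𝓢(EuclideanSpace ℝ (Fin n), ℂ))
    (a b : ℝ) :
    ∫ t in a..b, l2Pairing n (phaseMul n t h) (schwartzToL2 n (symbolMul n ψ)) =
      Complex.I * (l2Pairing n (phaseMul n b h) (schwartzToL2 n ψ) -
        l2Pairing n (phaseMul n a h) (schwartzToL2 n ψ)) := by
  have hc : Continuous fun t => l2Pairing n (phaseMul n t h) (schwartzToL2 n (symbolMul n ψ)) := by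
    have := continuous_phaseMul_apply h
    fun_prop
  have := intervalIntegral.integral_eq_sub_of_hasDerivAt (a := a) (b := b)
    (fun t _ => hasDerivAt_l2Pairing_phaseMul h ψ t)
    ((continuous_const.mul hc).intervalIntegrable a b)
  rw [← this, intervalIntegral.integral_const_mul, ← mul_assoc]
  simp

/-! ### Forcing terms as bounded measurable curves in L² -/

/-- A map into a separable metric space is strongly measurable as soon as its distances to
points are measurable. -/
theorem stronglyMeasurable_of_measurable_edist {α X : Type*} [MeasurableSpace α]
    [PseudoMetricSpace X] [SecondCountableTopology X] {f : α → X}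
    (h : ∀ c : X, Measurable fun a => edist (f a) c) : StronglyMeasurable f := by
  let _ : MeasurableSpace X := borel X
  have : BorelSpace X := ⟨rfl⟩
  refine Measurable.stronglyMeasurable (measurable_of_isOpen fun U hU => ?_)
  choose! r hr0 hr using fun x (hx : x ∈ U) => EMetric.isOpen_iff.1 hU x hx
  obtain ⟨T, hTU, hTc, hT⟩ := TopologicalSpace.countable_cover_nhdsWithin
    (s := U) (f := fun x => Metric.eball x (r x))
    (fun x hx => mem_nhdsWithin_of_mem_nhds (Metric.eball_mem_nhds x (hr0 x hx)))
  have hU' : U = ⋃ x ∈ T, Metric.eball x (r x) :=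
    hT.antisymm (iUnion₂_subset fun x hx => hr x (hTU hx))
  rw [hU', preimage_iUnion₂]
  exact MeasurableSet.biUnion hTc fun x _ => measurableSet_lt (h x) measurable_const

theorem IsForcing.exists_support_bound {n : ℕ} {F : ℝ → EuclideanSpace ℝ (Fin n) → ℂ}
    (hF : IsForcing F) : ∃ R : ℝ, ∀ t x, F t x ≠ 0 → |t| ≤ R ∧ ‖x‖ ≤ R := by
  obtain ⟨R, hR⟩ := hF.compactSupport.isCompact.isBounded.exists_norm_le
  refine ⟨R, fun t x h => ?_⟩
  have := hR (t, x) (subset_tsupport _ h)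
  exact ⟨(norm_fst_le (t, x)).trans this, (norm_snd_le (t, x)).trans this⟩

theorem IsForcing.memLp {n : ℕ} {F : ℝ → EuclideanSpace ℝ (Fin n) → ℂ}
    (hF : IsForcing F) (p : ℝ≥0∞) (t : ℝ) : MemLp (F t) p volume := by
  obtain ⟨R, hR⟩ := hF.exists_support_bound
  obtain ⟨M, hM⟩ := hF.bounded
  have hi : F t = (Metric.closedBall 0 R).indicator (F t) := by
    refine (indicator_eq_self.2 fun x hx => ?_).symm
    simpa using (hR t x hx).2
  rw [hi, memLp_indicator_iff_restrict measurableSet_closedBall]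
  have : IsFiniteMeasure (volume.restrict
      (Metric.closedBall (0 : EuclideanSpace ℝ (Fin n)) R)) :=
    ⟨by simpa using (isCompact_closedBall _ _).measure_lt_top⟩
  exact MemLp.of_bound (hF.measurable.of_uncurry_left).aestronglyMeasurable M
    (Eventually.of_forall fun x => hM t x)

/-- The forcing term as a curve in `L²(ℝⁿ)`. -/
def IsForcing.slice {n : ℕ} {F : ℝ → EuclideanSpace ℝ (Fin n) → ℂ}
    (hF : IsForcing F) (t : ℝ) : L2Space n := (hF.memLp 2 t).toLp (F t)

theorem IsForcing.slice_ae_eq {n : ℕ} {F : ℝ → EuclideanSpace ℝ (Fin n) → ℂ}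
    (hF : IsForcing F) (t : ℝ) : hF.slice t =ᵐ[volume] F t := (hF.memLp 2 t).coeFn_toLp

theorem IsForcing.exists_norm_slice_le {n : ℕ} {F : ℝ → EuclideanSpace ℝ (Fin n) → ℂ}
    (hF : IsForcing F) : ∃ C : ℝ, ∀ t, ‖hF.slice t‖ ≤ C := by
  obtain ⟨R, hR⟩ := hF.exists_support_bound
  obtain ⟨M, hM⟩ := hF.bounded
  have hfin : volume (Metric.closedBall (0 : EuclideanSpace ℝ (Fin n)) R) ≠ ∞ :=
    (isCompact_closedBall _ _).measure_lt_top.ne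
  refine ⟨‖(indicatorConstLp 2 measurableSet_closedBall hfin (M : ℂ) : L2Space n)‖, fun t => ?_⟩
  refine Lp.norm_le_norm_of_ae_le ?_
  filter_upwards [hF.slice_ae_eq t, indicatorConstLp_coeFn (p := 2)
    (hs := measurableSet_closedBall) (hμs := hfin) (c := (M : ℂ))] with x h1 h2
  rw [h1, h2]
  by_cases hx : x ∈ Metric.closedBall (0 : EuclideanSpace ℝ (Fin n)) R
  · rw [indicator_of_mem hx, Complex.norm_real]
    exact (hM t x).trans (le_abs_self M)
  · have : F t x = 0 := by
      by_contra h
      exact hx (by simpa using (hR t x h).2)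
    simp [this]

/-- The distance to a fixed g is a power of a parameter integral, hence measurable in t by Tonelli;
separability of L² does the rest. -/
theorem IsForcing.stronglyMeasurable_slice {n : ℕ} {F : ℝ → EuclideanSpace ℝ (Fin n) → ℂ}
    (hF : IsForcing F) : StronglyMeasurable hF.slice := by
  have : Fact ((2 : ℝ≥0∞) ≠ ∞) := ⟨by simp⟩
  refine stronglyMeasurable_of_measurable_edist fun g => ?_
  have h : ∀ t, edist (hF.slice t) g = (∫⁻ x, ‖F t x - g x‖ₑ ^ (2 : ℝ)) ^ (1 / 2 : ℝ) := by
    intro t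
    rw [Lp.edist_def, eLpNorm_eq_lintegral_rpow_enorm_toReal (by simp) (by simp)]
    simp only [ENNReal.toReal_ofNat]
    congr 1
    refine lintegral_congr_ae ?_
    filter_upwards [hF.slice_ae_eq t] with x hx
    rw [Pi.sub_apply, hx]
  simp_rw [h]
  refine Measurable.pow_const ?_ _
  refine Measurable.lintegral_prod_right' (f := fun p : ℝ × EuclideanSpace ℝ (Fin n) =>
    ‖F p.1 p.2 - g p.2‖ₑ ^ (2 : ℝ)) ?_
  have h1 : Measurable fun p : ℝ × EuclideanSpace ℝ (Fin n) => F p.1 p.2 := hF.measurable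
  have h2 : Measurable fun p : ℝ × EuclideanSpace ℝ (Fin n) => g p.2 :=
    (Lp.stronglyMeasurable g).measurable.comp measurable_snd
  exact (h1.sub h2).enorm.pow_const _

/-! ### Duhamel's formula and existence -/

/-- Duhamel's formula on the Fourier side, for a forcing curve `g` in `L²`. -/
def duhamel (n : ℕ) (g : ℝ → L2Space n) (t : ℝ) : L2Space n :=
  -Complex.I • phaseMul n t (∫ s in (0 : ℝ)..t, phaseMul n (-s) (g s))

theorem stronglyMeasurable_phaseMul_comp {n : ℕ} {α : Type*} [MeasurableSpace α] {a : α → ℝ}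
    {g : α → L2Space n} (ha : Measurable a) (hg : StronglyMeasurable g) :
    StronglyMeasurable fun x => phaseMul n (a x) (g x) :=
  (continuous_phaseMul n).comp_stronglyMeasurable (ha.stronglyMeasurable.prodMk hg)

theorem intervalIntegrable_of_norm_le {E : Type*} [NormedAddCommGroup E] {g : ℝ → E}
    (hg : StronglyMeasurable g) {C : ℝ} (hC : ∀ s, ‖g s‖ ≤ C) (a b : ℝ) :
    IntervalIntegrable g volume a b :=
  (intervalIntegrable_const (c := C)).mono_fun' hg.aestronglyMeasurable
    (Eventually.of_forall fun s => hC s)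

theorem continuous_duhamel {n : ℕ} {g : ℝ → L2Space n} (hg : StronglyMeasurable g) {C : ℝ}
    (hC : ∀ s, ‖g s‖ ≤ C) : Continuous (duhamel n g) := by
  have h1 : Continuous fun t => ∫ s in (0 : ℝ)..t, phaseMul n (-s) (g s) :=
    intervalIntegral.continuous_primitive (fun a b => intervalIntegrable_of_norm_le
      (stronglyMeasurable_phaseMul_comp measurable_neg hg)
      (fun s => (norm_phaseMul _ _).trans_le (hC s)) a b) 0
  exact ((continuous_phaseMul n).comp (continuous_id.prodMk h1)).const_smul (-Complex.I)

theorem l2Pairing_duhamel {n : ℕ} {g : ℝ → L2Space n} (hg : StronglyMeasurable g) {C : ℝ}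
    (hC : ∀ s, ‖g s‖ ≤ C) (ψ : L2Space n) (t : ℝ) :
    l2Pairing n (duhamel n g t) ψ =
      -Complex.I * ∫ s in (0 : ℝ)..t, l2Pairing n (phaseMul n (t - s) (g s)) ψ := by
  have hi := intervalIntegrable_of_norm_le (stronglyMeasurable_phaseMul_comp measurable_neg hg)
      (fun s => (norm_phaseMul _ _).trans_le (hC s)) 0 t
  have h := ContinuousLinearMap.intervalIntegral_comp_comm
    (((l2Pairing n).flip ψ).comp (phaseMul n t)) hi
  rw [duhamel, map_smul, smul_apply, smul_eq_mul]
  congr 1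
  refine h.symm.trans (intervalIntegral.integral_congr fun s _ => ?_)
  rw [sub_eq_add_neg, phaseMul_add]
  rfl

/-- Fubini's theorem on a triangle. -/
theorem integral_triangle_swap {Φ : ℝ → ℝ → ℂ} (hΦ : StronglyMeasurable (Function.uncurry Φ))
    {C : ℝ} (hC : ∀ s r, ‖Φ s r‖ ≤ C) {t : ℝ} (ht : 0 ≤ t) :
    ∫ s in (0 : ℝ)..t, ∫ r in (0 : ℝ)..s, Φ s r = ∫ r in (0 : ℝ)..t, ∫ s in r..t, Φ s r := by
  set Ψ : ℝ → ℝ → ℂ := fun s r => {p : ℝ × ℝ | p.2 ≤ p.1}.indicator (Function.uncurry Φ) (s, r)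
    with hΨ
  have hm : StronglyMeasurable (Function.uncurry Ψ) :=
    hΦ.indicator (measurableSet_le measurable_snd measurable_fst)
  have hb : ∀ p, ‖Function.uncurry Ψ p‖ ≤ C := fun p =>
    (norm_indicator_le_norm_self _ _).trans (hC p.1 p.2)
  have h1 : ∀ s ∈ uIcc 0 t, ∫ r in (0 : ℝ)..s, Φ s r = ∫ r in (0 : ℝ)..t, Ψ s r := by
    intro s hs
    rw [uIcc_of_le ht] at hs
    rw [← intervalIntegral.integral_indicator hs]
    rfl
  have h2 : ∀ r ∈ uIcc 0 t, ∫ s in r..t, Φ s r = ∫ s in (0 : ℝ)..t, Ψ s r := by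
    intro r hr
    rw [uIcc_of_le ht] at hr
    rw [intervalIntegral.integral_of_le hr.2, intervalIntegral.integral_of_le ht,
      ← integral_Icc_eq_integral_Ioc, ← integral_Icc_eq_integral_Ioc]
    have : (fun s => Ψ s r) = (Ici r).indicator (fun s => Φ s r) := rfl
    rw [this, setIntegral_indicator measurableSet_Ici]
    congr 2
    ext s
    simp only [mem_Icc, mem_inter_iff, mem_Ici]
    exact ⟨fun h => ⟨⟨hr.1.trans h.1, h.2⟩, h.1⟩, fun h => ⟨h.2, h.1.2⟩⟩
  rw [intervalIntegral.integral_congr h1, intervalIntegral.integral_congr h2]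
  refine intervalIntegral_intervalIntegral_swap ?_
  refine Measure.integrableOn_of_bounded (M := C) ?_ hm.aestronglyMeasurable
    (Eventually.of_forall hb)
  rw [uIoc_of_le ht]
  simp [Measure.volume_eq_prod, ENNReal.mul_eq_top]

/-- After the swap on the triangle the inner integral over s ∈ [r, t] is evaluated by `h` and leaves
two boundary terms. The one at s = t cancels the first term on the left; the one at s = r is the
right-hand side. Only the relation `h` between χ and χ' enters. -/
theorem duhamel_weak_of_primitive {n : ℕ} {g : ℝ → L2Space n} (hg : StronglyMeasurable g)
    {C : ℝ} (hC : ∀ s, ‖g s‖ ≤ C) {χ χ' : L2Space n}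
    (h : ∀ (f : L2Space n) (b : ℝ), ∫ s in (0 : ℝ)..b, l2Pairing n (phaseMul n s f) χ' =
      Complex.I * (l2Pairing n (phaseMul n b f) χ - l2Pairing n f χ)) {t : ℝ} (ht : 0 ≤ t) :
    Complex.I * l2Pairing n (duhamel n g t) χ -
        ∫ s in (0 : ℝ)..t, l2Pairing n (duhamel n g s) χ' =
      ∫ s in (0 : ℝ)..t, l2Pairing n (g s) χ := by
  have hb : ∀ (χ : L2Space n) (a s : ℝ), ‖l2Pairing n (phaseMul n a (g s)) χ‖ ≤
      ‖l2Pairing n‖ * C * ‖χ‖ := fun χ a s => by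
    refine ((l2Pairing n).le_opNorm₂ _ _).trans ?_
    rw [norm_phaseMul]
    gcongr
    exact hC s
  have hcont : ∀ χ : L2Space n, Continuous fun f : L2Space n => l2Pairing n f χ :=
    fun χ => ((l2Pairing n).flip χ).continuous
  simp_rw [l2Pairing_duhamel hg hC, intervalIntegral.integral_const_mul]
  have h3 : ∀ r, ∫ s in r..t, l2Pairing n (phaseMul n (s - r) (g r)) χ' =
      Complex.I * (l2Pairing n (phaseMul n (t - r) (g r)) χ - l2Pairing n (g r) χ) := by
    intro r
    rw [intervalIntegral.integral_comp_sub_right (fun s => l2Pairing n (phaseMul n s (g r)) χ') r,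
      sub_self, h]
  rw [integral_triangle_swap (Φ := fun s r => l2Pairing n (phaseMul n (s - r) (g r)) χ') ?_
    (fun s r => hb χ' _ _) ht]
  · simp_rw [h3]
    rw [intervalIntegral.integral_const_mul, intervalIntegral.integral_sub]
    · linear_combination (-(∫ s in (0 : ℝ)..t, l2Pairing n (g s) χ)) * Complex.I_sq
    · exact intervalIntegrable_of_norm_le ((hcont χ).comp_stronglyMeasurable
        (stronglyMeasurable_phaseMul_comp (measurable_const.sub measurable_id) hg))
        (fun s => hb χ _ _) _ _
    · refine intervalIntegrable_of_norm_le ((hcont χ).comp_stronglyMeasurable hg)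
        (C := ‖l2Pairing n‖ * C * ‖χ‖) (fun s => ?_) _ _
      have := hb χ 0 s
      rwa [phaseMul_zero] at this
  · exact (hcont χ').comp_stronglyMeasurable (stronglyMeasurable_phaseMul_comp
      (measurable_fst.sub measurable_snd) (hg.comp_measurable measurable_snd))

theorem duhamel_weak {n : ℕ} {g : ℝ → L2Space n} (hg : StronglyMeasurable g) {C : ℝ}
    (hC : ∀ s, ‖g s‖ ≤ C) (ψ : 𝓢(EuclideanSpace ℝ (Fin n), ℂ)) {t : ℝ} (ht : 0 ≤ t) :
    Complex.I * l2Pairing n (duhamel n g t) (schwartzToL2 n ψ) -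
        ∫ s in (0 : ℝ)..t, l2Pairing n (duhamel n g s) (schwartzToL2 n (symbolMul n ψ)) =
      ∫ s in (0 : ℝ)..t, l2Pairing n (g s) (schwartzToL2 n ψ) :=
  duhamel_weak_of_primitive hg hC (fun f b => by rw [l2Pairing_phaseMul_sub, phaseMul_zero]) ht

theorem l2Fourier_laplacian {n : ℕ} (φ : 𝓢(EuclideanSpace ℝ (Fin n), ℂ)) :
    l2Fourier n (schwartzToL2 n (Δ φ)) = -schwartzToL2 n (symbolMul n (𝓕 φ)) := by
  rw [l2Fourier_schwartz, fourier_laplacian, map_neg]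

theorem l2Pairing_laplacian {n : ℕ} (f : L2Space n) (φ : 𝓢(EuclideanSpace ℝ (Fin n), ℂ)) :
    l2Pairing n f (schwartzToL2 n (Δ φ)) =
      ∫ x, f x * Laplacian.laplacian (φ : EuclideanSpace ℝ (Fin n) → ℂ) x := by
  rw [l2Pairing_schwartz]
  simp_rw [SchwartzMap.laplacian_apply]

theorem IsForcing.l2Pairing_slice {n : ℕ} {F : ℝ → EuclideanSpace ℝ (Fin n) → ℂ}
    (hF : IsForcing F) (t : ℝ) (φ : 𝓢(EuclideanSpace ℝ (Fin n), ℂ)) :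
    l2Pairing n (hF.slice t) (schwartzToL2 n φ) = ∫ x, F t x * φ x := by
  rw [l2Pairing_schwartz]
  refine integral_congr_ae ?_
  filter_upwards [hF.slice_ae_eq t] with x hx
  rw [hx]

/-- The solution of the Cauchy problem given by Duhamel's formula. -/
def IsForcing.solution {n : ℕ} {F : ℝ → EuclideanSpace ℝ (Fin n) → ℂ}
    (hF : IsForcing F) (t : ℝ) : L2Space n :=
  l2Fourier n (duhamel n (fun s => l2FourierInv n (hF.slice s)) t)

theorem IsForcing.stronglyMeasurable_fourierInv_slice {n : ℕ}
    {F : ℝ → EuclideanSpace ℝ (Fin n) → ℂ} (hF : IsForcing F) :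
    StronglyMeasurable fun s => l2FourierInv n (hF.slice s) :=
  (l2FourierInv n).continuous.comp_stronglyMeasurable hF.stronglyMeasurable_slice

theorem IsForcing.exists_norm_fourierInv_slice_le {n : ℕ}
    {F : ℝ → EuclideanSpace ℝ (Fin n) → ℂ} (hF : IsForcing F) :
    ∃ C : ℝ, ∀ s, ‖l2FourierInv n (hF.slice s)‖ ≤ C := by
  obtain ⟨C, hC⟩ := hF.exists_norm_slice_le
  exact ⟨C, fun s => (norm_l2FourierInv _).trans_le (hC s)⟩

/-- Since the transform is its own transpose, testing against φ is testing the Duhamel curve against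
𝓕 φ, and Δφ turns into minus the symbol times 𝓕 φ. This is why the frequency side is reached by the
inverse transform and left by the direct one; the symbol is even, so either choice is legitimate. -/
theorem IsForcing.isSchrodingerSolution {n : ℕ} {F : ℝ → EuclideanSpace ℝ (Fin n) → ℂ}
    (hF : IsForcing F) : IsSchrodingerSolution F hF.solution := by
  obtain ⟨C, hC⟩ := hF.exists_norm_fourierInv_slice_le
  have hg := hF.stronglyMeasurable_fourierInv_slice
  refine ⟨((l2Fourier n).continuous.comp (continuous_duhamel hg hC)).continuousOn, ?_, ?_⟩
  · simp [IsForcing.solution, duhamel]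
  · intro φ t ht
    have h := duhamel_weak hg hC (𝓕 φ) ht
    have h1 : ∀ t, ∫ x, hF.solution t x * φ x =
        l2Pairing n (duhamel n (fun s => l2FourierInv n (hF.slice s)) t)
          (schwartzToL2 n (𝓕 φ)) := by
      intro t
      rw [← l2Pairing_schwartz, IsForcing.solution, l2Pairing_l2Fourier, l2Fourier_schwartz]
    have h2 : ∀ t, ∫ x, hF.solution t x *
        Laplacian.laplacian (φ : EuclideanSpace ℝ (Fin n) → ℂ) x =
        -l2Pairing n (duhamel n (fun s => l2FourierInv n (hF.slice s)) t)
          (schwartzToL2 n (symbolMul n (𝓕 φ))) := by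
      intro t
      rw [← l2Pairing_laplacian, IsForcing.solution, l2Pairing_l2Fourier,
        l2Fourier_laplacian, map_neg]
    have h3 : ∀ s, l2Pairing n (l2FourierInv n (hF.slice s)) (schwartzToL2 n (𝓕 φ)) =
        ∫ x, F s x * φ x := by
      intro s
      rw [l2Pairing_l2FourierInv, ← l2Fourier_schwartz, l2FourierInv_l2Fourier, hF.l2Pairing_slice]
    simp_rw [h3] at h
    simp_rw [h1, h2]
    rw [intervalIntegral.integral_neg, ← sub_eq_add_neg]
    exact h

/-! ### Uniqueness -/

/-- Applying `hL` j times trades index growth B^j for the j-fold time integral t^j/j!, and the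
factorial wins. -/
theorem eq_zero_of_iterated_primitive {L : ℕ → ℝ → ℂ} {A B T : ℝ}
    (hL : ∀ k, ∀ t ∈ Icc 0 T, ‖L k t‖ ≤ ∫ s in (0 : ℝ)..t, ‖L (k + 1) s‖)
    (hb : ∀ k, ∀ t ∈ Icc 0 T, ‖L k t‖ ≤ A * B ^ k) {t : ℝ} (ht : t ∈ Icc 0 T) : L 0 t = 0 := by
  have key : ∀ j k, ∀ t ∈ Icc 0 T, ‖L k t‖ ≤ A * B ^ (k + j) * (t ^ j / j.factorial) := by
    intro j
    induction j with
    | zero => intro k t ht; simpa using hb k t ht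
    | succ j ih =>
      intro k t ht
      refine (hL k t ht).trans ?_
      have h1 : ∫ s in (0 : ℝ)..t, A * B ^ (k + 1 + j) * (s ^ j / j.factorial) =
          A * B ^ (k + (j + 1)) * (t ^ (j + 1) / (j + 1).factorial) := by
        rw [intervalIntegral.integral_const_mul, intervalIntegral.integral_div, integral_pow,
          Nat.factorial_succ]
        push_cast
        have : (j : ℝ) + 1 ≠ 0 := by positivity
        field_simp
        simp only [pow_succ, pow_add]
        ring
      rw [← h1]
      -- Nothing is assumed on the measurability of `L`, so the integral is compared through its
      -- absolute value, a bound that needs only the majorant to be integrable.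
      refine (le_abs_self _).trans ?_
      rw [← Real.norm_eq_abs]
      refine intervalIntegral.norm_integral_le_of_norm_le ht.1
        (Eventually.of_forall fun s hs => ?_) (Continuous.intervalIntegrable (by fun_prop) _ _)
      rw [norm_norm]
      exact ih (k + 1) s ⟨hs.1.le, hs.2.trans ht.2⟩
  have hlim : Tendsto (fun j : ℕ => A * ((B * t) ^ j / j.factorial)) atTop (𝓝 (A * 0)) :=
    (FloorSemiring.tendsto_pow_div_factorial_atTop (B * t)).const_mul A
  rw [mul_zero] at hlim
  refine norm_le_zero_iff.1 (ge_of_tendsto' hlim fun j => ?_)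
  refine (key j 0 t ht).trans_eq ?_
  rw [zero_add, mul_pow]; ring

theorem norm_symbolMul_le {n : ℕ} {ψ : 𝓢(EuclideanSpace ℝ (Fin n), ℂ)} {R : ℝ}
    (hψ : ∀ ξ, ψ ξ ≠ 0 → ‖ξ‖ ≤ R) :
    ‖(schwartzToL2 n (symbolMul n ψ))‖ ≤
      (2 * Real.pi) ^ 2 * R ^ 2 * ‖(schwartzToL2 n ψ)‖ := by
  refine Lp.norm_le_mul_norm_of_ae_le_mul ?_
  filter_upwards [schwartzToL2_ae_eq (symbolMul n ψ), schwartzToL2_ae_eq ψ] with ξ h1 h2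
  rw [h1, h2, symbolMul_apply, norm_mul, Complex.norm_real, Real.norm_of_nonneg (by positivity)]
  by_cases h : ψ ξ = 0
  · simp [h]
  · have := hψ ξ h
    gcongr

/-- Bernstein's inequality: on functions with frequencies in a ball of radius R the Laplacian
preserves the frequency support and has norm at most (2πR)². This supplies the geometric growth in
`eq_zero_of_iterated_primitive`. -/
theorem fourier_iterate_laplacian {n : ℕ} (φ : 𝓢(EuclideanSpace ℝ (Fin n), ℂ)) {R : ℝ}
    (hφ : ∀ ξ, 𝓕 φ ξ ≠ 0 → ‖ξ‖ ≤ R) (k : ℕ) :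
    (∀ ξ, 𝓕 ((Laplacian.laplacian)^[k] φ) ξ ≠ 0 → ‖ξ‖ ≤ R) ∧
      ‖(schwartzToL2 n ((Laplacian.laplacian)^[k] φ))‖ ≤
        ‖(schwartzToL2 n φ)‖ * ((2 * Real.pi) ^ 2 * R ^ 2) ^ k := by
  induction k with
  | zero => simpa using hφ
  | succ k ih =>
    rw [Function.iterate_succ_apply']
    generalize ((Laplacian.laplacian)^[k] φ) = χ at ih ⊢
    obtain ⟨h1, h2⟩ := ih
    constructor
    · intro ξ hξ
      rw [fourier_laplacian, neg_apply, symbolMul_apply] at hξ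
      exact h1 ξ (right_ne_zero_of_mul (neg_ne_zero.1 hξ))
    · rw [← norm_l2Fourier, l2Fourier_laplacian, norm_neg]
      refine (norm_symbolMul_le h1).trans ?_
      rw [← l2Fourier_schwartz, norm_l2Fourier, pow_succ]
      calc _ ≤ (2 * Real.pi) ^ 2 * R ^ 2 * _ := mul_le_mul_of_nonneg_left h2 (by positivity)
        _ = _ := by ring

theorem IsSchrodingerSolution.pairing_eq {n : ℕ} {F : ℝ → EuclideanSpace ℝ (Fin n) → ℂ}
    {u : ℝ → L2Space n} (hu : IsSchrodingerSolution F u)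
    (φ : 𝓢(EuclideanSpace ℝ (Fin n), ℂ)) {t : ℝ} (ht : 0 ≤ t) :
    Complex.I * l2Pairing n (u t) (schwartzToL2 n φ) +
      (∫ s in (0 : ℝ)..t, l2Pairing n (u s) (schwartzToL2 n (Δ φ))) =
        ∫ s in (0 : ℝ)..t, ∫ x, F s x * φ x := by
  simp_rw [l2Pairing_laplacian, l2Pairing_schwartz]
  exact hu.weak φ t ht

/-- The solution of the Cauchy problem is unique. -/
theorem IsSchrodingerSolution.unique {n : ℕ} {F : ℝ → EuclideanSpace ℝ (Fin n) → ℂ}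
    {u v : ℝ → L2Space n} (hu : IsSchrodingerSolution F u) (hv : IsSchrodingerSolution F v)
    {T : ℝ} (hT : 0 ≤ T) : u T = v T := by
  set d : ℝ → L2Space n := fun t => u t - v t with hd
  have hdc : ContinuousOn d (Icc 0 T) :=
    (hu.continuousOn.sub hv.continuousOn).mono Icc_subset_Ici_self
  obtain ⟨D, hD⟩ := isCompact_Icc.exists_bound_of_continuousOn hdc
  have hpc : ∀ (w : ℝ → L2Space n) (χ : L2Space n) (t : ℝ), ContinuousOn w (Icc 0 T) →
      t ∈ Icc 0 T → IntervalIntegrable (fun s => l2Pairing n (w s) χ) volume 0 t := by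
    intro w χ t hw ht
    refine ContinuousOn.intervalIntegrable ?_
    rw [uIcc_of_le ht.1]
    exact ((l2Pairing n).flip χ).continuous.comp_continuousOn (hw.mono (Icc_subset_Icc_right ht.2))
  -- The forcing cancels in the difference, leaving i⟨d(t), φ⟩ = -∫₀ᵗ ⟨d(s), Δφ⟩ ds, which can be
  -- iterated along φ, Δφ, Δ²φ, and so on.
  have hrec : ∀ φ : 𝓢(EuclideanSpace ℝ (Fin n), ℂ), ∀ t ∈ Icc 0 T,
      ‖l2Pairing n (d t) (schwartzToL2 n φ)‖ ≤
        ∫ s in (0 : ℝ)..t, ‖l2Pairing n (d s) (schwartzToL2 n (Δ φ))‖ := by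
    intro φ t ht
    have h1 := hu.pairing_eq φ ht.1
    have h2 := hv.pairing_eq φ ht.1
    generalize (schwartzToL2 n φ) = χ at h1 h2 ⊢
    generalize (schwartzToL2 n (Δ φ)) = χ' at h1 h2 ⊢
    have h3 : Complex.I * l2Pairing n (d t) χ = -∫ s in (0 : ℝ)..t, l2Pairing n (d s) χ' := by
      have h4 : ∫ s in (0 : ℝ)..t, l2Pairing n (d s) χ' =
          (∫ s in (0 : ℝ)..t, l2Pairing n (u s) χ') - ∫ s in (0 : ℝ)..t, l2Pairing n (v s) χ' := by
        rw [← intervalIntegral.integral_sub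
          (hpc u χ' t (hu.continuousOn.mono Icc_subset_Ici_self) ht)
          (hpc v χ' t (hv.continuousOn.mono Icc_subset_Ici_self) ht)]
        simp [hd]
      have h5 : l2Pairing n (d t) χ = l2Pairing n (u t) χ - l2Pairing n (v t) χ := by simp [hd]
      rw [h4, h5]
      linear_combination h1 - h2
    have h6 : ‖l2Pairing n (d t) χ‖ = ‖Complex.I * l2Pairing n (d t) χ‖ := by simp
    rw [h6, h3, norm_neg]
    exact intervalIntegral.norm_integral_le_integral_norm ht.1
  have hzero : ∀ φ : 𝓢(EuclideanSpace ℝ (Fin n), ℂ), 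
      HasCompactSupport (𝓕 φ : 𝓢(EuclideanSpace ℝ (Fin n), ℂ)) →
      l2Pairing n (d T) (schwartzToL2 n φ) = 0 := by
    intro φ hφ
    obtain ⟨R, hR⟩ := hφ.isCompact.isBounded.exists_norm_le
    have hφR : ∀ ξ, 𝓕 φ ξ ≠ 0 → ‖ξ‖ ≤ R := fun ξ h => hR ξ (subset_tsupport _ h)
    refine eq_zero_of_iterated_primitive (T := T)
      (L := fun k t => l2Pairing n (d t) (schwartzToL2 n ((Laplacian.laplacian)^[k] φ)))
      (A := ‖l2Pairing n‖ * D * ‖(schwartzToL2 n φ)‖) (B := (2 * Real.pi) ^ 2 * R ^ 2)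
      (fun k t ht => ?_) (fun k t ht => ?_) ⟨hT, le_rfl⟩
    · rw [Function.iterate_succ_apply']
      exact hrec _ t ht
    · refine ((l2Pairing n).le_opNorm₂ _ _).trans ?_
      rw [mul_assoc _ _ (_ ^ k)]
      have h1 := hD t ht
      have h2 := (fourier_iterate_laplacian φ hφR k).2
      have h3 : 0 ≤ D := (norm_nonneg _).trans h1
      gcongr
  -- Band-limited test functions are the inverse transforms of compactly supported Schwartz
  -- functions, and the latter separate points of L² on the frequency side.
  have hfin : l2FourierInv n (d T) = 0 := by
    refine L2Space.ext_pairing fun ψ hψ => ?_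
    have h := hzero (𝓕⁻ ψ) (by rwa [FourierTransform.fourier_fourierInv_eq])
    rw [← l2FourierInv_schwartz, ← l2Pairing_l2FourierInv] at h
    rw [h, map_zero]; rfl
  have : d T = 0 := by rw [← l2Fourier_l2FourierInv (d T), hfin, map_zero]
  exact sub_eq_zero.1 this

/-! ### The convolution kernel of the free evolution -/

/-- The Fourier transform of the complex Gaussian `exp (-b ‖·‖²)`. -/
def gaussKernel (n : ℕ) (b : ℂ) (z : EuclideanSpace ℝ (Fin n)) : ℂ :=
  (Real.pi / b) ^ (n / 2 : ℂ) * Complex.exp (-Real.pi ^ 2 * ‖z‖ ^ 2 / b)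

/-- The estimate survives up to the imaginary axis, where the Gaussian stops being integrable; it
provides the majorant for the limit Re b → 0. -/
theorem norm_gaussKernel_le {n : ℕ} {b : ℂ} (hb : 0 ≤ b.re) (z : EuclideanSpace ℝ (Fin n)) :
    ‖gaussKernel n b z‖ ≤ ‖(Real.pi / b : ℂ)‖ ^ (n / 2 : ℝ) := by
  rw [gaussKernel, norm_mul]
  have h1 : ‖(Real.pi / b : ℂ) ^ (n / 2 : ℂ)‖ = ‖(Real.pi / b : ℂ)‖ ^ (n / 2 : ℝ) := by
    have := Complex.norm_cpow_real (Real.pi / b : ℂ) (n / 2 : ℝ)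
    rw [← this]; push_cast; rfl
  have h2 : ‖Complex.exp (-Real.pi ^ 2 * ‖z‖ ^ 2 / b)‖ ≤ 1 := by
    rw [Complex.norm_exp, Real.exp_le_one_iff]
    have : (-Real.pi ^ 2 * ‖z‖ ^ 2 / b : ℂ) = ((-(Real.pi ^ 2 * ‖z‖ ^ 2) : ℝ) : ℂ) * b⁻¹ := by
      push_cast; ring
    rw [this, Complex.re_ofReal_mul, Complex.inv_re]
    have : 0 ≤ b.re / Complex.normSq b := div_nonneg hb (Complex.normSq_nonneg b)
    nlinarith [mul_nonneg (by positivity : 0 ≤ Real.pi ^ 2 * ‖z‖ ^ 2) this]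
  rw [h1]
  exact mul_le_of_le_one_right (by positivity) h2

theorem continuous_gaussKernel (n : ℕ) (b : ℂ) : Continuous (gaussKernel n b) := by
  unfold gaussKernel; fun_prop

/-- If b is not real then π/b avoids the branch cut of the complex power. -/
theorem tendsto_gaussKernel {n : ℕ} {b : ℂ} (hb : b.im ≠ 0) (z : EuclideanSpace ℝ (Fin n)) :
    ContinuousAt (fun b => gaussKernel n b z) b := by
  have hb0 : b ≠ 0 := fun h => hb (by simp [h])
  have hs : (Real.pi / b : ℂ) ∈ Complex.slitPlane := by
    refine Or.inr ?_
    rw [div_eq_mul_inv, Complex.im_ofReal_mul, Complex.inv_im]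
    exact mul_ne_zero Real.pi_ne_zero (div_ne_zero (neg_ne_zero.2 hb)
      (Complex.normSq_pos.2 hb0).ne')
  unfold gaussKernel
  refine ContinuousAt.mul ?_ ?_
  · exact (continuousAt_const.div continuousAt_id hb0).cpow continuousAt_const hs
  · exact (continuousAt_const.div continuousAt_id hb0).cexp

theorem continuous_neg_inner (n : ℕ) :
    Continuous fun p : EuclideanSpace ℝ (Fin n) × EuclideanSpace ℝ (Fin n) =>
      (-innerₗ (EuclideanSpace ℝ (Fin n))) p.1 p.2 :=
  (continuous_inner (𝕜 := ℝ) (E := EuclideanSpace ℝ (Fin n))).neg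

theorem continuous_fourierInv {n : ℕ} {f : EuclideanSpace ℝ (Fin n) → ℂ} (hf : Integrable f) :
    Continuous (𝓕⁻ f) :=
  VectorFourier.fourierIntegral_continuous Real.continuous_fourierChar (continuous_neg_inner n) hf

theorem integral_fourierInv_mul {n : ℕ} {f g : EuclideanSpace ℝ (Fin n) → ℂ}
    (hf : Integrable f) (hg : Integrable g) : ∫ x, 𝓕⁻ f x * g x = ∫ x, f x * 𝓕⁻ g x := by
  have := VectorFourier.integral_bilin_fourierIntegral_eq_flip (ContinuousLinearMap.mul ℂ ℂ)
    (L := -innerₗ (EuclideanSpace ℝ (Fin n))) (μ := volume) (ν := volume)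
    Real.continuous_fourierChar (continuous_neg_inner n) hf hg
  simp only [Real.fourierInv_eq]
  simpa [VectorFourier.fourierIntegral, real_inner_comm] using this

theorem integral_fourier_mul {n : ℕ} {f g : EuclideanSpace ℝ (Fin n) → ℂ}
    (hf : Integrable f) (hg : Integrable g) : ∫ x, 𝓕 f x * g x = ∫ x, f x * 𝓕 g x := by
  have := VectorFourier.integral_bilin_fourierIntegral_eq_flip (ContinuousLinearMap.mul ℂ ℂ)
    (L := innerₗ (EuclideanSpace ℝ (Fin n))) (μ := volume) (ν := volume)
    Real.continuous_fourierChar continuous_inner hf hg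
  simp only [Real.fourier_eq]
  simpa [VectorFourier.fourierIntegral, real_inner_comm] using this

theorem integrable_cexp_neg_mul_norm_sq {n : ℕ} {b : ℂ} (hb : 0 < b.re)
    (x : EuclideanSpace ℝ (Fin n)) :
    Integrable fun v => Complex.exp (-b * ‖v‖ ^ 2 + 2 * Real.pi * Complex.I * inner ℝ x v) :=
  GaussianFourier.integrable_cexp_neg_mul_sq_norm_add hb _ x

/-- The Gaussian Fourier multiplier acts by convolution with a Gaussian. -/
theorem fourierInv_gaussian_mul_fourier {n : ℕ} {b : ℂ} (hb : 0 < b.re)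
    (φ : 𝓢(EuclideanSpace ℝ (Fin n), ℂ)) (x : EuclideanSpace ℝ (Fin n)) :
    𝓕⁻ (fun ξ => Complex.exp (-b * ‖ξ‖ ^ 2) * 𝓕 (φ : EuclideanSpace ℝ (Fin n) → ℂ) ξ) x =
      ∫ y, gaussKernel n b (x - y) * φ y := by
  rw [Real.fourierInv_eq']
  have h1 := integral_fourier_mul (integrable_cexp_neg_mul_norm_sq hb x) φ.integrable
  simp_rw [fourier_gaussian_innerProductSpace' hb] at h1
  simp only [finrank_euclideanSpace, Fintype.card_fin] at h1
  unfold gaussKernel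
  rw [h1]
  refine integral_congr_ae (Eventually.of_forall fun ξ => ?_)
  simp only [smul_eq_mul, ← mul_assoc, ← Complex.exp_add]
  congr 2
  rw [real_inner_comm]
  push_cast; ring

theorem integral_gaussian_fourierInv_mul_fourier {n : ℕ} {b : ℂ} (hb : 0 < b.re)
    {f : EuclideanSpace ℝ (Fin n) → ℂ} (hf : Integrable f)
    (φ : 𝓢(EuclideanSpace ℝ (Fin n), ℂ)) :
    ∫ ξ, Complex.exp (-b * ‖ξ‖ ^ 2) * (𝓕⁻ f ξ * 𝓕 φ ξ) =
      ∫ x, f x * ∫ y, gaussKernel n b (x - y) * φ y := by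
  simp_rw [← fourierInv_gaussian_mul_fourier hb φ]
  rw [← integral_fourierInv_mul hf]
  · refine integral_congr_ae (Eventually.of_forall fun ξ => ?_)
    simp only [SchwartzMap.fourier_coe]
    ring
  · rw [← SchwartzMap.fourier_coe]
    refine (𝓕 φ).integrable.bdd_mul (c := 1) (by fun_prop) (Eventually.of_forall fun ξ => ?_)
    rw [Complex.norm_exp, Real.exp_le_one_iff]
    have : (-b * (‖ξ‖ : ℂ) ^ 2) = ((-‖ξ‖ ^ 2 : ℝ) : ℂ) * b := by push_cast; ring
    rw [this, Complex.re_ofReal_mul]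
    nlinarith [mul_nonneg (sq_nonneg ‖ξ‖) hb.le]

/-- The symbol is a Gaussian with purely imaginary parameter, for which the Fourier integral does
not converge absolutely. The identity is taken at b = ε + (2π)²τ i with ε > 0 and both sides pass to
the limit ε → 0+ by dominated convergence. -/
theorem l2Pairing_phaseMul_eq_gaussKernel {n : ℕ} {f : EuclideanSpace ℝ (Fin n) → ℂ}
    (hf : Integrable f) (hf2 : MemLp f 2 volume) (φ : 𝓢(EuclideanSpace ℝ (Fin n), ℂ))
    {τ : ℝ} (hτ : 0 < τ) :
    l2Pairing n (phaseMul n τ (l2FourierInv n (hf2.toLp f))) (schwartzToL2 n (𝓕 φ)) =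
      ∫ x, f x * ∫ y, gaussKernel n ((2 * Real.pi) ^ 2 * τ * Complex.I) (x - y) * φ y := by
  set b : ℝ → ℂ := fun ε => ε + (2 * Real.pi) ^ 2 * τ * Complex.I with hb
  have hb' : ∀ ε, b ε = ε + (((2 * Real.pi) ^ 2 * τ : ℝ) : ℂ) * Complex.I := fun ε => by
    simp [hb]
  have hbre : ∀ ε, (b ε).re = ε := fun ε => by
    rw [hb', Complex.add_re, Complex.re_ofReal_mul]; simp
  have hbim : ∀ ε, (b ε).im = (2 * Real.pi) ^ 2 * τ := fun ε => by
    rw [hb', Complex.add_im, Complex.im_ofReal_mul]; simp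
  have hb0 : b 0 = (2 * Real.pi) ^ 2 * τ * Complex.I := by simp [hb]
  have hbc : Continuous b := by fun_prop
  have hpos : 0 < (2 * Real.pi) ^ 2 * τ := by positivity
  have hf' : Continuous (𝓕⁻ f) := continuous_fourierInv hf
  have hI : Integrable fun ξ => 𝓕⁻ f ξ * 𝓕 φ ξ :=
    (𝓕 φ).integrable.bdd_mul (c := ∫ x, ‖f x‖) hf'.aestronglyMeasurable
      (Eventually.of_forall fun ξ =>
        VectorFourier.norm_fourierIntegral_le_integral_norm _ _ _ _ _)
  have hleft : Tendsto (fun ε => ∫ ξ, Complex.exp (-b ε * ‖ξ‖ ^ 2) * (𝓕⁻ f ξ * 𝓕 φ ξ))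
      (𝓝[>] 0) (𝓝 (∫ ξ, Complex.exp (-b 0 * ‖ξ‖ ^ 2) * (𝓕⁻ f ξ * 𝓕 φ ξ))) := by
    refine tendsto_integral_filter_of_dominated_convergence
      (fun ξ => ‖𝓕⁻ f ξ * 𝓕 φ ξ‖) (Eventually.of_forall fun ε => ?_) ?_ hI.norm ?_
    · exact AEStronglyMeasurable.mul (by fun_prop) hI.aestronglyMeasurable
    · filter_upwards [self_mem_nhdsWithin] with ε hε
      refine Eventually.of_forall fun ξ => ?_
      rw [norm_mul]
      refine mul_le_of_le_one_left (norm_nonneg _) ?_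
      rw [Complex.norm_exp, Real.exp_le_one_iff]
      have : (-b ε * (‖ξ‖ : ℂ) ^ 2) = ((-‖ξ‖ ^ 2 : ℝ) : ℂ) * b ε := by push_cast; ring
      rw [this, Complex.re_ofReal_mul, hbre]
      nlinarith [mul_nonneg (sq_nonneg ‖ξ‖) (le_of_lt hε)]
    · refine Eventually.of_forall fun ξ => ?_
      have : Continuous fun ε => Complex.exp (-b ε * ‖ξ‖ ^ 2) * (𝓕⁻ f ξ * 𝓕 φ ξ) := by fun_prop
      exact (this.tendsto 0).mono_left nhdsWithin_le_nhds
  -- The modulus of b is at least its imaginary part (2π)²τ for every ε, so this bounds all the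
  -- kernels at once.
  set Cb : ℝ := (Real.pi / ((2 * Real.pi) ^ 2 * τ)) ^ (n / 2 : ℝ) with hCb
  have hbound : ∀ ε ∈ Ici (0 : ℝ), ∀ z, ‖gaussKernel n (b ε) z‖ ≤ Cb := by
    intro ε hε z
    refine (norm_gaussKernel_le ((hbre ε).symm ▸ hε) z).trans ?_
    rw [norm_div, Complex.norm_real, Real.norm_of_nonneg Real.pi_pos.le]
    have : (2 * Real.pi) ^ 2 * τ ≤ ‖b ε‖ := by
      rw [← hbim ε]; exact (le_abs_self _).trans (Complex.abs_im_le_norm _)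
    rw [hCb]
    gcongr
  have hright : Tendsto (fun ε => ∫ x, f x * ∫ y, gaussKernel n (b ε) (x - y) * φ y)
      (𝓝[>] 0) (𝓝 (∫ x, f x * ∫ y, gaussKernel n (b 0) (x - y) * φ y)) := by
    have hev : ∀ᶠ ε in 𝓝[>] (0 : ℝ), ε ∈ Ici (0 : ℝ) := by
      filter_upwards [self_mem_nhdsWithin] with ε hε using mem_Ici.2 (le_of_lt (mem_Ioi.1 hε))
    have hmeas : ∀ ε x, AEStronglyMeasurable (fun y => gaussKernel n (b ε) (x - y) * φ y)
        volume := fun ε x =>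
      (((continuous_gaussKernel n (b ε)).comp (by fun_prop)).mul φ.continuous).aestronglyMeasurable
    have hle : ∀ ε ∈ Ici (0 : ℝ), ∀ x y, ‖gaussKernel n (b ε) (x - y) * φ y‖ ≤ Cb * ‖φ y‖ := by
      intro ε hε x y
      rw [norm_mul]
      exact mul_le_mul_of_nonneg_right (hbound ε hε _) (norm_nonneg _)
    refine tendsto_integral_filter_of_dominated_convergence
      (fun x => ‖f x‖ * ∫ y, Cb * ‖φ y‖) (Eventually.of_forall fun ε => ?_) ?_
      (hf.norm.mul_const _) (Eventually.of_forall fun x => Tendsto.const_mul _ ?_)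
    · refine hf.aestronglyMeasurable.mul ?_
      have : Continuous fun p : EuclideanSpace ℝ (Fin n) × EuclideanSpace ℝ (Fin n) =>
          gaussKernel n (b ε) (p.1 - p.2) * φ p.2 :=
        ((continuous_gaussKernel n (b ε)).comp (by fun_prop)).mul (φ.continuous.comp (by fun_prop))
      exact this.stronglyMeasurable.integral_prod_right'.aestronglyMeasurable
    · filter_upwards [hev] with ε hε
      refine Eventually.of_forall fun x => ?_
      rw [norm_mul]
      refine mul_le_mul_of_nonneg_left ?_ (norm_nonneg _)
      exact norm_integral_le_of_norm_le (φ.integrable.norm.const_mul _)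
        (Eventually.of_forall fun y => hle ε hε x y)
    · refine tendsto_integral_filter_of_dominated_convergence (fun y => Cb * ‖φ y‖)
        (Eventually.of_forall fun ε => hmeas ε x) ?_ (φ.integrable.norm.const_mul _)
        (Eventually.of_forall fun y => Tendsto.mul_const _ ?_)
      · filter_upwards [hev] with ε hε
        exact Eventually.of_forall fun y => hle ε hε x y
      · have h0 : (b 0).im ≠ 0 := by rw [hbim]; exact hpos.ne'
        exact ((tendsto_gaussKernel h0 (x - y)).tendsto.comp (hbc.tendsto 0)).mono_left
          nhdsWithin_le_nhds
  have heq : ∀ᶠ ε in 𝓝[>] (0 : ℝ), (∫ ξ, Complex.exp (-b ε * ‖ξ‖ ^ 2) * (𝓕⁻ f ξ * 𝓕 φ ξ)) =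
      ∫ x, f x * ∫ y, gaussKernel n (b ε) (x - y) * φ y := by
    filter_upwards [self_mem_nhdsWithin] with ε hε
    exact integral_gaussian_fourierInv_mul_fourier ((hbre ε).symm ▸ hε) hf φ
  have hfinal := tendsto_nhds_unique (hleft.congr' heq) hright
  rw [hb0] at hfinal
  rw [← hfinal, l2Pairing_phaseMul]
  refine integral_congr_ae ?_
  filter_upwards [l2FourierInv_toLp_ae_eq hf hf2] with ξ hξ
  rw [hξ, mul_assoc, schrodingerSymbol]
  congr 2
  push_cast; ring

/-- The constant `(4πi)^{-n/2}`. -/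
def freeKernelConst (n : ℕ) : ℂ := (Real.pi / ((2 * Real.pi) ^ 2 * Complex.I)) ^ (n / 2 : ℂ)

theorem freeKernelConst_ne_zero (n : ℕ) : freeKernelConst n ≠ 0 := by
  unfold freeKernelConst
  rw [Ne, Complex.cpow_eq_zero_iff]
  simp [Real.pi_ne_zero]

/-- The fundamental solution `(4πiτ)^{-n/2} exp (i|z|²/4τ)` of the free Schrödinger equation. -/
def freeKernel (n : ℕ) (τ : ℝ) (z : EuclideanSpace ℝ (Fin n)) : ℂ :=
  freeKernelConst n * (((Real.sqrt τ ^ n)⁻¹ : ℝ) : ℂ) *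
    Complex.exp ((‖z‖ ^ 2 / (4 * τ) : ℝ) * Complex.I)

theorem gaussKernel_eq_freeKernel {n : ℕ} {τ : ℝ} (hτ : 0 < τ) (z : EuclideanSpace ℝ (Fin n)) :
    gaussKernel n ((2 * Real.pi) ^ 2 * τ * Complex.I) z = freeKernel n τ z := by
  have hπ : (Real.pi : ℂ) ≠ 0 := by exact_mod_cast Real.pi_ne_zero
  have hτ0 : (τ : ℂ) ≠ 0 := by exact_mod_cast hτ.ne'
  set w : ℂ := Real.pi / ((2 * Real.pi) ^ 2 * Complex.I) with hw
  have hw0 : w ≠ 0 := by simp [hw, Real.pi_ne_zero]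
  have h1 : (Real.pi / ((2 * Real.pi) ^ 2 * τ * Complex.I) : ℂ) = (τ⁻¹ : ℝ) * w := by
    rw [hw]; push_cast; field_simp
  have h2 : (-Real.pi ^ 2 * ‖z‖ ^ 2 / ((2 * Real.pi) ^ 2 * τ * Complex.I) : ℂ) =
      (‖z‖ ^ 2 / (4 * τ) : ℝ) * Complex.I := by
    push_cast
    field_simp
    rw [Complex.I_sq]; ring
  -- The positive factor τ⁻¹ may leave the principal power, because multiplying by it only adds a
  -- real number to the logarithm.
  have h3 : ((τ⁻¹ : ℝ) * w) ^ (n / 2 : ℂ) = (((Real.sqrt τ ^ n)⁻¹ : ℝ) : ℂ) * w ^ (n / 2 : ℂ) := by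
    rw [Complex.cpow_def_of_ne_zero (mul_ne_zero (by simpa using hτ0) hw0),
      Complex.log_ofReal_mul (inv_pos.2 hτ) hw0, add_mul, Complex.exp_add,
      Complex.cpow_def_of_ne_zero hw0]
    congr 1
    have : Real.sqrt τ = Real.exp (Real.log τ / 2) := by
      rw [Real.exp_half, Real.exp_log hτ]
    rw [this, ← Real.exp_nat_mul, ← Real.exp_neg, Real.log_inv]
    push_cast
    congr 1; ring
  rw [gaussKernel, freeKernel, h1, h2, h3, freeKernelConst, mul_comm (w ^ _)]

theorem norm_freeKernel {n : ℕ} (τ : ℝ) (z : EuclideanSpace ℝ (Fin n)) :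
    ‖freeKernel n τ z‖ = ‖freeKernelConst n‖ * (Real.sqrt τ ^ n)⁻¹ := by
  rw [freeKernel, norm_mul, norm_mul, Complex.norm_exp_ofReal_mul_I, mul_one, Complex.norm_real,
    Real.norm_of_nonneg (by positivity)]

theorem norm_freeKernel_le {n : ℕ} {τ : ℝ} (hτ : 1 ≤ τ) (z : EuclideanSpace ℝ (Fin n)) :
    ‖freeKernel n τ z‖ ≤ ‖freeKernelConst n‖ := by
  rw [norm_freeKernel]
  exact mul_le_of_le_one_right (norm_nonneg _)
    (inv_le_one_of_one_le₀ (one_le_pow₀ (Real.one_le_sqrt.2 hτ)))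

theorem measurable_freeKernel (n : ℕ) :
    Measurable fun p : ℝ × EuclideanSpace ℝ (Fin n) => freeKernel n p.1 p.2 := by
  unfold freeKernel; fun_prop

theorem continuousOn_freeKernel (n : ℕ) :
    ContinuousOn (fun p : ℝ × EuclideanSpace ℝ (Fin n) => freeKernel n p.1 p.2)
      (Ici 1 ×ˢ univ) := by
  unfold freeKernel
  have h : ∀ p ∈ (Ici 1 ×ˢ univ : Set (ℝ × EuclideanSpace ℝ (Fin n))), 0 < p.1 :=
    fun p hp => zero_lt_one.trans_le hp.1
  refine ContinuousOn.mul (continuousOn_const.mul ?_) ?_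
  · refine Complex.continuous_ofReal.comp_continuousOn (ContinuousOn.inv₀ (by fun_prop) ?_)
    intro p hp
    exact (pow_pos (Real.sqrt_pos.2 (h p hp)) n).ne'
  · refine ContinuousOn.cexp (ContinuousOn.mul ?_ continuousOn_const)
    refine Complex.continuous_ofReal.comp_continuousOn (ContinuousOn.div (by fun_prop)
      (by fun_prop) ?_)
    intro p hp
    exact (mul_pos four_pos (h p hp)).ne'

theorem IsForcing.integrable {n : ℕ} {F : ℝ → EuclideanSpace ℝ (Fin n) → ℂ}
    (hF : IsForcing F) :
    Integrable fun p : ℝ × EuclideanSpace ℝ (Fin n) => F p.1 p.2 := by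
  obtain ⟨M, hM⟩ := hF.bounded
  have h : IntegrableOn (Function.uncurry F) (tsupport (Function.uncurry F)) volume :=
    Measure.integrableOn_of_bounded (M := M) hF.compactSupport.isCompact.measure_lt_top.ne
      hF.measurable.aestronglyMeasurable (Eventually.of_forall fun p => hM p.1 p.2)
  exact (integrableOn_iff_integrable_of_support_subset (subset_tsupport _)).1 h

/-! ### The explicit solution after the forcing has ceased -/

/-- The solution at times `t ≥ 2` for a forcing term supported in times `[0,1]`, as an explicit
integral. -/
def freeSolution (n : ℕ) (F : ℝ → EuclideanSpace ℝ (Fin n) → ℂ)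
    (q : ℝ × EuclideanSpace ℝ (Fin n)) : ℂ :=
  -Complex.I * ∫ p : ℝ × EuclideanSpace ℝ (Fin n),
    F p.1 p.2 * freeKernel n (q.1 - p.1) (p.2 - q.2)

section

variable {n : ℕ} {F : ℝ → EuclideanSpace ℝ (Fin n) → ℂ}

/-- The gap between the support [0,1] of the forcing and t ≥ 2 forces τ ≥ 1, where the kernel is
bounded. All the integrals below converge absolutely for this reason. -/
theorem norm_mul_freeKernel_le (hs : ∀ s, s ∉ Icc (0 : ℝ) 1 → F s = 0) {t : ℝ} (ht : 2 ≤ t)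
    (s : ℝ) (x z : EuclideanSpace ℝ (Fin n)) :
    ‖F s x * freeKernel n (t - s) z‖ ≤ ‖F s x‖ * ‖freeKernelConst n‖ := by
  by_cases h : s ∈ Icc (0 : ℝ) 1
  · rw [norm_mul]
    exact mul_le_mul_of_nonneg_left (norm_freeKernel_le (by linarith [h.2]) z) (norm_nonneg _)
  · simp [hs s h]

theorem IsForcing.measurable_mul_freeKernel (hF : IsForcing F) (t : ℝ)
    (y : EuclideanSpace ℝ (Fin n)) :
    Measurable fun p : ℝ × EuclideanSpace ℝ (Fin n) =>
      F p.1 p.2 * freeKernel n (t - p.1) (p.2 - y) := by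
  have h1 : Measurable fun p : ℝ × EuclideanSpace ℝ (Fin n) => F p.1 p.2 := hF.measurable
  refine h1.mul ?_
  unfold freeKernel
  fun_prop

theorem continuousOn_freeSolution (hF : IsForcing F) (hs : ∀ s, s ∉ Icc (0 : ℝ) 1 → F s = 0) :
    ContinuousOn (freeSolution n F) (Ici 2 ×ˢ univ) := by
  refine continuousOn_const.mul (continuousOn_of_dominated
    (bound := fun p => ‖F p.1 p.2‖ * ‖freeKernelConst n‖)
    (fun q _ => (hF.measurable_mul_freeKernel q.1 q.2).aestronglyMeasurable)
    (fun q hq => Eventually.of_forall fun p => norm_mul_freeKernel_le hs hq.1 _ _ _)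
    (hF.integrable.norm.mul_const _) (Eventually.of_forall fun p => ?_))
  by_cases h : p.1 ∈ Icc (0 : ℝ) 1
  · refine continuousOn_const.mul ((continuousOn_freeKernel n).comp
      (f := fun q : ℝ × EuclideanSpace ℝ (Fin n) => (q.1 - p.1, p.2 - q.2)) (by fun_prop) ?_)
    intro q hq
    exact ⟨by have := hq.1; have := h.2; simp only [mem_Ici] at *; linarith, mem_univ _⟩
  · simp [hs _ h, continuousOn_const]

theorem IsForcing.solution_pairing (hF : IsForcing F) (hs : ∀ s, s ∉ Icc (0 : ℝ) 1 → F s = 0)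
    {t : ℝ} (ht : 2 ≤ t) (φ : 𝓢(EuclideanSpace ℝ (Fin n), ℂ)) :
    l2Pairing n (hF.solution t) (schwartzToL2 n φ) = -Complex.I *
      ∫ s, ∫ x, F s x * ∫ y, freeKernel n (t - s) (x - y) * φ y := by
  obtain ⟨C, hC⟩ := hF.exists_norm_fourierInv_slice_le
  rw [IsForcing.solution, l2Pairing_l2Fourier, l2Fourier_schwartz,
    l2Pairing_duhamel hF.stronglyMeasurable_fourierInv_slice hC]
  congr 1
  have h1 : ∀ s ∈ uIoc 0 t,
      l2Pairing n (phaseMul n (t - s) (l2FourierInv n (hF.slice s))) (schwartzToL2 n (𝓕 φ)) =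
        ∫ x, F s x * ∫ y, freeKernel n (t - s) (x - y) * φ y := by
    intro s hst
    by_cases h : s ∈ Icc (0 : ℝ) 1
    · have hpos : 0 < t - s := by linarith [h.2]
      have := l2Pairing_phaseMul_eq_gaussKernel
        (memLp_one_iff_integrable.1 (hF.memLp 1 s)) (hF.memLp 2 s) φ hpos
      rw [IsForcing.slice, this]
      simp_rw [← gaussKernel_eq_freeKernel hpos]
    · have h0 : hF.slice s = 0 := by
        refine Lp.ext ?_
        filter_upwards [hF.slice_ae_eq s, Lp.coeFn_zero ℂ 2
          (volume : Measure (EuclideanSpace ℝ (Fin n)))] with x hx hx0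
        rw [hx, hs s h, hx0]
      simp [h0, hs s h]
  rw [intervalIntegral.integral_congr_ae (Eventually.of_forall h1),
    intervalIntegral.integral_of_le (by linarith)]
  -- The half-open interval (0, t] contains the support [0,1] in time except for the single point s
  -- = 0, which is null.
  refine setIntegral_eq_integral_of_ae_compl_eq_zero ?_
  have : ∀ᵐ s : ℝ, s ≠ 0 := by simp [ae_iff]
  filter_upwards [this] with s hs0 hst
  have : F s = 0 := hs s fun h => hst ⟨lt_of_le_of_ne h.1 hs0.symm, by linarith [h.2]⟩
  simp [this]

theorem IsForcing.solution_ae_eq (hF : IsForcing F) (hs : ∀ s, s ∉ Icc (0 : ℝ) 1 → F s = 0)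
    {t : ℝ} (ht : 2 ≤ t) : hF.solution t =ᵐ[volume] fun y => freeSolution n F (t, y) := by
  have hc : Continuous fun y => freeSolution n F (t, y) :=
    (continuousOn_freeSolution hF hs).comp_continuous (by fun_prop) fun y => ⟨ht, mem_univ _⟩
  refine ae_eq_of_integral_mul_schwartz_eq (L2Space.locallyIntegrable _) hc.locallyIntegrable ?_
  intro φ _
  rw [← l2Pairing_schwartz, hF.solution_pairing hs ht]
  have hm : Measurable fun z : (ℝ × EuclideanSpace ℝ (Fin n)) × EuclideanSpace ℝ (Fin n) =>
      F z.1.1 z.1.2 * freeKernel n (t - z.1.1) (z.1.2 - z.2) * φ z.2 := by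
    have h1 : Measurable fun p : ℝ × EuclideanSpace ℝ (Fin n) => F p.1 p.2 := hF.measurable
    have h2 : Measurable fun z : (ℝ × EuclideanSpace ℝ (Fin n)) × EuclideanSpace ℝ (Fin n) =>
        (t - z.1.1, z.1.2 - z.2) := by fun_prop
    exact ((h1.comp measurable_fst).mul ((measurable_freeKernel n).comp h2)).mul
      (φ.continuous.measurable.comp measurable_snd)
  have hint : Integrable (fun z : (ℝ × EuclideanSpace ℝ (Fin n)) × EuclideanSpace ℝ (Fin n) =>
      F z.1.1 z.1.2 * freeKernel n (t - z.1.1) (z.1.2 - z.2) * φ z.2)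
      ((volume : Measure (ℝ × EuclideanSpace ℝ (Fin n))).prod volume) := by
    refine (((hF.integrable.norm.mul_const ‖freeKernelConst n‖).mul_prod φ.integrable.norm)).mono'
      hm.aestronglyMeasurable (Eventually.of_forall fun z => ?_)
    rw [norm_mul]
    exact mul_le_mul_of_nonneg_right (norm_mul_freeKernel_le hs ht _ _ _) (norm_nonneg _)
  have h1 : (∫ s, ∫ x, F s x * ∫ y, freeKernel n (t - s) (x - y) * φ y) =
      ∫ p : ℝ × EuclideanSpace ℝ (Fin n),
        ∫ y, F p.1 p.2 * freeKernel n (t - p.1) (p.2 - y) * φ y := by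
    have hint' := hint.integral_prod_left
    rw [Measure.volume_eq_prod] at hint' ⊢
    rw [integral_prod _ hint']
    simp_rw [mul_assoc, integral_const_mul]
  rw [h1, integral_integral_swap hint, ← integral_const_mul]
  refine integral_congr_ae (Eventually.of_forall fun y => ?_)
  simp only [freeSolution, integral_mul_const]
  ring

end

theorem IsSchrodingerSolution.ae_eq_freeSolution {n : ℕ}
    {F : ℝ → EuclideanSpace ℝ (Fin n) → ℂ} {u : ℝ → L2Space n} (hu : IsSchrodingerSolution F u)
    (hF : IsForcing F) (hs : ∀ s, s ∉ Icc (0 : ℝ) 1 → F s = 0) {t : ℝ} (ht : 2 ≤ t) :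
    u t =ᵐ[volume] fun y => freeSolution n F (t, y) := by
  rw [hu.unique hF.isSchrodingerSolution (zero_le_two.trans ht)]
  exact hF.solution_ae_eq hs ht

/-! ### Fresnel integrals with explicit tails -/

/-- Integration by parts with e^{-bσ²} = (-2bσ)⁻¹ (e^{-bσ²})'. The bound is uniform in R and in b
with Re b ≥ 0 and |b| ≥ 1, so it survives both R → ∞ and the removal of the damping. -/
theorem norm_integral_cexp_neg_mul_sq_le {b : ℂ} (hb : 0 ≤ b.re) (hb1 : 1 ≤ ‖b‖) {B R : ℝ}
    (hB : 0 < B) (hR : B ≤ R) :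
    ‖∫ σ in B..R, Complex.exp (-b * σ ^ 2)‖ ≤ 1 / B := by
  have hb0 : b ≠ 0 := norm_pos_iff.1 (zero_lt_one.trans_le hb1)
  have hpos : ∀ σ ∈ uIcc B R, 0 < σ := fun σ hσ => by
    rw [uIcc_of_le hR] at hσ; exact hB.trans_le hσ.1
  have hexp : ∀ σ : ℝ, ‖Complex.exp (-b * σ ^ 2)‖ ≤ 1 := fun σ => by
    rw [Complex.norm_exp, Real.exp_le_one_iff]
    have : (-b * (σ : ℂ) ^ 2) = ((-σ ^ 2 : ℝ) : ℂ) * b := by push_cast; ring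
    rw [this, Complex.re_ofReal_mul]
    nlinarith [mul_nonneg (sq_nonneg σ) hb]
  have hv : ∀ σ ∈ uIcc B R, HasDerivAt (fun σ : ℝ => Complex.exp (-b * σ ^ 2))
      (Complex.exp (-b * σ ^ 2) * (-b * (2 * σ))) σ := fun σ _ => by
    have h1 : HasDerivAt (fun σ : ℝ => (σ : ℂ)) 1 σ := Complex.ofRealCLM.hasDerivAt
    have := ((h1.pow 2).const_mul (-b)).cexp
    convert! this using 1
    simp
  have hu : ∀ σ ∈ uIcc B R, HasDerivAt (fun σ : ℝ => (((-2 * b)⁻¹ : ℂ) * ((σ⁻¹ : ℝ) : ℂ)))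
      ((-2 * b)⁻¹ * ((-(σ ^ 2)⁻¹ : ℝ) : ℂ)) σ := fun σ hσ =>
    ((hasDerivAt_inv (hpos σ hσ).ne').ofReal_comp).const_mul _
  have hinv2 : ContinuousOn (fun σ : ℝ => (σ ^ 2)⁻¹) (uIcc B R) :=
    ContinuousOn.inv₀ (by fun_prop) fun σ hσ => (pow_pos (hpos σ hσ) 2).ne'
  have hibp := intervalIntegral.integral_mul_deriv_eq_deriv_mul hu hv
    (ContinuousOn.intervalIntegrable (by
      exact continuousOn_const.mul (Complex.continuous_ofReal.comp_continuousOn hinv2.neg)))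
    (Continuous.intervalIntegrable (by fun_prop) _ _)
  have h1 : ∫ σ in B..R, Complex.exp (-b * σ ^ 2) = ∫ σ in B..R,
      (((-2 * b)⁻¹ : ℂ) * ((σ⁻¹ : ℝ) : ℂ)) * (Complex.exp (-b * σ ^ 2) * (-b * (2 * σ))) := by
    refine intervalIntegral.integral_congr fun σ hσ => ?_
    have : (σ : ℂ) ≠ 0 := by exact_mod_cast (hpos σ hσ).ne'
    push_cast
    field_simp
  rw [h1, hibp]
  have hc : ‖(-2 * b)⁻¹‖ ≤ 1 / 2 := by
    rw [norm_inv, norm_mul, norm_neg, Complex.norm_ofNat, one_div]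
    exact inv_anti₀ two_pos (by linarith)
  have hR0 : 0 < R := hB.trans_le hR
  have hend : ∀ σ : ℝ, 0 < σ →
      ‖(-2 * b)⁻¹ * ((σ⁻¹ : ℝ) : ℂ) * Complex.exp (-b * σ ^ 2)‖ ≤ 1 / 2 * σ⁻¹ := by
    intro σ hσ
    rw [norm_mul, norm_mul, Complex.norm_real, Real.norm_of_nonneg (inv_nonneg.2 hσ.le)]
    have := mul_le_mul hc (le_refl σ⁻¹) (inv_nonneg.2 hσ.le) (by norm_num)
    exact (mul_le_of_le_one_right (by positivity) (hexp σ)).trans this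
  have hint : ‖∫ σ in B..R, (-2 * b)⁻¹ * ((-(σ ^ 2)⁻¹ : ℝ) : ℂ) * Complex.exp (-b * σ ^ 2)‖ ≤
      1 / 2 * (B⁻¹ - R⁻¹) := by
    have hprim : ∫ σ in B..R, 1 / 2 * (σ ^ 2)⁻¹ = 1 / 2 * (B⁻¹ - R⁻¹) := by
      rw [intervalIntegral.integral_const_mul]
      congr 1
      have := intervalIntegral.integral_eq_sub_of_hasDerivAt (a := B) (b := R)
        (f := fun σ => -σ⁻¹) (f' := fun σ => (σ ^ 2)⁻¹)
        (fun σ hσ => by simpa using! (hasDerivAt_inv (hpos σ hσ).ne').neg)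
        hinv2.intervalIntegrable
      rw [this]; ring
    rw [← hprim]
    refine intervalIntegral.norm_integral_le_of_norm_le hR (Eventually.of_forall fun σ hσ => ?_)
      (hinv2.intervalIntegrable.const_mul _)
    have hσ0 : 0 < σ := hB.trans hσ.1
    rw [norm_mul, norm_mul, Complex.norm_real, norm_neg, Real.norm_of_nonneg (by positivity)]
    exact (mul_le_of_le_one_right (by positivity) (hexp σ)).trans
      (mul_le_mul_of_nonneg_right hc (by positivity))
  -- The three contributions are 1/(2R), 1/(2B) and 1/(2B) - 1/(2R); they add up to 1/B.
  refine (norm_sub_le _ _).trans ((add_le_add ((norm_sub_le _ _).trans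
    (add_le_add (hend R hR0) (hend B hB))) hint).trans ?_)
  rw [one_div B]; linarith

/-- The Fresnel constant `√(πi)`. -/
def fresnelConst : ℂ := (Real.pi / -Complex.I) ^ (1 / 2 : ℂ)

theorem fresnelConst_ne_zero : fresnelConst ≠ 0 := by
  unfold fresnelConst
  rw [Ne, Complex.cpow_eq_zero_iff]
  simp [Real.pi_ne_zero]

/-- For b = ε - i with ε > 0 the full half-line integral is a known Gaussian value and the tail
beyond B is at most 1/B; then ε → 0+. -/
theorem norm_fresnel_half_sub_le {B : ℝ} (hB : 0 < B) :
    ‖(∫ σ in (0 : ℝ)..B, Complex.exp (Complex.I * σ ^ 2)) - fresnelConst / 2‖ ≤ 1 / B := by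
  set b : ℝ → ℂ := fun ε => ε - Complex.I with hb
  have hre : ∀ ε, (b ε).re = ε := fun ε => by simp [hb]
  have him : ∀ ε, (b ε).im = -1 := fun ε => by simp [hb]
  have hnorm : ∀ ε, 1 ≤ ‖b ε‖ := fun ε => by
    have := Complex.abs_im_le_norm (b ε)
    rwa [him, abs_neg, abs_one] at this
  have hbc : Continuous b := by fun_prop
  have h1 : ∀ ε > 0, ‖(∫ σ in (0 : ℝ)..B, Complex.exp (-b ε * σ ^ 2)) -
      (Real.pi / b ε) ^ (1 / 2 : ℂ) / 2‖ ≤ 1 / B := by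
    intro ε hε
    have hlim := intervalIntegral_tendsto_integral_Ioi 0
      (integrable_cexp_neg_mul_sq ((hre ε).symm ▸ hε)).integrableOn tendsto_id
    rw [integral_gaussian_complex_Ioi ((hre ε).symm ▸ hε)] at hlim
    have hlim' := (hlim.const_sub (∫ σ in (0 : ℝ)..B, Complex.exp (-b ε * σ ^ 2))).norm
    refine le_of_tendsto hlim' ?_
    filter_upwards [eventually_ge_atTop B] with R hR
    rw [norm_sub_rev, id, intervalIntegral.integral_interval_sub_left
      (Continuous.intervalIntegrable (by fun_prop) _ _)
      (Continuous.intervalIntegrable (by fun_prop) _ _)]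
    exact norm_integral_cexp_neg_mul_sq_le ((hre ε).symm ▸ hε.le) (hnorm ε) hB hR
  have hl : Tendsto (fun ε => ∫ σ in (0 : ℝ)..B, Complex.exp (-b ε * σ ^ 2)) (𝓝[>] 0)
      (𝓝 (∫ σ in (0 : ℝ)..B, Complex.exp (-b 0 * σ ^ 2))) := by
    have : Continuous fun ε => ∫ σ in (0 : ℝ)..B, Complex.exp (-b ε * σ ^ 2) :=
      intervalIntegral.continuous_parametric_intervalIntegral_of_continuous' (by fun_prop) _ _
    exact (this.tendsto 0).mono_left nhdsWithin_le_nhds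
  have hb0 : b 0 = -Complex.I := by simp [hb]
  have hr : Tendsto (fun ε => (Real.pi / b ε) ^ (1 / 2 : ℂ) / 2) (𝓝[>] 0)
      (𝓝 (fresnelConst / 2)) := by
    have hne : b 0 ≠ 0 := by simp [hb0]
    have hs : (Real.pi / b 0 : ℂ) ∈ Complex.slitPlane := by
      refine Or.inr ?_
      rw [hb0, div_neg, Complex.div_I]
      simp [Real.pi_ne_zero]
    have : ContinuousAt (fun ε => (Real.pi / b ε) ^ (1 / 2 : ℂ) / 2) 0 :=
      ((continuousAt_const.div hbc.continuousAt hne).cpow continuousAt_const hs).div_const _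
    rw [fresnelConst, ← hb0]
    exact this.tendsto.mono_left nhdsWithin_le_nhds
  have h2 := le_of_tendsto ((hl.sub hr).norm)
    (by filter_upwards [self_mem_nhdsWithin] with ε hε using h1 ε hε)
  rw [hb0, neg_neg] at h2
  exact h2

theorem norm_fresnel_sub_le {A B : ℝ} (hA : 0 < A) (hB : 0 < B) :
    ‖(∫ σ in (-A)..B, Complex.exp (Complex.I * σ ^ 2)) - fresnelConst‖ ≤ 1 / A + 1 / B := by
  have hi : ∀ a b : ℝ, IntervalIntegrable (fun σ : ℝ => Complex.exp (Complex.I * σ ^ 2))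
      volume a b := fun a b => Continuous.intervalIntegrable (by fun_prop) _ _
  have h1 : ∫ σ in (-A)..0, Complex.exp (Complex.I * σ ^ 2) =
      ∫ σ in (0 : ℝ)..A, Complex.exp (Complex.I * σ ^ 2) := by
    have := intervalIntegral.integral_comp_neg (a := 0) (b := A)
      (fun σ : ℝ => Complex.exp (Complex.I * σ ^ 2))
    simpa using this.symm
  rw [← intervalIntegral.integral_add_adjacent_intervals (hi (-A) 0) (hi 0 B), h1]
  have h2 := norm_fresnel_half_sub_le hA
  have h3 := norm_fresnel_half_sub_le hB
  have h4 := (norm_add_le _ _).trans (add_le_add h2 h3)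
  refine le_trans (le_of_eq ?_) h4
  congr 1; ring

/-! ### Stationary phase through an exact square root of the phase -/

/-- Here h h' e^{ilh²} is the derivative of e^{ilh²}/(2il), so one integration by parts gains 1/l
even though the phase is stationary where h vanishes. The factor 2 + (b - a) counts the two boundary
terms and the integral of k'. -/
theorem norm_integral_mul_cexp_sq_le {k k' h h' : ℝ → ℝ} {a b C l : ℝ} (hab : a ≤ b) (hl : 0 < l)
    (hk : ∀ τ ∈ Icc a b, HasDerivAt k (k' τ) τ) (hh : ∀ τ ∈ Icc a b, HasDerivAt h (h' τ) τ)
    (hk' : ContinuousOn k' (Icc a b)) (hh' : ContinuousOn h' (Icc a b))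
    (hkC : ∀ τ ∈ Icc a b, |k τ| ≤ C) (hkC' : ∀ τ ∈ Icc a b, |k' τ| ≤ C) :
    ‖∫ τ in a..b, ((k τ * h τ * h' τ : ℝ) : ℂ) * Complex.exp ((l * h τ ^ 2 : ℝ) * Complex.I)‖ ≤
      C * (2 + (b - a)) / (2 * l) := by
  have hI : uIcc a b = Icc a b := uIcc_of_le hab
  have hhc : ContinuousOn h (Icc a b) := fun τ hτ => (hh τ hτ).continuousAt.continuousWithinAt
  have hv : ∀ τ ∈ uIcc a b, HasDerivAt
      (fun τ => Complex.exp ((l * h τ ^ 2 : ℝ) * Complex.I))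
      (Complex.exp ((l * h τ ^ 2 : ℝ) * Complex.I) * ((l * (2 * h τ * h' τ) : ℝ) * Complex.I))
      τ := fun τ hτ => by
    have := (((((hh τ (hI ▸ hτ)).pow 2).const_mul l).ofReal_comp).mul_const Complex.I).cexp
    convert! this using 1
    simp
  have hu : ∀ τ ∈ uIcc a b, HasDerivAt (fun τ => (k τ : ℂ)) (k' τ : ℂ) τ :=
    fun τ hτ => (hk τ (hI ▸ hτ)).ofReal_comp
  have hibp := intervalIntegral.integral_mul_deriv_eq_deriv_mul hu hv
    (ContinuousOn.intervalIntegrable (by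
      rw [hI]; exact Complex.continuous_ofReal.comp_continuousOn hk'))
    (ContinuousOn.intervalIntegrable (by
      rw [hI]
      refine ContinuousOn.mul (ContinuousOn.cexp (ContinuousOn.mul
        (Complex.continuous_ofReal.comp_continuousOn (by fun_prop)) continuousOn_const)) ?_
      exact (Complex.continuous_ofReal.comp_continuousOn (by fun_prop)).mul continuousOn_const))
  have h1 : ∫ τ in a..b, (k τ : ℂ) * (Complex.exp ((l * h τ ^ 2 : ℝ) * Complex.I) *
      ((l * (2 * h τ * h' τ) : ℝ) * Complex.I)) = (2 * l * Complex.I) *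
      ∫ τ in a..b, ((k τ * h τ * h' τ : ℝ) : ℂ) *
        Complex.exp ((l * h τ ^ 2 : ℝ) * Complex.I) := by
    rw [← intervalIntegral.integral_const_mul]
    refine intervalIntegral.integral_congr fun τ _ => ?_
    push_cast; ring
  have hE : ∀ τ, ‖Complex.exp ((l * h τ ^ 2 : ℝ) * Complex.I)‖ = 1 :=
    fun τ => Complex.norm_exp_ofReal_mul_I _
  have h2 : ‖∫ τ in a..b, (k' τ : ℂ) * Complex.exp ((l * h τ ^ 2 : ℝ) * Complex.I)‖ ≤
      C * (b - a) := by
    refine (intervalIntegral.norm_integral_le_of_norm_le_const (C := C) fun τ hτ => ?_).trans_eq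
      (by rw [abs_of_nonneg (sub_nonneg.2 hab)])
    rw [norm_mul, hE, mul_one, Complex.norm_real]
    exact hkC' τ (by rw [uIoc_of_le hab] at hτ; exact Ioc_subset_Icc_self hτ)
  have h3 : ∀ τ ∈ Icc a b, ‖(k τ : ℂ) * Complex.exp ((l * h τ ^ 2 : ℝ) * Complex.I)‖ ≤ C := by
    intro τ hτ
    rw [norm_mul, hE, mul_one, Complex.norm_real]
    exact hkC τ hτ
  have h4 : ‖(2 * l * Complex.I : ℂ)‖ = 2 * l := by
    simp [abs_of_pos hl]
  rw [le_div_iff₀ (by positivity), mul_comm, ← h4, ← norm_mul, ← h1, hibp]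
  refine (norm_sub_le _ _).trans ((add_le_add ((norm_sub_le _ _).trans (add_le_add
    (h3 b ⟨hab, le_rfl⟩) (h3 a ⟨le_rfl, hab⟩))) h2).trans_eq ?_)
  ring

/-- The remainder amplitude in the stationary phase expansion, in terms of the square roots of
the time variable and of the stationary time. -/
def stationaryRemainder (n : ℕ) (m μ : ℝ) : ℝ :=
  2 * m ^ 4 / ((m + μ) * (m ^ 2 + μ ^ 2)) *
    (-(∑ j ∈ Finset.range n, m ^ j * μ ^ (n - 1 - j)) / (m ^ n * μ ^ n) +
      (μ ^ n)⁻¹ * (2 * m ^ 2 + μ * m + μ ^ 2) / (2 * m ^ 3))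

/-- With m = √τ, μ = √T, h = (m² - μ²)/m and h' = (m² + μ²)/(2m³), the difference m^{-n} - μ μ^{-n}
h' vanishes at m = μ because h' = 1/μ there. It is therefore divisible by h with smooth quotient,
the geometric sum being (m^n - μ^n)/(m - μ). Square roots of the times keep everything rational for
odd n too. -/
theorem inv_pow_eq_stationary {n : ℕ} {m μ : ℝ} (hm : 0 < m) (hμ : 0 < μ) :
    (m ^ n)⁻¹ = μ * (μ ^ n)⁻¹ * ((m ^ 2 + μ ^ 2) / (2 * m ^ 3)) +
      stationaryRemainder n m μ * ((m ^ 2 - μ ^ 2) / m) * ((m ^ 2 + μ ^ 2) / (2 * m ^ 3)) := by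
  have hS : (∑ j ∈ Finset.range n, m ^ j * μ ^ (n - 1 - j)) * (m - μ) = m ^ n - μ ^ n :=
    (Commute.all m μ).geom_sum₂_mul n
  unfold stationaryRemainder
  generalize (∑ j ∈ Finset.range n, m ^ j * μ ^ (n - 1 - j)) = S at hS ⊢
  have hA : 0 < m ^ n := pow_pos hm n
  have hB : 0 < μ ^ n := pow_pos hμ n
  generalize m ^ n = A at hS hA ⊢
  generalize μ ^ n = B at hS hB ⊢
  have h1 : m + μ ≠ 0 := by positivity
  have h2 : m ^ 2 + μ ^ 2 ≠ 0 := by positivity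
  have key : 2 * m ^ 4 / ((m + μ) * (m ^ 2 + μ ^ 2)) *
      (-S / (A * B) + B⁻¹ * (2 * m ^ 2 + μ * m + μ ^ 2) / (2 * m ^ 3)) *
      ((m ^ 2 - μ ^ 2) / m) * ((m ^ 2 + μ ^ 2) / (2 * m ^ 3)) =
      (m - μ) * (-S / (A * B) + B⁻¹ * (2 * m ^ 2 + μ * m + μ ^ 2) / (2 * m ^ 3)) := by
    field_simp
    ring
  rw [key]
  have h3 : S * (m - μ) / (A * B) = (A - B) / (A * B) := by rw [hS]
  have h4 : (m - μ) * (-S / (A * B) + B⁻¹ * (2 * m ^ 2 + μ * m + μ ^ 2) / (2 * m ^ 3)) =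
      -(S * (m - μ) / (A * B)) +
        (m - μ) * (B⁻¹ * (2 * m ^ 2 + μ * m + μ ^ 2) / (2 * m ^ 3)) := by ring
  rw [h4, h3]
  field_simp
  ring

theorem contDiffOn_stationaryRemainder (n : ℕ) :
    ContDiffOn ℝ 1 (fun p : ℝ × ℝ => stationaryRemainder n (√p.1) (√p.2))
      (Ioi 0 ×ˢ Ioi 0) := by
  have h1 : ContDiffOn ℝ 1 (fun p : ℝ × ℝ => √p.1) (Ioi 0 ×ˢ Ioi 0) :=
    contDiff_fst.contDiffOn.sqrt fun p hp => (ne_of_gt hp.1)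
  have h2 : ContDiffOn ℝ 1 (fun p : ℝ × ℝ => √p.2) (Ioi 0 ×ˢ Ioi 0) :=
    contDiff_snd.contDiffOn.sqrt fun p hp => (ne_of_gt hp.2)
  have p1 : ∀ p ∈ (Ioi 0 ×ˢ Ioi 0 : Set (ℝ × ℝ)), 0 < √p.1 := fun p hp => Real.sqrt_pos.2 hp.1
  have p2 : ∀ p ∈ (Ioi 0 ×ˢ Ioi 0 : Set (ℝ × ℝ)), 0 < √p.2 := fun p hp => Real.sqrt_pos.2 hp.2
  unfold stationaryRemainder
  refine ContDiffOn.mul (ContDiffOn.div (contDiffOn_const.mul (h1.pow 4))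
    ((h1.add h2).mul ((h1.pow 2).add (h2.pow 2))) fun p hp => ?_) (ContDiffOn.add
    (ContDiffOn.div (ContDiffOn.neg (ContDiffOn.sum fun j _ => (h1.pow _).mul (h2.pow _)))
      ((h1.pow n).mul (h2.pow n)) fun p hp => ?_)
    (ContDiffOn.div (((h2.pow n).inv fun p hp => ?_).mul
      (((contDiffOn_const.mul (h1.pow 2)).add (h2.mul h1)).add (h2.pow 2)))
      (contDiffOn_const.mul (h1.pow 3)) fun p hp => ?_))
  all_goals
    have := p1 p hp
    have := p2 p hp
    positivity

/-- The remainder is C¹ jointly in (τ, T), and compactness of [1,3]² gives one constant valid for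
every stationary time T. -/
theorem exists_bound_stationaryRemainder (n : ℕ) :
    ∃ C : ℝ, 0 ≤ C ∧ ∀ T ∈ Icc (1 : ℝ) 3, ∃ k' : ℝ → ℝ, ContinuousOn k' (Icc 1 3) ∧
      ∀ τ ∈ Icc (1 : ℝ) 3,
        HasDerivAt (fun τ => stationaryRemainder n (√τ) (√T)) (k' τ) τ ∧
        |stationaryRemainder n (√τ) (√T)| ≤ C ∧ |k' τ| ≤ C := by
  set U : Set (ℝ × ℝ) := Ioi 0 ×ˢ Ioi 0 with hU
  set κ : ℝ × ℝ → ℝ := fun p => stationaryRemainder n (√p.1) (√p.2) with hκ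
  have hUo : IsOpen U := isOpen_Ioi.prod isOpen_Ioi
  have hc : ContDiffOn ℝ 1 κ U := contDiffOn_stationaryRemainder n
  have hf : ContinuousOn (fun p => fderiv ℝ κ p (1, 0)) U :=
    (hc.continuousOn_fderiv_of_isOpen hUo le_rfl).clm_apply continuousOn_const
  have hK : IsCompact (Icc (1 : ℝ) 3 ×ˢ Icc (1 : ℝ) 3) := isCompact_Icc.prod isCompact_Icc
  have hKU : Icc (1 : ℝ) 3 ×ˢ Icc (1 : ℝ) 3 ⊆ U := fun p hp =>
    ⟨zero_lt_one.trans_le hp.1.1, zero_lt_one.trans_le hp.2.1⟩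
  obtain ⟨C1, hC1⟩ := hK.exists_bound_of_continuousOn (hc.continuousOn.mono hKU)
  obtain ⟨C2, hC2⟩ := hK.exists_bound_of_continuousOn (hf.mono hKU)
  refine ⟨max (max C1 C2) 0, le_max_right _ _, fun T hT =>
    ⟨fun τ => fderiv ℝ κ (τ, T) (1, 0), ?_, fun τ hτ => ⟨?_, ?_, ?_⟩⟩⟩
  · exact hf.comp (f := fun τ : ℝ => (τ, T)) (by fun_prop) fun τ hτ => hKU ⟨hτ, hT⟩
  · have h1 : HasFDerivAt κ (fderiv ℝ κ (τ, T)) (τ, T) :=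
      ((hc.differentiableOn one_ne_zero).differentiableAt
        (hUo.mem_nhds (hKU ⟨hτ, hT⟩))).hasFDerivAt
    have h2 : HasDerivAt (fun τ : ℝ => (τ, T)) ((1 : ℝ), (0 : ℝ)) τ :=
      (hasDerivAt_id τ).prodMk (hasDerivAt_const τ T)
    exact h1.comp_hasDerivAt τ h2
  · exact (hC1 (τ, T) ⟨hτ, hT⟩).trans ((le_max_left _ _).trans (le_max_left _ _))
  · exact (hC2 (τ, T) ⟨hτ, hT⟩).trans ((le_max_right _ _).trans (le_max_left _ _))

/-- Square root of the phase function, vanishing at the stationary time `T`. -/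
def phaseRoot (T τ : ℝ) : ℝ := (√τ ^ 2 - √T ^ 2) / √τ

theorem hasDerivAt_phaseRoot {T τ : ℝ} (hτ : 0 < τ) :
    HasDerivAt (phaseRoot T) ((√τ ^ 2 + √T ^ 2) / (2 * √τ ^ 3)) τ := by
  have h1 := Real.hasDerivAt_sqrt hτ.ne'
  have hs : √τ ≠ 0 := (Real.sqrt_pos.2 hτ).ne'
  have := ((h1.pow 2).sub_const (√T ^ 2)).div h1 hs
  convert! this using 1
  simp only [Pi.pow_apply]
  field_simp
  ring

/-- Completing the square: the right-hand side is (N√τ - ρ/(2√τ))², which vanishes at T = ρ/(2N). -/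
theorem phaseRoot_sq {N ρ τ : ℝ} (hN : 0 < N) (hρ : 0 ≤ ρ) (hτ : 0 < τ) :
    N ^ 2 * phaseRoot (ρ / (2 * N)) τ ^ 2 = N ^ 2 * τ + ρ ^ 2 / (4 * τ) - N * ρ := by
  have h1 : √τ ^ 2 = τ := Real.sq_sqrt hτ.le
  have h2 : √(ρ / (2 * N)) ^ 2 = ρ / (2 * N) := Real.sq_sqrt (by positivity)
  rw [phaseRoot, h2, div_pow, h1]
  field_simp
  ring

/-- Stationary phase for the oscillatory integral with quadratic phase root. -/
theorem exists_stationary_phase (n : ℕ) : ∃ C : ℝ, 0 ≤ C ∧ ∀ N : ℝ, 0 < N → ∀ t ∈ Icc (2 : ℝ) 3,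
    ∀ T ∈ Icc (t - 3 / 4) (t - 1 / 4),
      ‖(∫ τ in (t - 1)..t, (((√τ ^ n)⁻¹ : ℝ) : ℂ) *
          Complex.exp ((N ^ 2 * phaseRoot T τ ^ 2 : ℝ) * Complex.I)) -
        ((√T * (√T ^ n)⁻¹ / N : ℝ) : ℂ) * fresnelConst‖ ≤ C / N ^ 2 := by
  obtain ⟨C, hC0, hC⟩ := exists_bound_stationaryRemainder n
  -- Since α ≤ 2 and both Fresnel endpoints exceed N/8 in modulus, the main term errs by at most
  -- (2/N)(8/N + 8/N) = 32/N². The remainder contributes C(2 + 1)/(2N²), the time interval having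
  -- length 1.
  refine ⟨32 + 3 / 2 * C, by positivity, fun N hN t ht T hT => ?_⟩
  have hT13 : T ∈ Icc (1 : ℝ) 3 := ⟨by linarith [ht.1, hT.1], by linarith [ht.2, hT.2]⟩
  have hsub : Icc (t - 1) t ⊆ Icc (1 : ℝ) 3 := Icc_subset_Icc (by linarith [ht.1]) ht.2
  obtain ⟨k', hk'c, hk⟩ := hC T hT13
  set α : ℝ := √T * (√T ^ n)⁻¹ with hα
  have hT1 : 1 ≤ √T := Real.one_le_sqrt.2 hT13.1
  have hs2 : ∀ x : ℝ, x ≤ 3 → √x ≤ 2 := fun x hx => by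
    rw [Real.sqrt_le_left two_pos.le]; linarith
  have hα2 : α ≤ 2 := by
    have : (√T ^ n)⁻¹ ≤ 1 := inv_le_one_of_one_le₀ (one_le_pow₀ hT1)
    calc α ≤ √T * 1 := mul_le_mul_of_nonneg_left this (Real.sqrt_nonneg T)
      _ ≤ 2 := by linarith [hs2 T hT13.2]
  have hα0 : 0 ≤ α := by positivity
  set h' : ℝ → ℝ := fun τ => (√τ ^ 2 + √T ^ 2) / (2 * √τ ^ 3) with hh'
  have hpos : ∀ τ ∈ Icc (t - 1) t, 0 < τ := fun τ hτ => zero_lt_one.trans_le (hsub hτ).1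
  have hspos : ∀ τ ∈ Icc (t - 1) t, 0 < √τ := fun τ hτ => Real.sqrt_pos.2 (hpos τ hτ)
  have hd : ∀ τ ∈ Icc (t - 1) t, HasDerivAt (phaseRoot T) (h' τ) τ :=
    fun τ hτ => hasDerivAt_phaseRoot (hpos τ hτ)
  have hdc : ContinuousOn h' (Icc (t - 1) t) := by
    refine ContinuousOn.div (by fun_prop) (by fun_prop) fun τ hτ => ?_
    have := hspos τ hτ
    positivity
  have hrc : ContinuousOn (phaseRoot T) (Icc (t - 1) t) :=
    fun τ hτ => (hd τ hτ).continuousAt.continuousWithinAt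
  have hI : uIcc (t - 1) t = Icc (t - 1) t := uIcc_of_le (by linarith)
  have hec : ContinuousOn (fun τ => Complex.exp ((N ^ 2 * phaseRoot T τ ^ 2 : ℝ) * Complex.I))
      (Icc (t - 1) t) :=
    ContinuousOn.cexp ((Complex.continuous_ofReal.comp_continuousOn (by fun_prop)).mul
      continuousOn_const)
  have hkc : ContinuousOn (fun τ => stationaryRemainder n (√τ) (√T)) (Icc (t - 1) t) :=
    fun τ hτ => (hk τ (hsub hτ)).1.continuousAt.continuousWithinAt
  have hsplit : ∫ τ in (t - 1)..t, (((√τ ^ n)⁻¹ : ℝ) : ℂ) *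
      Complex.exp ((N ^ 2 * phaseRoot T τ ^ 2 : ℝ) * Complex.I) =
      (α : ℂ) * (∫ τ in (t - 1)..t, (h' τ : ℂ) *
        Complex.exp ((N ^ 2 * phaseRoot T τ ^ 2 : ℝ) * Complex.I)) +
      ∫ τ in (t - 1)..t, ((stationaryRemainder n (√τ) (√T) * phaseRoot T τ * h' τ : ℝ) : ℂ) *
        Complex.exp ((N ^ 2 * phaseRoot T τ ^ 2 : ℝ) * Complex.I) := by
    rw [← intervalIntegral.integral_const_mul, ← intervalIntegral.integral_add]
    · refine intervalIntegral.integral_congr fun τ hτ => ?_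
      rw [hI] at hτ
      rw [inv_pow_eq_stationary (hspos τ hτ) (zero_lt_one.trans_le hT1)]
      simp only [hα, hh', phaseRoot]
      push_cast
      ring
    · refine ContinuousOn.intervalIntegrable ?_
      rw [hI]
      exact continuousOn_const.mul ((Complex.continuous_ofReal.comp_continuousOn hdc).mul hec)
    · refine ContinuousOn.intervalIntegrable ?_
      rw [hI]
      exact (Complex.continuous_ofReal.comp_continuousOn ((hkc.mul hrc).mul hdc)).mul hec
  have hrem := norm_integral_mul_cexp_sq_le (C := C) (l := N ^ 2) (a := t - 1) (b := t)
    (by linarith) (by positivity) (fun τ hτ => (hk τ (hsub hτ)).1) hd (hk'c.mono hsub) hdc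
    (fun τ hτ => (hk τ (hsub hτ)).2.1) (fun τ hτ => (hk τ (hsub hτ)).2.2)
  -- Substitution σ = N h(τ): the factor h' is exactly the Jacobian, so a pure Fresnel integral
  -- remains.
  have hmain : ∫ τ in (t - 1)..t, (h' τ : ℂ) *
      Complex.exp ((N ^ 2 * phaseRoot T τ ^ 2 : ℝ) * Complex.I) =
      (N⁻¹ : ℝ) * ∫ σ in (N * phaseRoot T (t - 1))..(N * phaseRoot T t),
        Complex.exp (Complex.I * σ ^ 2) := by
    have := intervalIntegral.integral_deriv_smul_comp (a := t - 1) (b := t)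
      (f := fun τ => N * phaseRoot T τ) (f' := fun τ => N * h' τ)
      (g := fun σ : ℝ => Complex.exp (Complex.I * σ ^ 2))
      (fun τ hτ => (hd τ (hI ▸ hτ)).const_mul N)
      (by rw [hI]; exact continuousOn_const.mul hdc) (by fun_prop)
    rw [← this, ← intervalIntegral.integral_const_mul]
    refine intervalIntegral.integral_congr fun τ _ => ?_
    have hN' : (N : ℂ) ≠ 0 := by exact_mod_cast hN.ne'
    simp only [Function.comp, Complex.real_smul]
    push_cast
    rw [← mul_assoc, ← mul_assoc, inv_mul_cancel₀ hN', one_mul]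
    congr 2
    ring
  -- The stationary time is at distance at least 1/4 from both ends of [t - 1, t], and √τ ≤ 2 there,
  -- so |h| ≥ 1/8 at the endpoints.
  have hB : N / 8 ≤ N * phaseRoot T t := by
    rw [phaseRoot, Real.sq_sqrt (by linarith [ht.1]), Real.sq_sqrt (by linarith [hT13.1]),
      div_eq_mul_one_div]
    refine mul_le_mul_of_nonneg_left ?_ hN.le
    rw [le_div_iff₀ (Real.sqrt_pos.2 (by linarith [ht.1]))]
    linarith [hs2 t ht.2, hT.2]
  have hA : N / 8 ≤ -(N * phaseRoot T (t - 1)) := by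
    rw [phaseRoot, Real.sq_sqrt (by linarith [ht.1]), Real.sq_sqrt (by linarith [hT13.1]),
      div_eq_mul_one_div, ← mul_neg, ← neg_div]
    refine mul_le_mul_of_nonneg_left ?_ hN.le
    rw [le_div_iff₀ (Real.sqrt_pos.2 (by linarith [ht.1]))]
    linarith [hs2 (t - 1) (by linarith [ht.2]), hT.1]
  have hfres := norm_fresnel_sub_le (A := -(N * phaseRoot T (t - 1))) (B := N * phaseRoot T t)
    ((by positivity : 0 < N / 8).trans_le hA) ((by positivity : 0 < N / 8).trans_le hB)
  rw [neg_neg] at hfres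
  have hfres' := hfres.trans (add_le_add (one_div_le_one_div_of_le (by positivity) hA)
    (one_div_le_one_div_of_le (by positivity) hB))
  rw [hsplit, hmain]
  set G := ∫ σ in (N * phaseRoot T (t - 1))..(N * phaseRoot T t), Complex.exp (Complex.I * σ ^ 2)
  set Rm := ∫ τ in (t - 1)..t,
    ((stationaryRemainder n (√τ) (√T) * phaseRoot T τ * h' τ : ℝ) : ℂ) *
        Complex.exp ((N ^ 2 * phaseRoot T τ ^ 2 : ℝ) * Complex.I)
  have heq : (α : ℂ) * ((N⁻¹ : ℝ) * G) + Rm - ((α / N : ℝ) : ℂ) * fresnelConst =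
      ((α / N : ℝ) : ℂ) * (G - fresnelConst) + Rm := by
    push_cast; ring
  rw [heq]
  refine (norm_add_le _ _).trans ?_
  rw [norm_mul, Complex.norm_real, Real.norm_of_nonneg (by positivity)]
  calc α / N * ‖G - fresnelConst‖ + ‖Rm‖
      ≤ 2 / N * (1 / (N / 8) + 1 / (N / 8)) + C * (2 + (t - (t - 1))) / (2 * N ^ 2) := by
        gcongr
    _ = (32 + 3 / 2 * C) / N ^ 2 := by field_simp; ring

/-! ### The forcing with linear phase and the pointwise lower bound -/

theorem norm_linearForcing_le_one {n : ℕ} {η N : ℝ} (t : ℝ) (x : EuclideanSpace ℝ (Fin n)) :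
    ‖linearForcing n η N t x‖ ≤ 1 := by
  have h1 : ‖Complex.exp (-Complex.I * (N : ℂ) ^ 2 * (t : ℂ))‖ = 1 := by
    have : (-Complex.I * (N : ℂ) ^ 2 * (t : ℂ)) = ((-(N ^ 2 * t) : ℝ) : ℂ) * Complex.I := by
      push_cast; ring
    rw [this, Complex.norm_exp_ofReal_mul_I]
  have h2 : ∀ {α : Type} (s : Set α) (a : α), ‖s.indicator (fun _ => (1 : ℂ)) a‖ ≤ 1 :=
    fun s a => (norm_indicator_le_norm_self _ _).trans (by simp)
  rw [linearForcing, norm_mul, norm_mul, h1, one_mul]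
  exact mul_le_one₀ (h2 _ _) (norm_nonneg _) (h2 _ _)

theorem isForcing_linearForcing (n : ℕ) (η N : ℝ) : IsForcing (linearForcing n η N) where
  measurable := by
    have h1 : Measurable fun p : ℝ × EuclideanSpace ℝ (Fin n) =>
        Complex.exp (-Complex.I * (N : ℂ) ^ 2 * (p.1 : ℂ)) := by fun_prop
    have h2 : Measurable fun p : ℝ × EuclideanSpace ℝ (Fin n) =>
        (Icc (0 : ℝ) 1).indicator (fun _ => (1 : ℂ)) p.1 :=
      (measurable_const.indicator measurableSet_Icc).comp measurable_fst
    have h3 : Measurable fun p : ℝ × EuclideanSpace ℝ (Fin n) =>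
        (Metric.ball (0 : EuclideanSpace ℝ (Fin n)) (η / N)).indicator (fun _ => (1 : ℂ)) p.2 :=
      (measurable_const.indicator measurableSet_ball).comp measurable_snd
    exact (h1.mul h2).mul h3
  bounded := ⟨1, norm_linearForcing_le_one⟩
  compactSupport := by
    refine HasCompactSupport.of_support_subset_isCompact
      ((isCompact_Icc (a := (0 : ℝ)) (b := 1)).prod
        (isCompact_closedBall (0 : EuclideanSpace ℝ (Fin n)) (η / N))) ?_
    rintro ⟨t, x⟩ h
    rw [Function.mem_support] at h
    refine ⟨?_, ?_⟩
    · by_contra h1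
      refine h ?_
      rw [Function.uncurry_apply_pair, linearForcing, indicator_of_notMem h1]; simp
    · by_contra h1
      refine h ?_
      rw [Function.uncurry_apply_pair, linearForcing,
        indicator_of_notMem (s := Metric.ball _ _) fun h2 => h1 (Metric.ball_subset_closedBall h2)]
      simp

theorem linearForcing_eq_zero {n : ℕ} {η N : ℝ} (s : ℝ) (hs : s ∉ Icc (0 : ℝ) 1) :
    linearForcing n η N s = 0 := by
  funext x
  rw [linearForcing, indicator_of_notMem hs]; simp

/-- The oscillatory integral in the time variable for the forcing with linear phase. -/
def timeOscillation (n : ℕ) (N t ρ : ℝ) : ℂ :=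
  ∫ τ in (t - 1)..t, (((√τ ^ n)⁻¹ : ℝ) : ℂ) *
    Complex.exp ((N ^ 2 * phaseRoot (ρ / (2 * N)) τ ^ 2 : ℝ) * Complex.I)

/-- Change of variable τ = t - s. Completing the square extracts e^{iN|z|}, which carries the fast
dependence on z, from the time integral. -/
theorem integral_phase_mul_freeKernel {n : ℕ} {N t : ℝ} (hN : 0 < N) (ht : 2 ≤ t)
    (z : EuclideanSpace ℝ (Fin n)) :
    ∫ s in (0 : ℝ)..1, Complex.exp (-Complex.I * (N : ℂ) ^ 2 * (s : ℂ)) * freeKernel n (t - s) z =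
      freeKernelConst n * Complex.exp ((-(N ^ 2 * t) : ℝ) * Complex.I) *
        (Complex.exp ((N * ‖z‖ : ℝ) * Complex.I) * timeOscillation n N t ‖z‖) := by
  have h := intervalIntegral.integral_comp_sub_left (a := 0) (b := 1)
    (fun τ : ℝ => Complex.exp (-Complex.I * (N : ℂ) ^ 2 * ((t - τ : ℝ) : ℂ)) * freeKernel n τ z) t
  simp only [sub_sub_cancel, sub_zero] at h
  rw [h, timeOscillation, ← intervalIntegral.integral_const_mul,
    ← intervalIntegral.integral_const_mul]
  refine intervalIntegral.integral_congr fun τ hτ => ?_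
  rw [uIcc_of_le (by linarith)] at hτ
  have hτ0 : 0 < τ := by linarith [hτ.1]
  rw [phaseRoot_sq hN (norm_nonneg z) hτ0, freeKernel]
  have hexp : Complex.exp (-Complex.I * (N : ℂ) ^ 2 * ((t - τ : ℝ) : ℂ)) *
      Complex.exp ((‖z‖ ^ 2 / (4 * τ) : ℝ) * Complex.I) =
      Complex.exp ((-(N ^ 2 * t) : ℝ) * Complex.I) * (Complex.exp ((N * ‖z‖ : ℝ) * Complex.I) *
        Complex.exp ((N ^ 2 * τ + ‖z‖ ^ 2 / (4 * τ) - N * ‖z‖ : ℝ) * Complex.I)) := by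
    rw [← Complex.exp_add, ← Complex.exp_add, ← Complex.exp_add]
    congr 1
    push_cast; ring
  linear_combination (freeKernelConst n * (((√τ ^ n)⁻¹ : ℝ) : ℂ)) * hexp

theorem integrableOn_and_freeSolution_linearForcing {n : ℕ} {η N t : ℝ} (hN : 0 < N) (ht : 2 ≤ t)
    (x : EuclideanSpace ℝ (Fin n)) :
    IntegrableOn (fun y => freeKernelConst n * Complex.exp ((-(N ^ 2 * t) : ℝ) * Complex.I) *
        (Complex.exp ((N * ‖y - x‖ : ℝ) * Complex.I) * timeOscillation n N t ‖y - x‖))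
        (Metric.ball 0 (η / N)) ∧
    freeSolution n (linearForcing n η N) (t, x) = -Complex.I *
      ∫ y in Metric.ball 0 (η / N),
        freeKernelConst n * Complex.exp ((-(N ^ 2 * t) : ℝ) * Complex.I) *
        (Complex.exp ((N * ‖y - x‖ : ℝ) * Complex.I) * timeOscillation n N t ‖y - x‖) := by
  have hF := isForcing_linearForcing n η N
  have hint : Integrable (fun p : ℝ × EuclideanSpace ℝ (Fin n) =>
      linearForcing n η N p.1 p.2 * freeKernel n (t - p.1) (p.2 - x)) (volume.prod volume) :=
    (hF.integrable.norm.mul_const ‖freeKernelConst n‖).mono'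
      (hF.measurable_mul_freeKernel t x).aestronglyMeasurable
      (Eventually.of_forall fun p => norm_mul_freeKernel_le linearForcing_eq_zero ht _ _ _)
  have hslice : ∀ y, (∫ s, linearForcing n η N s y * freeKernel n (t - s) (y - x)) =
      (Metric.ball (0 : EuclideanSpace ℝ (Fin n)) (η / N)).indicator (fun y =>
        freeKernelConst n * Complex.exp ((-(N ^ 2 * t) : ℝ) * Complex.I) *
        (Complex.exp ((N * ‖y - x‖ : ℝ) * Complex.I) * timeOscillation n N t ‖y - x‖)) y := by
    intro y
    by_cases hy : y ∈ Metric.ball (0 : EuclideanSpace ℝ (Fin n)) (η / N)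
    · rw [indicator_of_mem hy, ← integral_phase_mul_freeKernel hN ht,
        intervalIntegral.integral_of_le zero_le_one, ← integral_Icc_eq_integral_Ioc,
        ← integral_indicator measurableSet_Icc]
      refine integral_congr_ae (Eventually.of_forall fun s => ?_)
      simp only [linearForcing, indicator_of_mem hy, mul_one]
      by_cases hs : s ∈ Icc (0 : ℝ) 1
      · simp only [indicator_of_mem hs, mul_one]
      · simp only [indicator_of_notMem hs, mul_zero, zero_mul]
    · rw [indicator_of_notMem hy]
      simp [linearForcing, indicator_of_notMem hy]
  constructor
  · have := hint.integral_prod_right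
    simp_rw [hslice] at this
    exact (integrable_indicator_iff measurableSet_ball).1 this
  · rw [freeSolution, Measure.volume_eq_prod, integral_prod_symm _ hint]
    simp_rw [hslice]
    rw [integral_indicator measurableSet_ball]

/-- If the integrand stays within δ of a ray, rotating that ray onto the positive axis and taking
real parts excludes cancellation. -/
theorem le_norm_setIntegral_of_aligned {α : Type*} [MeasurableSpace α] {μ : Measure α}
    {B : Set α} (hB : MeasurableSet B) (hμ : μ B ≠ ∞) {G : α → ℂ} (hG : IntegrableOn G B μ) {z : ℂ}
    {a : α → ℝ} {a₀ δ : ℝ} (h0 : ∀ y ∈ B, a₀ ≤ a y) (h : ∀ y ∈ B, ‖G y - a y * z‖ ≤ δ) :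
    (‖z‖ * a₀ - δ) * μ.real B ≤ ‖∫ y in B, G y ∂μ‖ := by
  -- For z = 0 there is no direction to rotate to. If moreover B is empty then δ may be negative,
  -- but both sides vanish.
  by_cases hz : z = 0
  · by_cases hne : B.Nonempty
    · obtain ⟨y, hy⟩ := hne
      have hδ : 0 ≤ δ := (norm_nonneg _).trans (h y hy)
      rw [hz, norm_zero, zero_mul, zero_sub]
      exact (mul_nonpos_of_nonpos_of_nonneg (by linarith) measureReal_nonneg).trans
        (norm_nonneg _)
    · rw [not_nonempty_iff_eq_empty.1 hne]; simp
  set w : ℂ := (starRingEnd ℂ) z / ‖z‖ with hw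
  have hz0 : ‖z‖ ≠ 0 := norm_ne_zero_iff.2 hz
  have hwn : ‖w‖ = 1 := by
    rw [hw, norm_div, RCLike.norm_conj, Complex.norm_real, norm_norm, div_self hz0]
  have hwz : w * z = ‖z‖ := by
    have hz1 : (‖z‖ : ℂ) ≠ 0 := by exact_mod_cast hz0
    rw [hw, div_mul_eq_mul_div, Complex.conj_mul', sq, mul_div_assoc, div_self hz1, mul_one]
  have hre : ∀ y ∈ B, ‖z‖ * a₀ - δ ≤ (w * G y).re := by
    intro y hy
    have h1 : w * G y = ((a y * ‖z‖ : ℝ) : ℂ) + w * (G y - a y * z) := by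
      push_cast; rw [← hwz]; ring
    have h2 := Complex.abs_re_le_norm (w * (G y - a y * z))
    rw [norm_mul, hwn, one_mul] at h2
    have h3 := (abs_le.1 (h2.trans (h y hy))).1
    rw [h1, Complex.add_re, Complex.ofReal_re]
    nlinarith [mul_le_mul_of_nonneg_left (h0 y hy) (norm_nonneg z)]
  have hwG : IntegrableOn (fun y => w * G y) B μ := hG.const_mul w
  calc (‖z‖ * a₀ - δ) * μ.real B = ∫ _ in B, (‖z‖ * a₀ - δ) ∂μ := by
        rw [setIntegral_const, smul_eq_mul, mul_comm]
    _ ≤ ∫ y in B, (w * G y).re ∂μ :=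
        setIntegral_mono_on (integrableOn_const hμ) hwG.re hB hre
    _ = (w * ∫ y in B, G y ∂μ).re := by
        rw [← integral_const_mul]
        exact integral_re hwG
    _ ≤ ‖w * ∫ y in B, G y ∂μ‖ := (le_abs_self _).trans (Complex.abs_re_le_norm _)
    _ = ‖∫ y in B, G y ∂μ‖ := by rw [norm_mul, hwn, one_mul]

theorem volume_ball_eq {n : ℕ} (x : EuclideanSpace ℝ (Fin n)) {r : ℝ} (hr : 0 < r) :
    volume (Metric.ball x r) = ENNReal.ofReal
      (r ^ n * volume.real (Metric.ball (0 : EuclideanSpace ℝ (Fin n)) 1)) := by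
  rw [Measure.addHaar_ball_of_pos _ _ hr, finrank_euclideanSpace, Fintype.card_fin,
    ENNReal.ofReal_mul (by positivity), ofReal_measureReal measure_ball_lt_top.ne]

theorem volume_real_ball {n : ℕ} (x : EuclideanSpace ℝ (Fin n)) {r : ℝ} (hr : 0 < r) :
    volume.real (Metric.ball x r) =
      r ^ n * volume.real (Metric.ball (0 : EuclideanSpace ℝ (Fin n)) 1) := by
  rw [measureReal_def, volume_ball_eq x hr, ENNReal.toReal_ofReal (by positivity)]

theorem volume_real_unitBall_pos (n : ℕ) :
    0 < volume.real (Metric.ball (0 : EuclideanSpace ℝ (Fin n)) 1) :=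
  ENNReal.toReal_pos (Metric.measure_ball_pos _ _ one_pos).ne' measure_ball_lt_top.ne

/-- For y in B(η/N) the integrand is compared with a positive multiple a(y) of one fixed complex
number. The discrepancy has two sources: the stationary phase error C/N², and the change of
e^{iN|y-x|} against e^{iN|x|}, at most η. -/
theorem exists_freeSolution_lower_bound (n : ℕ) :
    ∃ η₀ : ℝ, 0 < η₀ ∧ ∃ N₀ : ℝ, 0 < N₀ ∧ ∃ c : ℝ, 0 < c ∧
      ∀ η : ℝ, 0 < η → η ≤ η₀ → ∀ N : ℝ, N₀ ≤ N → ∀ p ∈ shellRegion n η N,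
        c * η ^ n * (N ^ (1 + n))⁻¹ ≤ ‖freeSolution n (linearForcing n η N) p‖ := by
  obtain ⟨C, hC0, hC⟩ := exists_stationary_phase n
  set ω := volume.real (Metric.ball (0 : EuclideanSpace ℝ (Fin n)) 1) with hω
  have hω0 : 0 < ω := volume_real_unitBall_pos n
  set κ := ‖freeKernelConst n‖ with hκ
  have hκ0 : 0 < κ := norm_pos_iff.2 (freeKernelConst_ne_zero n)
  set ζ := ‖fresnelConst‖ with hζ
  have hζ0 : 0 < ζ := norm_pos_iff.2 fresnelConst_ne_zero
  set d : ℝ := (2 ^ n)⁻¹ with hd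
  have hd0 : 0 < d := by positivity
  -- The main term is at least κζd/N, where d = 2^{-n} bounds √T^{1-n} from below because 1 ≤ √T ≤
  -- 2. The thresholds make each of the errors C/N and 2ζη at most ζd/4, so half of the main term
  -- survives.
  refine ⟨d / 8, by positivity, 1 + 4 * C / (ζ * d), by positivity, κ * ζ * d / 2 * ω,
    by positivity, ?_⟩
  rintro η hη hη0 N hN ⟨t, x⟩ ⟨ht, hx1, hx2⟩
  simp only at ht hx1 hx2
  have hN0 : 0 < N := lt_of_lt_of_le (by positivity) hN
  have hCN : C / N ≤ ζ * d / 4 := by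
    have : 4 * C / (ζ * d) ≤ N := by linarith
    rw [div_le_iff₀ (by positivity)] at this
    rw [div_le_iff₀ hN0]
    linarith
  obtain ⟨hI, hS⟩ := integrableOn_and_freeSolution_linearForcing (η := η) hN0 ht.1 x
  rw [hS, norm_mul, norm_neg, Complex.norm_I, one_mul]
  set T : EuclideanSpace ℝ (Fin n) → ℝ := fun y => ‖y - x‖ / (2 * N) with hT
  set a : EuclideanSpace ℝ (Fin n) → ℝ := fun y => √(T y) * (√(T y) ^ n)⁻¹ / N with ha
  set E : ℂ := Complex.exp ((-(N ^ 2 * t) : ℝ) * Complex.I) with hE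
  have hE1 : ‖E‖ = 1 := Complex.norm_exp_ofReal_mul_I _
  have hdiff : ∀ y ∈ Metric.ball (0 : EuclideanSpace ℝ (Fin n)) (η / N),
      |‖y - x‖ - ‖x‖| ≤ η / N := fun y hy => by
    have h1 := abs_norm_sub_norm_le (y - x) (-x)
    rw [norm_neg, sub_neg_eq_add, sub_add_cancel] at h1
    exact h1.trans (mem_ball_zero_iff.1 hy).le
  -- The margin η/N in the definition of the shell absorbs the displacement of y, since ‖y - x‖ and
  -- ‖x‖ differ by at most η/N.
  have hTmem : ∀ y ∈ Metric.ball (0 : EuclideanSpace ℝ (Fin n)) (η / N),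
      T y ∈ Icc (t - 3 / 4) (t - 1 / 4) := fun y hy => by
    have h1 := abs_le.1 (hdiff y hy)
    rw [div_eq_mul_inv] at h1
    constructor
    · rw [hT, le_div_iff₀ (by positivity)]; linarith [h1.1]
    · rw [hT, div_le_iff₀ (by positivity)]; linarith [h1.2]
  have hsq : ∀ y ∈ Metric.ball (0 : EuclideanSpace ℝ (Fin n)) (η / N),
      1 ≤ √(T y) ∧ √(T y) ≤ 2 := fun y hy => by
    have h1 := hTmem y hy
    refine ⟨Real.one_le_sqrt.2 (by linarith [h1.1, ht.1]), ?_⟩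
    rw [Real.sqrt_le_left two_pos.le]; linarith [h1.2, ht.2]
  have ha0 : ∀ y ∈ Metric.ball (0 : EuclideanSpace ℝ (Fin n)) (η / N), d / N ≤ a y :=
    fun y hy => by
      obtain ⟨h1, h2⟩ := hsq y hy
      have h3 : d ≤ (√(T y) ^ n)⁻¹ := by
        rw [hd]
        exact inv_anti₀ (by positivity) (pow_le_pow_left₀ (by positivity) h2 n)
      have h4 : d ≤ √(T y) * (√(T y) ^ n)⁻¹ :=
        h3.trans (le_mul_of_one_le_left (by positivity) h1)
      exact div_le_div_of_nonneg_right h4 hN0.le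
  have ha2 : ∀ y ∈ Metric.ball (0 : EuclideanSpace ℝ (Fin n)) (η / N), a y ≤ 2 / N :=
    fun y hy => by
      obtain ⟨h1, h2⟩ := hsq y hy
      have h3 : (√(T y) ^ n)⁻¹ ≤ 1 := inv_le_one_of_one_le₀ (one_le_pow₀ h1)
      have h4 : √(T y) * (√(T y) ^ n)⁻¹ ≤ 2 :=
        (mul_le_of_le_one_right (by positivity) h3).trans h2
      exact div_le_div_of_nonneg_right h4 hN0.le
  have hball := le_norm_setIntegral_of_aligned (μ := volume)
    (B := Metric.ball (0 : EuclideanSpace ℝ (Fin n)) (η / N))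
    (z := freeKernelConst n * E * (Complex.exp ((N * ‖x‖ : ℝ) * Complex.I) * fresnelConst))
    (a := a) (a₀ := d / N) (δ := κ * (C / N ^ 2 + 2 / N * ζ * η))
    measurableSet_ball measure_ball_lt_top.ne hI ha0 ?_
  · refine le_trans ?_ hball
    rw [norm_mul, norm_mul, norm_mul, hE1, Complex.norm_exp_ofReal_mul_I, mul_one, one_mul,
      volume_real_ball _ (by positivity), ← hκ, ← hζ, ← hω]
    have h1 : κ * ζ * d / 2 / N ≤ κ * ζ * (d / N) - κ * (C / N ^ 2 + 2 / N * ζ * η) := by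
      have h2 : κ * ζ * (d / N) - κ * (C / N ^ 2 + 2 / N * ζ * η) =
          κ * (ζ * d - C / N - 2 * ζ * η) / N := by field_simp; ring
      rw [h2]
      refine div_le_div_of_nonneg_right ?_ hN0.le
      have h3 : ζ * η ≤ ζ * (d / 8) := mul_le_mul_of_nonneg_left hη0 hζ0.le
      have h4 : ζ * d / 2 ≤ ζ * d - C / N - 2 * ζ * η := by linarith
      calc κ * ζ * d / 2 = κ * (ζ * d / 2) := by ring
        _ ≤ _ := mul_le_mul_of_nonneg_left h4 hκ0.le
    refine le_trans (le_of_eq ?_) (mul_le_mul_of_nonneg_right h1 (by positivity))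
    rw [div_pow, pow_add, pow_one]
    field_simp
  · intro y hy
    have h1 := hC N hN0 t ht (T y) (hTmem y hy)
    have h2 : ‖Complex.exp ((N * ‖y - x‖ : ℝ) * Complex.I) -
        Complex.exp ((N * ‖x‖ : ℝ) * Complex.I)‖ ≤ η := by
      have h3 : Complex.exp ((N * ‖y - x‖ : ℝ) * Complex.I) -
          Complex.exp ((N * ‖x‖ : ℝ) * Complex.I) = Complex.exp ((N * ‖x‖ : ℝ) * Complex.I) *
            (Complex.exp (Complex.I * (N * (‖y - x‖ - ‖x‖) : ℝ)) - 1) := by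
        rw [mul_sub, ← Complex.exp_add, mul_one]
        congr 2
        push_cast; ring
      rw [h3, norm_mul, Complex.norm_exp_ofReal_mul_I, one_mul]
      refine Real.norm_exp_I_mul_ofReal_sub_one_le.trans ?_
      rw [Real.norm_eq_abs, abs_mul, abs_of_pos hN0]
      calc N * |‖y - x‖ - ‖x‖| ≤ N * (η / N) :=
            mul_le_mul_of_nonneg_left (hdiff y hy) hN0.le
        _ = η := by field_simp
    have h4 : freeKernelConst n * E * (Complex.exp ((N * ‖y - x‖ : ℝ) * Complex.I) *
        timeOscillation n N t ‖y - x‖) - a y * (freeKernelConst n * E *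
          (Complex.exp ((N * ‖x‖ : ℝ) * Complex.I) * fresnelConst)) =
        freeKernelConst n * E * (Complex.exp ((N * ‖y - x‖ : ℝ) * Complex.I) *
          (timeOscillation n N t ‖y - x‖ - a y * fresnelConst) + a y * fresnelConst *
          (Complex.exp ((N * ‖y - x‖ : ℝ) * Complex.I) -
            Complex.exp ((N * ‖x‖ : ℝ) * Complex.I))) := by ring
    rw [h4, norm_mul, norm_mul, hE1, mul_one]
    refine mul_le_mul_of_nonneg_left ((norm_add_le _ _).trans (add_le_add ?_ ?_)) hκ0.le
    · rw [norm_mul, Complex.norm_exp_ofReal_mul_I, one_mul]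
      exact h1
    · rw [norm_mul, norm_mul, Complex.norm_real]
      have h5 : ‖a y‖ ≤ 2 / N := by
        rw [Real.norm_of_nonneg ((by positivity : 0 ≤ d / N).trans (ha0 y hy))]
        exact ha2 y hy
      gcongr

/-! ### Bounds for mixed norms -/

/-- Valid at the endpoints as well: for r = 1 the conjugate exponent is ∞, whose `toReal` is 0, and
1/0 = 0. -/
theorem one_div_toReal_conjExponent {r : ℝ≥0∞} (hr : 1 ≤ r) :
    1 / r.conjExponent.toReal = 1 - (r⁻¹).toReal := by
  have h := ENNReal.HolderConjugate.conjExponent hr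
  have h1 : r⁻¹ + r.conjExponent⁻¹ = 1 := ENNReal.HolderConjugate.inv_add_inv_eq_one r _
  have h2 : r⁻¹ ≠ ∞ := ne_top_of_le_ne_top ENNReal.one_ne_top (h1 ▸ le_self_add)
  have h3 : r.conjExponent⁻¹ ≠ ∞ := ne_top_of_le_ne_top ENNReal.one_ne_top (h1 ▸ le_add_self)
  have h4 := congrArg ENNReal.toReal h1
  rw [ENNReal.toReal_add h2 h3, ENNReal.toReal_inv r.conjExponent, ENNReal.toReal_one] at h4
  rw [one_div]; linarith

theorem toReal_inv_mem_Icc {r : ℝ≥0∞} (hr : 1 ≤ r) : (r⁻¹).toReal ∈ Icc (0 : ℝ) 1 :=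
  ⟨ENNReal.toReal_nonneg, ENNReal.toReal_le_of_le_ofReal zero_le_one (by simpa using hr)⟩

theorem le_eLpNorm_of_forall_mem {α : Type*} [MeasurableSpace α] {μ : Measure α} {s : Set α}
    (hs : MeasurableSet s) (h0 : μ s ≠ 0) {f : α → ℂ} {a : ℝ} (ha : 0 ≤ a)
    (hf : ∀ᵐ x ∂μ, x ∈ s → a ≤ ‖f x‖) {p : ℝ≥0∞} (hp : p ≠ 0) :
    ENNReal.ofReal a * μ s ^ (1 / p.toReal) ≤ eLpNorm f p μ := by
  have h1 : eLpNorm (fun _ : α => a) p (μ.restrict s) ≤ eLpNorm f p (μ.restrict s) := by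
    refine eLpNorm_mono_ae ?_
    filter_upwards [(ae_restrict_iff' hs).2 hf] with x hx
    rwa [Real.norm_of_nonneg ha]
  rw [eLpNorm_const _ hp (by simpa using h0), Measure.restrict_apply_univ,
    Real.enorm_of_nonneg ha] at h1
  exact h1.trans (eLpNorm_mono_measure _ Measure.restrict_le_self)

theorem eLpNorm_le_measure_rpow {α : Type*} [MeasurableSpace α] {μ : Measure α} {s : Set α}
    (hs : MeasurableSet s) (h0 : μ s ≠ 0) {f : α → ℂ} (hf : ∀ x, ‖f x‖ ≤ 1)
    (hfs : ∀ x, x ∉ s → f x = 0) {p : ℝ≥0∞} (hp : p ≠ 0) :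
    eLpNorm f p μ ≤ μ s ^ (1 / p.toReal) := by
  have h1 : f = s.indicator f := by
    refine (indicator_eq_self.2 fun x hx => ?_).symm
    by_contra h
    exact hx (hfs x h)
  rw [h1, eLpNorm_indicator_eq_eLpNorm_restrict hs]
  refine (eLpNorm_mono (g := fun _ => (1 : ℝ)) fun x => (hf x).trans (by simp)).trans ?_
  rw [eLpNorm_const _ hp (by simpa using h0)]
  simp

theorem le_eLpNorm_time_of_forall_mem {g : ℝ → ℝ≥0∞} {D : ℝ≥0∞}
    (h : ∀ t ∈ Icc (2 : ℝ) 3, D ≤ g t) {q : ℝ≥0∞} (hq : q ≠ 0) :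
    D ≤ eLpNorm g q (volume.restrict (Ioi (0 : ℝ))) := by
  have hv : (volume.restrict (Icc (2 : ℝ) 3)) univ = 1 := by
    rw [Measure.restrict_apply_univ, Real.volume_Icc]; norm_num
  have hne : volume.restrict (Icc (2 : ℝ) 3) ≠ 0 := by
    intro h0; rw [h0] at hv; simp at hv
  calc D = eLpNorm (fun _ : ℝ => D) q (volume.restrict (Icc (2 : ℝ) 3)) := by
        rw [eLpNorm_const _ hq hne, hv]; simp
    _ ≤ eLpNorm g q (volume.restrict (Icc (2 : ℝ) 3)) := by
        refine eLpNorm_mono_enorm_ae ?_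
        filter_upwards [ae_restrict_mem measurableSet_Icc] with t ht
        exact h t ht
    _ ≤ _ := eLpNorm_mono_measure _ (Measure.restrict_mono_set _ fun t ht => by
        have := ht.1; simp only [mem_Ioi]; linarith)

theorem mixedNorm_le_of_norm_le_one {n : ℕ} {F : ℝ → EuclideanSpace ℝ (Fin n) → ℂ}
    (hF : ∀ t x, ‖F t x‖ ≤ 1) (hs : ∀ s, s ∉ Icc (0 : ℝ) 1 → F s = 0) {ρ : ℝ} (hρ : 0 < ρ)
    (hx : ∀ t x, x ∉ Metric.ball 0 ρ → F t x = 0) {q r : ℝ≥0∞} (hq : q ≠ 0) (hr : r ≠ 0) :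
    mixedNorm q r F ≤ volume (Metric.ball (0 : EuclideanSpace ℝ (Fin n)) ρ) ^ (1 / r.toReal) := by
  set V := volume (Metric.ball (0 : EuclideanSpace ℝ (Fin n)) ρ) ^ (1 / r.toReal)
  have h1 : ∀ t, eLpNorm (F t) r volume ≤ (Icc (0 : ℝ) 1).indicator (fun _ => V) t := by
    intro t
    by_cases ht : t ∈ Icc (0 : ℝ) 1
    · rw [indicator_of_mem ht]
      exact eLpNorm_le_measure_rpow measurableSet_ball (Metric.measure_ball_pos _ _ hρ).ne'
        (hF t) (hx t) hr
    · rw [indicator_of_notMem ht, hs t ht]; simp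
  have hv : (volume.restrict (Icc (0 : ℝ) 1)) univ = 1 := by
    rw [Measure.restrict_apply_univ, Real.volume_Icc]; norm_num
  have hne : volume.restrict (Icc (0 : ℝ) 1) ≠ 0 := by
    intro h0; rw [h0] at hv; simp at hv
  calc mixedNorm q r F ≤ eLpNorm (fun t => eLpNorm (F t) r volume) q volume :=
        eLpNorm_mono_measure _ Measure.restrict_le_self
    _ ≤ eLpNorm ((Icc (0 : ℝ) 1).indicator (fun _ => V)) q volume :=
        eLpNorm_mono_enorm h1
    _ = V := by
        rw [eLpNorm_indicator_eq_eLpNorm_restrict measurableSet_Icc, eLpNorm_const _ hq hne, hv]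
        simp

theorem linearForcing_eq_zero_of_notMem_ball {n : ℕ} {η N : ℝ} (t : ℝ)
    (x : EuclideanSpace ℝ (Fin n)) (hx : x ∉ Metric.ball 0 (η / N)) :
    linearForcing n η N t x = 0 := by
  rw [linearForcing, indicator_of_notMem (a := x) hx, mul_zero]

/-- A centre at the middle radius 2(t - 1/2)N works: the shell extends N/2 - η/N ≥ N/4 on either
side of it. This ball replaces the shell in all norm computations; n ≥ 1 supplies a direction for
the centre. -/
theorem exists_ball_subset_shell {n : ℕ} (hn : 1 ≤ n) {η N : ℝ} (hN : 1 ≤ N) (hη : η ≤ 1 / 4)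
    {t : ℝ} (ht : t ∈ Icc (2 : ℝ) 3) :
    ∃ x : EuclideanSpace ℝ (Fin n), ∀ y ∈ Metric.ball x (N / 4), (t, y) ∈ shellRegion n η N := by
  have h1 : η * N⁻¹ ≤ N / 4 := by
    have : N⁻¹ ≤ 1 := inv_le_one_of_one_le₀ hN
    have h0 : 0 < N⁻¹ := by positivity
    rcases le_total η 0 with h | h
    · nlinarith
    · nlinarith
  have hr : 0 ≤ 2 * (t - 1 / 2) * N := by nlinarith [ht.1]
  let i : Fin n := ⟨0, hn⟩
  refine ⟨EuclideanSpace.single i (2 * (t - 1 / 2) * N), fun y hy => ?_⟩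
  have hx : ‖(EuclideanSpace.single i (2 * (t - 1 / 2) * N) : EuclideanSpace ℝ (Fin n))‖ =
      2 * (t - 1 / 2) * N := by
    rw [PiLp.norm_single, Real.norm_of_nonneg hr]
  rw [mem_ball_iff_norm] at hy
  have h2 := abs_le.1 ((abs_norm_sub_norm_le y (EuclideanSpace.single i _)).trans hy.le)
  have h3 := abs_lt.1 ((abs_norm_sub_norm_le y (EuclideanSpace.single i _)).trans_lt hy)
  rw [hx] at h3
  refine ⟨ht, ?_, ?_⟩ <;> dsimp only <;> linarith [h3.1, h3.2]

theorem nonpos_of_mul_rpow_le {a b γ N₀ : ℝ} (ha : 0 < a)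
    (h : ∀ N, N₀ ≤ N → a * N ^ γ ≤ b) : γ ≤ 0 := by
  by_contra! hγ
  have h1 : Tendsto (fun N : ℝ => a * N ^ γ) atTop atTop :=
    (tendsto_rpow_atTop hγ).const_mul_atTop ha
  obtain ⟨N, hN, hN'⟩ := ((h1.eventually_gt_atTop b).and (eventually_ge_atTop N₀)).exists
  exact absurd (h N hN') (not_le.2 hN)

/-! ### Symmetry under time reversal and the aligned forcing -/

section

variable {n : ℕ} {F G : ℝ → EuclideanSpace ℝ (Fin n) → ℂ}

theorem freeKernel_neg (τ : ℝ) (z : EuclideanSpace ℝ (Fin n)) :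
    freeKernel n τ (-z) = freeKernel n τ z := by
  simp only [freeKernel, norm_neg]

/-- Reversal t = 3 - s exchanges [0,1] with [2,3], so the elapsed time 3 - s - s' is again at least
1 on the supports. -/
theorem integrable_mul_mul_freeKernel (hF : IsForcing F) (hG : IsForcing G)
    (hFs : ∀ s, s ∉ Icc (0 : ℝ) 1 → F s = 0) (hGs : ∀ s, s ∉ Icc (0 : ℝ) 1 → G s = 0) :
    Integrable (fun z : (ℝ × EuclideanSpace ℝ (Fin n)) × (ℝ × EuclideanSpace ℝ (Fin n)) =>
      F z.1.1 z.1.2 * (G z.2.1 z.2.2 * freeKernel n (3 - z.1.1 - z.2.1) (z.2.2 - z.1.2)))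
      (volume.prod volume) := by
  have h1 : Measurable fun p : ℝ × EuclideanSpace ℝ (Fin n) => F p.1 p.2 := hF.measurable
  have h2 : Measurable fun p : ℝ × EuclideanSpace ℝ (Fin n) => G p.1 p.2 := hG.measurable
  have h3 : Measurable fun z : (ℝ × EuclideanSpace ℝ (Fin n)) × (ℝ × EuclideanSpace ℝ (Fin n)) =>
      freeKernel n (3 - z.1.1 - z.2.1) (z.2.2 - z.1.2) := by
    unfold freeKernel; fun_prop
  refine (hF.integrable.norm.mul_prod (hG.integrable.norm.mul_const ‖freeKernelConst n‖)).mono'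
    ((h1.comp measurable_fst).mul ((h2.comp measurable_snd).mul h3)).aestronglyMeasurable
    (Eventually.of_forall fun z => ?_)
  rw [norm_mul]
  by_cases h : z.1.1 ∈ Icc (0 : ℝ) 1
  · exact mul_le_mul_of_nonneg_left
      (norm_mul_freeKernel_le hGs (by linarith [h.2]) _ _ _) (norm_nonneg _)
  · simp [hFs _ h]

theorem integrable_mul_freeSolution (hF : IsForcing F) (hG : IsForcing G)
    (hFs : ∀ s, s ∉ Icc (0 : ℝ) 1 → F s = 0) (hGs : ∀ s, s ∉ Icc (0 : ℝ) 1 → G s = 0) :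
    Integrable fun p : ℝ × EuclideanSpace ℝ (Fin n) =>
      F p.1 p.2 * freeSolution n G (3 - p.1, p.2) := by
  have h := (integrable_mul_mul_freeKernel hF hG hFs hGs).integral_prod_left.const_mul (-Complex.I)
  refine h.congr (Eventually.of_forall fun p => ?_)
  simp only [freeSolution, integral_const_mul]
  ring

/-- The map taking a forcing term to its solution is symmetric with respect to the time reversed
bilinear pairing. -/
theorem integral_mul_freeSolution_comm (hF : IsForcing F) (hG : IsForcing G)
    (hFs : ∀ s, s ∉ Icc (0 : ℝ) 1 → F s = 0) (hGs : ∀ s, s ∉ Icc (0 : ℝ) 1 → G s = 0) :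
    ∫ p : ℝ × EuclideanSpace ℝ (Fin n), F p.1 p.2 * freeSolution n G (3 - p.1, p.2) =
      ∫ p : ℝ × EuclideanSpace ℝ (Fin n), G p.1 p.2 * freeSolution n F (3 - p.1, p.2) := by
  have h := integral_integral_swap
    (f := fun p q : ℝ × EuclideanSpace ℝ (Fin n) =>
      F p.1 p.2 * (G q.1 q.2 * freeKernel n (3 - p.1 - q.1) (q.2 - p.2)))
    (integrable_mul_mul_freeKernel hF hG hFs hGs)
  have h1 := congrArg (fun z => -Complex.I * z) h
  simp only [← integral_const_mul] at h1
  convert h1 using 1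
  · refine integral_congr_ae (Eventually.of_forall fun p => ?_)
    simp only [freeSolution, integral_const_mul]
    ring
  · refine integral_congr_ae (Eventually.of_forall fun q => ?_)
    simp only [freeSolution, ← integral_const_mul]
    refine integral_congr_ae (Eventually.of_forall fun p => ?_)
    simp only
    -- The kernel depends only on 3 - s - s' and on the even variable x - y, both unchanged up to
    -- sign when the two forcings are exchanged.
    rw [sub_right_comm, ← freeKernel_neg, neg_sub]
    ring

theorem IsForcing.measurable_freeSolution (hF : IsForcing F) : Measurable (freeSolution n F) := by
  have h1 : Measurable fun p : ℝ × EuclideanSpace ℝ (Fin n) => F p.1 p.2 := hF.measurable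
  have h3 : Measurable fun z : (ℝ × EuclideanSpace ℝ (Fin n)) × (ℝ × EuclideanSpace ℝ (Fin n)) =>
      freeKernel n (z.1.1 - z.2.1) (z.2.2 - z.1.2) := by
    unfold freeKernel; fun_prop
  have h4 : StronglyMeasurable fun q : ℝ × EuclideanSpace ℝ (Fin n) =>
      ∫ p : ℝ × EuclideanSpace ℝ (Fin n), F p.1 p.2 * freeKernel n (q.1 - p.1) (p.2 - q.2) :=
    (((h1.comp measurable_snd).mul h3).stronglyMeasurable).integral_prod_right
  exact h4.measurable.const_mul _

end

/-- The forcing term aligned with a function `v` on `[2,3] × B(R)`, with time reversed. -/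
def alignedForcing {n : ℕ} (v : ℝ × EuclideanSpace ℝ (Fin n) → ℂ) (R : ℝ) (s : ℝ)
    (x : EuclideanSpace ℝ (Fin n)) : ℂ :=
  (Icc (0 : ℝ) 1 ×ˢ Metric.ball (0 : EuclideanSpace ℝ (Fin n)) R).indicator
    (fun p => (starRingEnd ℂ) (v (3 - p.1, p.2)) / ‖v (3 - p.1, p.2)‖) (s, x)

section

variable {n : ℕ} {v : ℝ × EuclideanSpace ℝ (Fin n) → ℂ} {R : ℝ}

theorem alignedForcing_eq_zero (s : ℝ) (hs : s ∉ Icc (0 : ℝ) 1) : alignedForcing v R s = 0 := by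
  funext x
  rw [alignedForcing, indicator_of_notMem fun h => hs h.1, Pi.zero_apply]

theorem alignedForcing_eq_zero_of_notMem_ball (s : ℝ) (x : EuclideanSpace ℝ (Fin n))
    (hx : x ∉ Metric.ball 0 R) : alignedForcing v R s x = 0 := by
  rw [alignedForcing, indicator_of_notMem fun h => hx h.2]

theorem norm_alignedForcing_le_one (s : ℝ) (x : EuclideanSpace ℝ (Fin n)) :
    ‖alignedForcing v R s x‖ ≤ 1 := by
  refine (norm_indicator_le_norm_self _ _).trans ?_
  rw [norm_div, RCLike.norm_conj, Complex.norm_real, norm_norm]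
  -- Where v vanishes the quotient is 0/0 = 0, hence an inequality and not an equality.
  exact div_self_le_one _

theorem isForcing_alignedForcing (hv : Measurable v) : IsForcing (alignedForcing v R) where
  measurable := by
    have h1 : Measurable fun p : ℝ × EuclideanSpace ℝ (Fin n) => v (3 - p.1, p.2) :=
      hv.comp (by fun_prop)
    have h2 : Measurable fun p : ℝ × EuclideanSpace ℝ (Fin n) =>
        (starRingEnd ℂ) (v (3 - p.1, p.2)) / ‖v (3 - p.1, p.2)‖ :=
      (Complex.continuous_conj.measurable.comp h1).div
        (Complex.measurable_ofReal.comp h1.norm)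
    exact h2.indicator (measurableSet_Icc.prod measurableSet_ball)
  bounded := ⟨1, norm_alignedForcing_le_one⟩
  compactSupport := by
    refine HasCompactSupport.of_support_subset_isCompact
      ((isCompact_Icc (a := (0 : ℝ)) (b := 1)).prod
        (isCompact_closedBall (0 : EuclideanSpace ℝ (Fin n)) R)) ?_
    rintro ⟨t, x⟩ h
    have h' : (t, x) ∈ Icc (0 : ℝ) 1 ×ˢ Metric.ball (0 : EuclideanSpace ℝ (Fin n)) R := by
      by_contra h1
      refine h ?_
      rw [Function.uncurry_apply_pair, alignedForcing, indicator_of_notMem h1]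
    exact ⟨h'.1, Metric.ball_subset_closedBall h'.2⟩

theorem alignedForcing_mul {s : ℝ} (hs : s ∈ Icc (0 : ℝ) 1) {x : EuclideanSpace ℝ (Fin n)}
    (hx : x ∈ Metric.ball 0 R) :
    alignedForcing v R s x * v (3 - s, x) = (‖v (3 - s, x)‖ : ℂ) := by
  rw [alignedForcing, indicator_of_mem (mk_mem_prod hs hx)]
  by_cases h : v (3 - s, x) = 0
  · simp [h]
  have h0 : (‖v (3 - s, x)‖ : ℂ) ≠ 0 := by simpa using h
  simp only
  rw [div_mul_eq_mul_div, Complex.conj_mul', sq, mul_div_assoc, div_self h0, mul_one]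

theorem alignedForcing_mul_eq_norm (s : ℝ) (x : EuclideanSpace ℝ (Fin n)) :
    alignedForcing v R s x * v (3 - s, x) = (‖alignedForcing v R s x * v (3 - s, x)‖ : ℂ) := by
  by_cases hs : s ∈ Icc (0 : ℝ) 1
  · by_cases hx : x ∈ Metric.ball 0 R
    · rw [alignedForcing_mul hs hx, Complex.norm_real, norm_norm]
    · simp [alignedForcing_eq_zero_of_notMem_ball s x hx]
  · simp [alignedForcing_eq_zero s hs]

/-- The integrand is real and nonnegative by the choice of the phase, so the integral loses nothing.
-/
theorem enorm_integral_alignedForcing_mul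
    (hint : Integrable fun p : ℝ × EuclideanSpace ℝ (Fin n) =>
      alignedForcing v R p.1 p.2 * v (3 - p.1, p.2)) :
    ‖∫ p : ℝ × EuclideanSpace ℝ (Fin n), alignedForcing v R p.1 p.2 * v (3 - p.1, p.2)‖ₑ =
      ∫⁻ p : ℝ × EuclideanSpace ℝ (Fin n), ‖alignedForcing v R p.1 p.2 * v (3 - p.1, p.2)‖ₑ := by
  rw [← ofReal_integral_norm_eq_lintegral_enorm hint,
    integral_congr_ae (Eventually.of_forall fun p : ℝ × EuclideanSpace ℝ (Fin n) =>
      alignedForcing_mul_eq_norm p.1 p.2), integral_complex_ofReal, ← ofReal_norm,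
    Complex.norm_real, Real.norm_of_nonneg (integral_nonneg fun _ => norm_nonneg _)]

theorem le_lintegral_alignedForcing_mul
    (hint : Integrable fun p : ℝ × EuclideanSpace ℝ (Fin n) =>
      alignedForcing v R p.1 p.2 * v (3 - p.1, p.2)) {a : ℝ} {V : ℝ≥0∞}
    (h : ∀ t ∈ Icc (2 : ℝ) 3, ∃ S ⊆ Metric.ball (0 : EuclideanSpace ℝ (Fin n)) R,
      MeasurableSet S ∧ volume S = V ∧ ∀ x ∈ S, a ≤ ‖v (t, x)‖) :
    ENNReal.ofReal a * V ≤
      ∫⁻ p : ℝ × EuclideanSpace ℝ (Fin n), ‖alignedForcing v R p.1 p.2 * v (3 - p.1, p.2)‖ₑ := by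
  have hm := hint.aestronglyMeasurable.enorm
  rw [Measure.volume_eq_prod] at hm ⊢
  rw [lintegral_prod _ hm]
  calc ENNReal.ofReal a * V = ∫⁻ _ in Icc (0 : ℝ) 1, ENNReal.ofReal a * V := by simp
    _ ≤ ∫⁻ s in Icc (0 : ℝ) 1, ∫⁻ x, ‖alignedForcing v R s x * v (3 - s, x)‖ₑ := by
        refine setLIntegral_mono' measurableSet_Icc fun s hs => ?_
        obtain ⟨S, hSR, hS, rfl, hSa⟩ := h (3 - s) ⟨by linarith [hs.2], by linarith [hs.1]⟩
        calc ENNReal.ofReal a * volume S = ∫⁻ _ in S, ENNReal.ofReal a := by simp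
          _ ≤ ∫⁻ x in S, ‖alignedForcing v R s x * v (3 - s, x)‖ₑ := by
              refine setLIntegral_mono' hS fun x hx => ?_
              rw [alignedForcing_mul hs (hSR hx), ← ofReal_norm, Complex.norm_real, norm_norm]
              exact ENNReal.ofReal_le_ofReal (hSa x hx)
          _ ≤ _ := setLIntegral_le_lintegral _ _
    _ ≤ _ := setLIntegral_le_lintegral _ _

end

/-! ### The dual use of the Strichartz estimate -/

/-- Hölder in x on the ball carrying F, giving its volume to the power 1 - 1/r, then monotonicity of
Lebesgue norms in time over [2,3], which has measure 1. -/
theorem lintegral_mul_reversed_le {n : ℕ} {F u : ℝ → EuclideanSpace ℝ (Fin n) → ℂ}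
    (hF : ∀ t x, ‖F t x‖ ≤ 1) (hs : ∀ s, s ∉ Icc (0 : ℝ) 1 → F s = 0) {ρ : ℝ} (hρ : 0 < ρ)
    (hx : ∀ t x, x ∉ Metric.ball 0 ρ → F t x = 0) {w : ℝ × EuclideanSpace ℝ (Fin n) → ℂ}
    (hw : Measurable w) (hu : ∀ t ∈ Icc (2 : ℝ) 3, u t =ᵐ[volume] fun x => w (t, x))
    {q r : ℝ≥0∞} (hq : 1 ≤ q) (hr : 1 ≤ r) :
    ∫⁻ p : ℝ × EuclideanSpace ℝ (Fin n), ‖F p.1 p.2 * w (3 - p.1, p.2)‖ₑ ≤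
      volume (Metric.ball (0 : EuclideanSpace ℝ (Fin n)) ρ) ^ (1 - (r⁻¹).toReal) *
        mixedNorm q r u := by
  set B := Metric.ball (0 : EuclideanSpace ℝ (Fin n)) ρ with hB
  set V := volume B ^ (1 - (r⁻¹).toReal) with hV
  have hB0 : volume B ≠ 0 := (Metric.measure_ball_pos _ _ hρ).ne'
  have hBt : volume B ≠ ∞ := measure_ball_lt_top.ne
  have hV0 : V ≠ 0 := (ENNReal.rpow_pos (pos_iff_ne_zero.2 hB0) hBt).ne'
  have hVt : V ≠ ∞ := ENNReal.rpow_ne_top_of_nonneg (by linarith [(toReal_inv_mem_Icc hr).2]) hBt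
  -- No measurability of t ↦ ‖u(t)‖_r is assumed. The comparison of time exponents is made for this
  -- minorant, measurable by Tonelli.
  set g : ℝ → ℝ≥0∞ := fun t => V⁻¹ * ∫⁻ x in B, ‖w (t, x)‖ₑ with hg
  have hgm : Measurable g := (Measurable.lintegral_prod_right' hw.enorm).const_mul _
  have hgle : ∀ t ∈ Icc (2 : ℝ) 3, g t ≤ eLpNorm (u t) r volume := by
    intro t ht
    rw [eLpNorm_congr_ae (hu t ht), hg]
    have h1 : AEStronglyMeasurable (fun x => w (t, x)) (volume.restrict B) :=
      (hw.comp measurable_prodMk_left).aestronglyMeasurable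
    have h2 := eLpNorm_le_eLpNorm_mul_rpow_measure_univ hr h1
    rw [eLpNorm_one_eq_lintegral_enorm, Measure.restrict_apply_univ, ENNReal.toReal_one, div_one,
      one_div, ← ENNReal.toReal_inv, mul_comm] at h2
    have h3 := h2.trans (mul_le_mul_right (eLpNorm_mono_measure (fun x => w (t, x)) (p := r)
      (Measure.restrict_le_self (μ := volume) (s := B))) _)
    calc V⁻¹ * ∫⁻ x in B, ‖w (t, x)‖ₑ ≤ V⁻¹ * (V * eLpNorm (fun x => w (t, x)) r volume) :=
          mul_le_mul_right h3 _
      _ = _ := by rw [← mul_assoc, ENNReal.inv_mul_cancel hV0 hVt, one_mul]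
  have hprob : IsProbabilityMeasure (volume.restrict (Icc (2 : ℝ) 3)) :=
    ⟨by rw [Measure.restrict_apply_univ, Real.volume_Icc]; norm_num⟩
  have hgint : ∫⁻ t in Icc (2 : ℝ) 3, g t ≤ mixedNorm q r u := by
    calc ∫⁻ t in Icc (2 : ℝ) 3, g t = eLpNorm g 1 (volume.restrict (Icc (2 : ℝ) 3)) := by
          rw [eLpNorm_one_eq_lintegral_enorm]; simp
      _ ≤ eLpNorm g q (volume.restrict (Icc (2 : ℝ) 3)) :=
          eLpNorm_le_eLpNorm_of_exponent_le hq hgm.aestronglyMeasurable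
      _ ≤ eLpNorm (fun t => eLpNorm (u t) r volume) q (volume.restrict (Icc (2 : ℝ) 3)) := by
          refine eLpNorm_mono_enorm_ae ?_
          filter_upwards [ae_restrict_mem measurableSet_Icc] with t ht
          exact hgle t ht
      _ ≤ _ := eLpNorm_mono_measure _ (Measure.restrict_mono_set _ fun t ht => by
          have := ht.1; simp only [mem_Ioi]; linarith)
  have hkey : ∀ p : ℝ × EuclideanSpace ℝ (Fin n), ‖F p.1 p.2 * w (3 - p.1, p.2)‖ₑ ≤
      (Icc (0 : ℝ) 1 ×ˢ B).indicator (fun p => ‖w (3 - p.1, p.2)‖ₑ) p := by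
    intro p
    by_cases hp : p ∈ Icc (0 : ℝ) 1 ×ˢ B
    · rw [indicator_of_mem hp, enorm_mul]
      refine mul_le_of_le_one_left' ?_
      rw [← ofReal_norm]
      exact ENNReal.ofReal_le_one.2 (hF _ _)
    · have : F p.1 p.2 = 0 := by
        by_cases h1 : p.1 ∈ Icc (0 : ℝ) 1
        · exact hx _ _ fun h2 => hp ⟨h1, h2⟩
        · rw [hs _ h1, Pi.zero_apply]
      simp [this]
  have hwr : Measurable fun p : ℝ × EuclideanSpace ℝ (Fin n) => ‖w (3 - p.1, p.2)‖ₑ :=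
    (hw.comp (by fun_prop : Measurable fun p : ℝ × EuclideanSpace ℝ (Fin n) =>
      (3 - p.1, p.2))).enorm
  calc _ ≤ ∫⁻ p in Icc (0 : ℝ) 1 ×ˢ B, ‖w (3 - p.1, p.2)‖ₑ := by
        rw [← lintegral_indicator (measurableSet_Icc.prod measurableSet_ball)]
        exact lintegral_mono hkey
    _ = ∫⁻ s in Icc (0 : ℝ) 1, ∫⁻ x in B, ‖w (3 - s, x)‖ₑ := by
        rw [Measure.volume_eq_prod, ← Measure.prod_restrict, lintegral_prod _ hwr.aemeasurable]
    _ = ∫⁻ s, (Icc (2 : ℝ) 3).indicator (fun t => ∫⁻ x in B, ‖w (t, x)‖ₑ) (3 - s) := by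
        rw [← lintegral_indicator measurableSet_Icc]
        refine lintegral_congr fun s => ?_
        by_cases h : s ∈ Icc (0 : ℝ) 1
        · have h' : 3 - s ∈ Icc (2 : ℝ) 3 := ⟨by linarith [h.2], by linarith [h.1]⟩
          rw [indicator_of_mem h, indicator_of_mem h']
        · rw [indicator_of_notMem h, indicator_of_notMem fun h' => h
            ⟨by linarith [h'.2], by linarith [h'.1]⟩]
    _ = ∫⁻ t in Icc (2 : ℝ) 3, V * g t := by
        rw [lintegral_sub_left_eq_self (fun t => (Icc (2 : ℝ) 3).indicator
          (fun t => ∫⁻ x in B, ‖w (t, x)‖ₑ) t) 3, lintegral_indicator measurableSet_Icc]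
        refine lintegral_congr fun t => ?_
        rw [hg, ← mul_assoc, ENNReal.mul_inv_cancel hV0 hVt, one_mul]
    _ = V * ∫⁻ t in Icc (2 : ℝ) 3, g t := lintegral_const_mul _ hgm
    _ ≤ _ := mul_le_mul_right hgint _

theorem conjExponent_ne_zero (p : ℝ≥0∞) : p.conjExponent ≠ 0 := by
  simp [ENNReal.conjExponent]

theorem mul_volume_rpow_le_mixedNorm {n : ℕ} (hn : 1 ≤ n) {η N a : ℝ} (hN : 1 ≤ N)
    (hη : η ≤ 1 / 4) (ha : 0 ≤ a) {v : ℝ × EuclideanSpace ℝ (Fin n) → ℂ}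
    (hv : ∀ p ∈ shellRegion n η N, a ≤ ‖v p‖) {u : ℝ → EuclideanSpace ℝ (Fin n) → ℂ}
    (hu : ∀ t ∈ Icc (2 : ℝ) 3, u t =ᵐ[volume] fun x => v (t, x)) {q r : ℝ≥0∞} (hq : 1 ≤ q)
    (hr : 1 ≤ r) :
    ENNReal.ofReal a *
      volume (Metric.ball (0 : EuclideanSpace ℝ (Fin n)) (N / 4)) ^ (r⁻¹).toReal ≤
      mixedNorm q r u := by
  refine le_eLpNorm_time_of_forall_mem (fun t ht => ?_) (zero_lt_one.trans_le hq).ne'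
  obtain ⟨x, hx⟩ := exists_ball_subset_shell hn hN hη ht
  have h4 : 0 < N / 4 := by positivity
  have h := le_eLpNorm_of_forall_mem (μ := volume) (measurableSet_ball (x := x) (ε := N / 4))
    (Metric.measure_ball_pos _ _ h4).ne' ha
    (Eventually.of_forall fun y hy => hv _ (hx y hy)) (zero_lt_one.trans_le hr).ne'
  rwa [one_div, ← ENNReal.toReal_inv, Measure.addHaar_ball_center, ← eLpNorm_congr_ae (hu t ht)]
    at h

theorem norm_lt_of_mem_shellRegion {n : ℕ} {η N : ℝ} (hη : 0 < η) (hN : 0 < N)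
    {p : ℝ × EuclideanSpace ℝ (Fin n)} (hp : p ∈ shellRegion n η N) : ‖p.2‖ < 6 * N := by
  have h1 : 0 < η * N⁻¹ := by positivity
  nlinarith [hp.2.2, hp.1.2]

/-- The hypothesis is applied to the forcing aligned with the reversed solution of F. By alignment
and symmetry, the L¹ mass of the solution of F on the shell is at most the pairing of F with the
solution of the aligned forcing, where Hölder and the estimate apply. No dual estimate is invoked.
-/
theorem mul_volume_le_of_strichartz {n : ℕ} (hn : 1 ≤ n) {η N a : ℝ} (hN : 1 ≤ N) (hη0 : 0 < η)
    (hη : η ≤ 1 / 4) {F : ℝ → EuclideanSpace ℝ (Fin n) → ℂ} (hF : IsForcing F)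
    (hF1 : ∀ t x, ‖F t x‖ ≤ 1) (hFs : ∀ s, s ∉ Icc (0 : ℝ) 1 → F s = 0) {ρ : ℝ} (hρ : 0 < ρ)
    (hFx : ∀ t x, x ∉ Metric.ball 0 ρ → F t x = 0)
    (hv : ∀ p ∈ shellRegion n η N, a ≤ ‖freeSolution n F p‖)
    {q r qt rt : ℝ≥0∞} (hq : 1 ≤ q) (hr : 1 ≤ r) (hrt : 1 ≤ rt) {C : ℝ≥0∞}
    (hC : ∀ G : ℝ → EuclideanSpace ℝ (Fin n) → ℂ, IsForcing G →
      ∀ u : ℝ → L2Space n, IsSchrodingerSolution G u →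
        mixedNorm q r (fun t => (u t : EuclideanSpace ℝ (Fin n) → ℂ))
          ≤ C * mixedNorm qt.conjExponent rt.conjExponent G) :
    ENNReal.ofReal a * volume (Metric.ball (0 : EuclideanSpace ℝ (Fin n)) (N / 4)) ≤
      volume (Metric.ball (0 : EuclideanSpace ℝ (Fin n)) ρ) ^ (1 - (r⁻¹).toReal) *
        (C * volume (Metric.ball (0 : EuclideanSpace ℝ (Fin n)) (6 * N)) ^
          (1 - (rt⁻¹).toReal)) := by
  have hN0 : 0 < N := zero_lt_one.trans_le hN
  have hG : IsForcing (alignedForcing (freeSolution n F) (6 * N)) :=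
    isForcing_alignedForcing hF.measurable_freeSolution
  have hGs := alignedForcing_eq_zero (v := freeSolution n F) (R := 6 * N)
  have hint := integrable_mul_freeSolution hG hF hGs hFs
  have hS : ∀ t ∈ Icc (2 : ℝ) 3, ∃ S ⊆ Metric.ball (0 : EuclideanSpace ℝ (Fin n)) (6 * N),
      MeasurableSet S ∧
        volume S = volume (Metric.ball (0 : EuclideanSpace ℝ (Fin n)) (N / 4)) ∧
        ∀ x ∈ S, a ≤ ‖freeSolution n F (t, x)‖ := by
    intro t ht
    obtain ⟨x, hx⟩ := exists_ball_subset_shell hn hN hη ht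
    refine ⟨Metric.ball x (N / 4), fun y hy => ?_, measurableSet_ball,
      Measure.addHaar_ball_center _ _ _, fun y hy => hv _ (hx y hy)⟩
    have hy' : ‖y‖ < 6 * N := norm_lt_of_mem_shellRegion (p := (t, y)) hη0 hN0 (hx y hy)
    rwa [mem_ball_zero_iff]
  have h1 := le_lintegral_alignedForcing_mul hint hS
  rw [← enorm_integral_alignedForcing_mul hint, integral_mul_freeSolution_comm hG hF hGs hFs] at h1
  obtain ⟨u, hu⟩ : ∃ u : ℝ → L2Space n,
      IsSchrodingerSolution (alignedForcing (freeSolution n F) (6 * N)) u :=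
    ⟨_, hG.isSchrodingerSolution⟩
  have hu' : ∀ t ∈ Icc (2 : ℝ) 3, u t =ᵐ[volume] fun x =>
      freeSolution n (alignedForcing (freeSolution n F) (6 * N)) (t, x) :=
    fun t ht => hu.ae_eq_freeSolution hG hGs ht.1
  have h2 := lintegral_mul_reversed_le hF1 hFs hρ hFx hG.measurable_freeSolution hu' hq hr
  have h3 : mixedNorm qt.conjExponent rt.conjExponent (alignedForcing (freeSolution n F) (6 * N)) ≤
      volume (Metric.ball (0 : EuclideanSpace ℝ (Fin n)) (6 * N)) ^ (1 - (rt⁻¹).toReal) := by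
    rw [← one_div_toReal_conjExponent hrt]
    exact mixedNorm_le_of_norm_le_one norm_alignedForcing_le_one hGs (by positivity)
      alignedForcing_eq_zero_of_notMem_ball (conjExponent_ne_zero _) (conjExponent_ne_zero _)
  have h4 := (hC _ hG _ hu).trans (mul_le_mul_right h3 C)
  exact (h1.trans (enorm_integral_le_lintegral_enorm _)).trans (h2.trans (mul_le_mul_right h4 _))

/-! ### Bookkeeping of powers of N -/

theorem pow_mul_rpow {N a : ℝ} (hN : 0 < N) (ha : 0 ≤ a) (n : ℕ) (s : ℝ) :
    (N ^ n * a) ^ s = N ^ (n * s) * a ^ s := by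
  rw [Real.mul_rpow (by positivity) ha, ← Real.rpow_natCast, ← Real.rpow_mul hN.le]

theorem inv_pow_mul_rpow {N a : ℝ} (hN : 0 < N) (ha : 0 ≤ a) (n : ℕ) (s : ℝ) :
    (N⁻¹ ^ n * a) ^ s = N ^ (-(n * s)) * a ^ s := by
  rw [pow_mul_rpow (inv_pos.2 hN) ha, Real.inv_rpow hN.le, Real.rpow_neg hN.le]

theorem volume_ball_rpow {n : ℕ} {ρ b : ℝ} (hρ : 0 < ρ)
    (hb : ρ ^ n * volume.real (Metric.ball (0 : EuclideanSpace ℝ (Fin n)) 1) = b) (s : ℝ) :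
    volume (Metric.ball (0 : EuclideanSpace ℝ (Fin n)) ρ) ^ s = ENNReal.ofReal (b ^ s) := by
  have := volume_real_unitBall_pos n
  rw [volume_ball_eq _ hρ, hb, ENNReal.ofReal_rpow_of_pos (by rw [← hb]; positivity)]

/-- Together with the lower bound `min_one_le_rpow`, this removes the exponents from the volume
constants, so that c in (a) depends on n alone. -/
theorem rpow_le_max_one {x s : ℝ} (hx : 0 < x) (hs : s ∈ Icc (0 : ℝ) 1) : x ^ s ≤ max 1 x := by
  rcases le_total x 1 with h | h
  · exact (Real.rpow_le_one hx.le h hs.1).trans (le_max_left _ _)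
  · exact ((Real.rpow_le_rpow_of_exponent_le h hs.2).trans (Real.rpow_one x).le).trans
      (le_max_right _ _)

theorem min_one_le_rpow {x s : ℝ} (hx : 0 < x) (hs : s ∈ Icc (0 : ℝ) 1) : min 1 x ≤ x ^ s := by
  rcases le_total x 1 with h | h
  · exact (min_le_right _ _).trans ((Real.rpow_one x).ge.trans
      (Real.rpow_le_rpow_of_exponent_ge hx h hs.2))
  · exact (min_le_left _ _).trans (Real.one_le_rpow h hs.1)

end

/-! ### Assembly: comparison of powers of N -/

theorem mainTheorem2 (n : ℕ) (hn : 1 ≤ n) :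
    (∃ η₀ : ℝ, 0 < η₀ ∧ ∃ N₀ : ℝ, 0 < N₀ ∧ ∃ c : ℝ, 0 < c ∧
      ∀ η : ℝ, 0 < η → η ≤ η₀ → ∀ N : ℝ, N₀ ≤ N →
        IsForcing (linearForcing n η N) ∧
        (∃ u : ℝ → L2Space n, IsSchrodingerSolution (linearForcing n η N) u) ∧
        ∀ u : ℝ → L2Space n, IsSchrodingerSolution (linearForcing n η N) u →
          (∃ v : ℝ × EuclideanSpace ℝ (Fin n) → ℂ,
            ContinuousOn v (Icc (2 : ℝ) 3 ×ˢ univ) ∧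
            (∀ t ∈ Icc (2 : ℝ) 3, ∀ᵐ x, u t x = v (t, x)) ∧
            ∀ p ∈ shellRegion n η N, c * η ^ n * (N ^ (1 + n))⁻¹ ≤ ‖v p‖) ∧
          ∀ q r qt rt : ℝ≥0∞, 1 ≤ q → 1 ≤ r → 1 ≤ qt → 1 ≤ rt →
            ENNReal.ofReal (c * η ^ ((n : ℝ) * (rt⁻¹).toReal)
                * N ^ ((n : ℝ) * (r⁻¹).toReal - (n : ℝ) * (rt⁻¹).toReal - 1))
              * mixedNorm qt.conjExponent rt.conjExponent (linearForcing n η N)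
            ≤ mixedNorm q r (fun t => (u t : EuclideanSpace ℝ (Fin n) → ℂ))) ∧
    ∀ q r qt rt : ℝ≥0∞, 1 ≤ q → 1 ≤ r → 1 ≤ qt → 1 ≤ rt →
      InhomogeneousStrichartz n q r qt rt →
        |(r⁻¹).toReal - (rt⁻¹).toReal| ≤ 1 / (n : ℝ) := by
  obtain ⟨η₁, hη₁, N₁, hN₁, c₁, hc₁, hlow⟩ := exists_freeSolution_lower_bound n
  set ω := volume.real (Metric.ball (0 : EuclideanSpace ℝ (Fin n)) 1) with hωdef
  have hω : 0 < ω := volume_real_unitBall_pos n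
  have hvol4 : ∀ N : ℝ, 0 < N → ∀ s : ℝ,
      volume (Metric.ball (0 : EuclideanSpace ℝ (Fin n)) (N / 4)) ^ s =
        ENNReal.ofReal (N ^ (n * s) * (ω / 4 ^ n) ^ s) := by
    intro N hN s
    rw [volume_ball_rpow (by positivity) rfl, ← pow_mul_rpow hN (by positivity)]
    congr 2; rw [div_pow]; ring
  have hvolη : ∀ η : ℝ, 0 < η → ∀ N : ℝ, 0 < N → ∀ s : ℝ,
      volume (Metric.ball (0 : EuclideanSpace ℝ (Fin n)) (η / N)) ^ s =
        ENNReal.ofReal (N ^ (-(n * s)) * (η ^ n * ω) ^ s) := by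
    intro η hη N hN s
    rw [volume_ball_rpow (by positivity) rfl, ← inv_pow_mul_rpow hN (by positivity)]
    congr 2; rw [div_eq_mul_inv, mul_pow]; ring
  have hvol6 : ∀ N : ℝ, 0 < N → ∀ s : ℝ,
      volume (Metric.ball (0 : EuclideanSpace ℝ (Fin n)) (6 * N)) ^ s =
        ENNReal.ofReal (N ^ (n * s) * (6 ^ n * ω) ^ s) := by
    intro N hN s
    rw [volume_ball_rpow (by positivity) rfl, ← pow_mul_rpow hN (by positivity)]
    congr 2; rw [mul_pow]; ring
  have hNpow : ∀ N : ℝ, 0 < N → (N ^ (1 + n))⁻¹ = N ^ (-(1 + n) : ℝ) := by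
    intro N hN
    rw [Real.rpow_neg hN.le, ← Real.rpow_natCast]; push_cast; rfl
  have hlinear : ∀ η : ℝ, 0 < η → ∀ N : ℝ, 0 < N → ∀ qt rt : ℝ≥0∞, 1 ≤ rt →
      mixedNorm qt.conjExponent rt.conjExponent (linearForcing n η N) ≤
        ENNReal.ofReal (N ^ (-(n * (1 - (rt⁻¹).toReal))) *
          (η ^ n * ω) ^ (1 - (rt⁻¹).toReal)) := by
    intro η hη N hN qt rt hrt
    rw [← hvolη η hη N hN, ← one_div_toReal_conjExponent hrt]
    exact mixedNorm_le_of_norm_le_one norm_linearForcing_le_one linearForcing_eq_zero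
      (div_pos hη hN) linearForcing_eq_zero_of_notMem_ball (conjExponent_ne_zero _)
      (conjExponent_ne_zero _)
  have hsol : ∀ η : ℝ, 0 < η → η ≤ min η₁ (1 / 4) → ∀ N : ℝ, max N₁ 1 ≤ N →
      ∀ u : ℝ → L2Space n, IsSchrodingerSolution (linearForcing n η N) u →
      ∀ q r : ℝ≥0∞, 1 ≤ q → 1 ≤ r →
      ENNReal.ofReal (c₁ * η ^ n * (ω / 4 ^ n) ^ (r⁻¹).toReal *
        N ^ (n * (r⁻¹).toReal - (1 + n))) ≤
      mixedNorm q r (fun t => (u t : EuclideanSpace ℝ (Fin n) → ℂ)) := by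
    intro η hη hη' N hN u hu q r hq hr
    have hN0 : 0 < N := zero_lt_one.trans_le ((le_max_right _ _).trans hN)
    refine le_trans (le_of_eq ?_) (mul_volume_rpow_le_mixedNorm hn ((le_max_right _ _).trans hN)
      (hη'.trans (min_le_right _ _)) (by positivity)
      (hlow η hη (hη'.trans (min_le_left _ _)) N ((le_max_left _ _).trans hN))
      (fun t ht => hu.ae_eq_freeSolution (isForcing_linearForcing n η N) linearForcing_eq_zero
        ht.1) hq hr)
    rw [hvol4 N hN0, ← ENNReal.ofReal_mul (by positivity), hNpow N hN0, sub_eq_add_neg,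
      Real.rpow_add hN0]
    congr 1; ring
  constructor
  -- The bounds η ≤ 1/4 and N ≥ 1 place a ball of radius N/4 in the shell. The minimum and maximum
  -- in c absorb (ω/4^n)^{1/r} and ω^{1-1/r̃} for all exponents at once.
  · refine ⟨min η₁ (1 / 4), by positivity, max N₁ 1, by positivity,
      c₁ * min 1 (ω / 4 ^ n) / max 1 ω, by positivity, fun η hη hη' N hN =>
      ⟨isForcing_linearForcing n η N, ⟨_, (isForcing_linearForcing n η N).isSchrodingerSolution⟩,
        fun u hu => ⟨⟨freeSolution n (linearForcing n η N), ?_, fun t ht => ?_, fun p hp => ?_⟩,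
          fun q r qt rt hq hr _ hrt => ?_⟩⟩⟩
    · exact (continuousOn_freeSolution (isForcing_linearForcing n η N) linearForcing_eq_zero).mono
        (prod_mono Icc_subset_Ici_self Subset.rfl)
    · exact hu.ae_eq_freeSolution (isForcing_linearForcing n η N) linearForcing_eq_zero ht.1
    · have hN0 : 0 < N := zero_lt_one.trans_le ((le_max_right _ _).trans hN)
      refine le_trans ?_ (hlow η hη (hη'.trans (min_le_left _ _)) N ((le_max_left _ _).trans hN)
        p hp)
      have : c₁ * min 1 (ω / 4 ^ n) / max 1 ω ≤ c₁ := by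
        rw [div_le_iff₀ (by positivity)]
        exact mul_le_mul_of_nonneg_left ((min_le_left _ _).trans (le_max_left _ _)) hc₁.le
      gcongr
    · have hN0 : 0 < N := zero_lt_one.trans_le ((le_max_right _ _).trans hN)
      set α := (r⁻¹).toReal with hα
      set β := (rt⁻¹).toReal with hβ
      have hαI := toReal_inv_mem_Icc hr
      have hβI := toReal_inv_mem_Icc hrt
      refine (mul_le_mul_right (hlinear η hη N hN0 qt rt hrt) _).trans
        (le_trans ?_ (hsol η hη hη' N hN u hu q r hq hr))
      rw [← ENNReal.ofReal_mul (by positivity)]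
      refine ENNReal.ofReal_le_ofReal ?_
      have h1 := rpow_le_max_one hω (s := 1 - β) ⟨by linarith [hβI.2], by linarith [hβI.1]⟩
      have h2 := min_one_le_rpow (x := ω / 4 ^ n) (by positivity) hαI
      have h3 : c₁ * min 1 (ω / 4 ^ n) / max 1 ω * ω ^ (1 - β) ≤ c₁ * (ω / 4 ^ n) ^ α := by
        rw [div_mul_eq_mul_div, div_le_iff₀ (by positivity)]
        gcongr
      have hηe : η ^ (n * β) * η ^ (n * (1 - β)) = η ^ n := by
        rw [← Real.rpow_add hη, ← Real.rpow_natCast]; congr 1; ring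
      have hNe : N ^ (n * α - n * β - 1) * N ^ (-(n * (1 - β))) = N ^ (n * α - (1 + n)) := by
        rw [← Real.rpow_add hN0]; congr 1; ring
      calc _ = (c₁ * min 1 (ω / 4 ^ n) / max 1 ω * ω ^ (1 - β)) *
            ((η ^ (n * β) * η ^ (n * (1 - β))) *
              (N ^ (n * α - n * β - 1) * N ^ (-(n * (1 - β))))) := by
            rw [pow_mul_rpow hη hω.le]; ring
        _ ≤ (c₁ * (ω / 4 ^ n) ^ α) * (η ^ n * N ^ (n * α - (1 + n))) := by
            rw [hηe, hNe]; gcongr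
        _ = _ := by ring
  · rintro q r qt rt hq hr - hrt ⟨C, hC⟩
    set α := (r⁻¹).toReal with hα
    set β := (rt⁻¹).toReal with hβ
    obtain ⟨η, hη, hη'⟩ : ∃ η : ℝ, 0 < η ∧ η ≤ min η₁ (1 / 4) := ⟨_, by positivity, le_rfl⟩
    have hC0 : (C : ℝ≥0∞) = ENNReal.ofReal C := (ENNReal.ofReal_coe_nnreal).symm
    -- The forcing F_l itself, with η fixed: the lower bound for its solution contradicts the
    -- estimate as N → ∞ unless this exponent of N is nonpositive.
    have h1 : n * α - n * β - 1 ≤ 0 := by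
      refine nonpos_of_mul_rpow_le (a := c₁ * η ^ n * (ω / 4 ^ n) ^ α)
        (b := C * (η ^ n * ω) ^ (1 - β)) (N₀ := max N₁ 1) (by positivity) fun N hN => ?_
      have hN0 : 0 < N := zero_lt_one.trans_le ((le_max_right _ _).trans hN)
      have hF := isForcing_linearForcing n η N
      have h := ((hsol η hη hη' N hN _ hF.isSchrodingerSolution q r hq hr).trans
        (hC _ hF _ hF.isSchrodingerSolution)).trans
          (mul_le_mul_right (hlinear η hη N hN0 qt rt hrt) _)
      rw [hC0, ← ENNReal.ofReal_mul (by positivity),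
        ENNReal.ofReal_le_ofReal_iff (by positivity)] at h
      have hNe : N ^ (n * α - n * β - 1) * N ^ (-(n * (1 - β))) = N ^ (n * α - (1 + n)) := by
        rw [← Real.rpow_add hN0]; congr 1; ring
      rw [← hNe] at h
      have hpos : 0 < N ^ (-(n * (1 - β))) := by positivity
      refine le_of_mul_le_mul_right (h.trans_eq' ?_ |>.trans_eq ?_) hpos <;> ring
    -- The dual test: N^{-(1+n)} N^n is at most a constant times N^{-n(1-α)} N^{n(1-β)} for all
    -- large N, so -1 ≤ nα - nβ.
    have h2 : n * β - n * α - 1 ≤ 0 := by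
      refine nonpos_of_mul_rpow_le (a := c₁ * η ^ n * (ω / 4 ^ n))
        (b := C * (η ^ n * ω) ^ (1 - α) * (6 ^ n * ω) ^ (1 - β)) (N₀ := max N₁ 1)
        (by positivity) fun N hN => ?_
      have hN0 : 0 < N := zero_lt_one.trans_le ((le_max_right _ _).trans hN)
      have h := mul_volume_le_of_strichartz hn ((le_max_right _ _).trans hN) hη
        (hη'.trans (min_le_right _ _)) (isForcing_linearForcing n η N) norm_linearForcing_le_one
        linearForcing_eq_zero (div_pos hη hN0) linearForcing_eq_zero_of_notMem_ball
        (hlow η hη (hη'.trans (min_le_left _ _)) N ((le_max_left _ _).trans hN)) hq hr hrt hC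
      rw [← ENNReal.rpow_one (volume (Metric.ball _ (N / 4))), hvol4 N hN0, hvolη η hη N hN0,
        hvol6 N hN0, hC0, ← ENNReal.ofReal_mul (by positivity),
        ← ENNReal.ofReal_mul (by positivity), ← ENNReal.ofReal_mul (by positivity),
        ENNReal.ofReal_le_ofReal_iff (by positivity), hNpow N hN0, Real.rpow_one] at h
      have hNe : N ^ (n * β - n * α - 1) * (N ^ (-(n * (1 - α))) * N ^ (n * (1 - β))) =
          N ^ (-(1 + n) : ℝ) * N ^ ((n : ℝ) * 1) := by
        rw [← Real.rpow_add hN0, ← Real.rpow_add hN0, ← Real.rpow_add hN0]; congr 1; ring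
      have hpos : 0 < N ^ (-(n * (1 - α))) * N ^ (n * (1 - β)) := by positivity
      refine le_of_mul_le_mul_right ?_ hpos
      rw [mul_assoc _ (N ^ (n * β - n * α - 1)), hNe]
      refine (h.trans_eq' ?_ |>.trans_eq ?_) <;> ring
    have hn0 : (0 : ℝ) < n := by exact_mod_cast hn
    rw [abs_le, le_div_iff₀ hn0]
    constructor
    · rw [neg_div', div_le_iff₀ hn0]; linarith
    · linarith
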